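/- **Setting.** Let $M$ be a compact smooth manifold with two commuting smooth vector fields $v,w$, and suppose that $v=\operatorname{grad} f_v$ and $w=\operatorname{grad} f_w$ for smooth functions $f_v,f_w$ and one common Riemannian metric. The 0-, 1- and 2-dimensional orbits of the pair $(v,w)$ are called *critical points*, *critical edges* and *leaves*. Assume that the critical points are isolated, that at each of them both fields are linear and diagonal in a common local chart, and that the critical edges are isolated. The *frame* of a leaf is the set of critical edges contained in its closure (with the cyclic order of their directions). A *direction* of a critical edge is a nonzero vector $(a,b)\in\mathbb R^2$ such that $bv-aw$ vanishes on the edge. The *outward normal* of a leaf $L$ at an edge $c$ of its frame is the unit vector $u\in\mathbb R^2$ orthogonal to the direction of $c$ such that, for $F=(f_v,f_w)\colon M\to\mathbb R^2$, one has $\langle u,F(x)\rangle<\langle u,F(q)\rangle$ for all $x\in L$, $q\in c$. **Degeneration.** A sequence of leaves $\Lambda_1,\Lambda_2,\dots$ with the same frame $f$ *degenerates* to the union of the distinct leaves $L_1,\dots,L_k$ if the closures $\overline{\Lambda_m}$ converge in the Hausdorff sense to $\overline{L_1}\cup\dots\cup\overline{L_k}$ and this union is homeomorphic to a closed disk. The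 frames of $L_1,\dots,L_k$ then form a *subdivision* of $f$. **Graphs with directions and webs.** A finite family of nonzero vectors of $\mathbb R^2$ *forms a toric fan* if they span pairwise distinct rays which cut the plane into angles less than $\pi$. A *graph with directions* is a graph with finitely many finite vertices, a special vertex $\infty$ and a direction in $\mathbb R^2$ for each oriented edge, such that reversing an edge negates its direction and the directions of the outgoing edges of every vertex, including $\infty$, form a toric fan. It is *realizable* if there is a web corresponding to it, that is, a drawing in the plane with its finite vertices at distinct points, edges between finite vertices drawn as straight segments and edges to $\infty$ as rays, all in the prescribed oriented directions, such that distinct edges have disjoint relative interiors and no vertex lies in the relative interior of an edge. The *dual graph* of the subdivision has finite vertices $1,\dots,k$; an edge between $i\ne j$ for every critical edge common to the frames of $L_i$ and $L_j$; and an edge between $i$ and $\infty$ for every critical edge common to the frame of $L_i$ and $f$. The direction of an edge leaving $i$ is the outward normal of $L_i$ at the corresponding critical edge; the direction of an edge from $\infty$ to $i$ is minus that normal. **Lemma 5.9.** If a sequence of leaves with common frame $f$ degenerates to the union of the leaves $L_1,\dots,L_k$, then the dual graph of the resulting subdivision is a graph with directions, and it is realizable by a web. -/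

import Mathlib

open scoped Manifold ContDiff Topology

noncomputable section

namespace TwoMorse

/-- The Euclidean plane. It is the plane of times `(s, t)` of the two vector fields, in which webs
are drawn, and also the plane of values of the two potentials. -/
abbrev Plane : Type := EuclideanSpace ℝ (Fin 2)

/-! ## Toric fans, graphs with directions and webs -/

/-- A finite family of vectors spans the rays of a toric fan: the rays are pairwise distinct and
cut the plane into angles less than `π`, that is, every open half-plane bounded by a line through
the origin contains one of them. -/
structure IsToricFan {ι : Type*} (d : ι → Plane) : Prop where
  finite : Finite ι
  ne_zero : ∀ a, d a ≠ 0
  distinct : ∀ a b, a ≠ b → ¬ SameRay ℝ (d a) (d b)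
  angle_lt_pi : ∀ u : Plane, u ≠ 0 → ∃ a, 0 < inner ℝ u (d a)

/-- The raw data of a graph with directions. The vertices are the finite vertices `some i`, for
`i : V`, and the special vertex infinity, `none`. Every edge occurs in `E` with its two orientations,
which are exchanged by `rev`. -/
structure DirGraph where
  V : Type
  E : Type*
  src : E → Option V
  rev : E → E
  rev_rev : ∀ e, rev (rev e) = e
  rev_ne : ∀ e, rev e ≠ e
  dir : E → Plane

namespace DirGraph

/-- The two axioms of a graph with directions: changing the orientation of an edge changes its
direction to the opposite, and the directions of the outgoing edges of every vertex, including
infinity, form a toric fan. -/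
structure IsGraphWithDirections (G : DirGraph) : Prop where
  finite_vertices : Finite G.V
  dir_rev : ∀ e, G.dir (G.rev e) = - G.dir e
  fan : ∀ a : Option G.V, IsToricFan (fun e : {e : G.E // G.src e = a} => G.dir e)

/-- The part of the plane (end points excluded) covered by the edge `e` when the finite vertices
are put at the points `y i`: an open segment, or an open ray for an edge that goes to infinity. -/
def edgeInterior (G : DirGraph) (y : G.V → Plane) (e : G.E) : Set Plane :=
  match G.src e, G.src (G.rev e) with
  | some i, some j => openSegment ℝ (y i) (y j)
  | some i, none => {z | ∃ r : ℝ, 0 < r ∧ z = y i + r • G.dir e}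
  | none, some j => {z | ∃ r : ℝ, 0 < r ∧ z = y j + r • G.dir (G.rev e)}
  | none, none => ∅

/-- `y` gives the vertices of a web with underlying graph with directions `G`: a drawing of `G`
in the plane, with straight edges (segments, and rays to infinity) in the prescribed oriented
directions, which meet only at common end points. The fans of the web at its vertices and at
infinity are those of `G`. -/
structure IsWeb (G : DirGraph) (y : G.V → Plane) : Prop where
  isGraph : G.IsGraphWithDirections
  injective : Function.Injective y
  edge_dir : ∀ e i j, G.src e = some i → G.src (G.rev e) = some j →
    ∃ r : ℝ, 0 < r ∧ y j - y i = r • G.dir e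
  edge_disjoint : ∀ e e', e' ≠ e → e' ≠ G.rev e →
    Disjoint (G.edgeInterior y e) (G.edgeInterior y e')
  vertex_notMem_edge : ∀ e i, y i ∉ G.edgeInterior y e

/-- A graph with directions is realizable if there is a web corresponding to it. -/
def Realizable (G : DirGraph) : Prop := ∃ y : G.V → Plane, G.IsWeb y

end DirGraph

/-! ## Pairs of commuting gradient vector fields -/

section Fields

variable {n : ℕ} {M : Type*} [TopologicalSpace M] [ChartedSpace (EuclideanSpace ℝ (Fin n)) M]

/-- `γ (s, t)` is moved by `v` with respect to the time `s` and by `w` with respect to the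
time `t`. -/
def IsJointIntegral (v w : (x : M) → TangentSpace (𝓡 n) x) (γ : ℝ → ℝ → M) : Prop :=
  (∀ t, IsMIntegralCurve (I := 𝓡 n) (fun s => γ s t) v) ∧
    ∀ s, IsMIntegralCurve (I := 𝓡 n) (fun t => γ s t) w

/-- `S` is a `d`-dimensional orbit of the pair `v`, `w` of commuting vector fields. -/
def IsOrbit (v w : (x : M) → TangentSpace (𝓡 n) x) (d : ℕ) (S : Set M) : Prop :=
  (∃ γ : ℝ → ℝ → M, IsJointIntegral v w γ ∧ S = {x | ∃ s t, x = γ s t}) ∧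
    ∀ x ∈ S, Module.finrank ℝ (Submodule.span ℝ ({v x, w x} : Set (TangentSpace (𝓡 n) x))) = d

/-- Critical points are the common zeros of the two fields, i.e. the 0-dimensional orbits. -/
def IsCriticalPoint (v w : (x : M) → TangentSpace (𝓡 n) x) (p : M) : Prop :=
  v p = 0 ∧ w p = 0

/-- Critical edges are the 1-dimensional orbits. -/
def IsCriticalEdge (v w : (x : M) → TangentSpace (𝓡 n) x) (c : Set M) : Prop := IsOrbit v w 1 c

/-- Leaves are the 2-dimensional orbits. -/
def IsLeaf (v w : (x : M) → TangentSpace (𝓡 n) x) (S : Set M) : Prop := IsOrbit v w 2 S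

/-- The vector field `v` is the gradient of the function `f` with respect to the metric `g`. -/
def IsGradient [IsManifold (𝓡 n) ∞ M]
    (g : Bundle.ContMDiffRiemannianMetric (𝓡 n) ∞ (EuclideanSpace ℝ (Fin n))
      (fun x : M => TangentSpace (𝓡 n) x))
    (f : M → ℝ) (v : (x : M) → TangentSpace (𝓡 n) x) : Prop :=
  ContMDiff (𝓡 n) 𝓘(ℝ, ℝ) ∞ f ∧
    ∀ (x : M) (u : TangentSpace (𝓡 n) x),
      (mfderiv (𝓡 n) 𝓘(ℝ, ℝ) f x u : ℝ) = g.inner x (v x) u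

/-- The geometric setting: smooth commuting vector fields `v`, `w`, which are the gradients of
`fv`, `fw` for a common Riemannian metric, with isolated critical points at which both fields are
simultaneously linear and diagonal in a suitable chart, and with isolated critical edges. -/
structure IsTwoMorsePair [IsManifold (𝓡 n) ∞ M]
    (v w : (x : M) → TangentSpace (𝓡 n) x) (fv fw : M → ℝ) : Prop where
  smooth_v : ContMDiff (𝓡 n) (𝓡 n).tangent ∞ (fun x => (⟨x, v x⟩ : TangentBundle (𝓡 n) M))
  smooth_w : ContMDiff (𝓡 n) (𝓡 n).tangent ∞ (fun x => (⟨x, w x⟩ : TangentBundle (𝓡 n) M))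
  commute : ∀ x, VectorField.mlieBracket (𝓡 n) v w x = 0
  gradient : ∃ g : Bundle.ContMDiffRiemannianMetric (𝓡 n) ∞ (EuclideanSpace ℝ (Fin n))
      (fun x : M => TangentSpace (𝓡 n) x), IsGradient g fv v ∧ IsGradient g fw w
  isolated_points : ∀ p, IsCriticalPoint v w p →
    ∃ U ∈ 𝓝 p, ∀ q ∈ U, IsCriticalPoint v w q → q = p
  linearization : ∀ p, IsCriticalPoint v w p →
    ∃ e ∈ IsManifold.maximalAtlas (𝓡 n) ∞ M, p ∈ e.source ∧ e p = 0 ∧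
      ∃ a b : Fin n → ℝ, ∀ x ∈ e.source,
        mfderiv (𝓡 n) (𝓡 n) e x (v x) = WithLp.toLp 2 (fun i => a i * e x i) ∧
        mfderiv (𝓡 n) (𝓡 n) e x (w x) = WithLp.toLp 2 (fun i => b i * e x i)
  isolated_edges : ∀ c, IsCriticalEdge v w c → ∀ x ∈ c,
    ∃ U ∈ 𝓝 x, ∀ c', IsCriticalEdge v w c' → (c' ∩ U).Nonempty → c' = c

/-- The frame bounding a leaf, recorded as the set of its critical edges: those contained in the
closure of the leaf. (Their cyclic order is that of their directions.) -/
def frame (v w : (x : M) → TangentSpace (𝓡 n) x) (L : Set M) : Set (Set M) :=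
  {c | IsCriticalEdge v w c ∧ c ⊆ closure L}

/-- `(d 0, d 1)` is, up to sign, a direction of the critical edge `c`: the field
`d 1 • v - d 0 • w` vanishes on `c`. -/
def IsEdgeDirection (v w : (x : M) → TangentSpace (𝓡 n) x) (c : Set M) (d : Plane) : Prop :=
  d ≠ 0 ∧ ∀ x ∈ c, d 1 • v x - d 0 • w x = 0

/-- The projection of `M` to the plane given by the two potentials. -/
def proj (fv fw : M → ℝ) (x : M) : Plane := !₂[fv x, fw x]

/-- `u` is the outward unit normal, at its side given by the critical edge `c`, of the polygon to
which the leaf `L` projects: it is orthogonal to the direction of `c`, and `L` projects into the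
open half-plane behind `c`. -/
def IsOutwardNormal (v w : (x : M) → TangentSpace (𝓡 n) x) (fv fw : M → ℝ)
    (L c : Set M) (u : Plane) : Prop :=
  ‖u‖ = 1 ∧ (∃ d, IsEdgeDirection v w c d ∧ inner ℝ u d = 0) ∧
    ∀ x ∈ L, ∀ q ∈ c, inner ℝ u (proj fv fw x) < inner ℝ u (proj fv fw q)

/-- The outward unit normal (unique when it exists). -/
def outwardNormal (v w : (x : M) → TangentSpace (𝓡 n) x) (fv fw : M → ℝ)
    (L c : Set M) : Plane :=
  Classical.epsilon (IsOutwardNormal v w fv fw L c)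

/-! ## Degenerations and dual graphs -/

/-- The sequence of leaves `Λ m` with common boundary `f` degenerates to the union of the distinct
leaves `L i`: the closures of the `Λ m` converge to the union of the closures of the `L i`
(as closed subsets of `M`, in the Vietoris sense, which for compact metrizable `M` is Hausdorff
convergence), and this union is still a topological disk. -/
structure Degenerates (v w : (x : M) → TangentSpace (𝓡 n) x) (f : Set (Set M))
    (Λ : ℕ → Set M) {k : ℕ} (L : Fin k → Set M) : Prop where
  leaf : ∀ m, IsLeaf v w (Λ m)
  boundary : ∀ m, frame v w (Λ m) = f
  limit_leaf : ∀ i, IsLeaf v w (L i)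
  distinct : Function.Injective L
  upper : ∀ U : Set M, IsOpen U → (⋃ i, closure (L i)) ⊆ U →
    ∀ᶠ m in Filter.atTop, closure (Λ m) ⊆ U
  lower : ∀ U : Set M, IsOpen U → ((⋃ i, closure (L i)) ∩ U).Nonempty →
    ∀ᶠ m in Filter.atTop, (closure (Λ m) ∩ U).Nonempty
  disk : Nonempty ((⋃ i, closure (L i) : Set M) ≃ₜ Metric.closedBall (0 : Plane) 1)

/-- The frame of a face of the subdivision; the exterior face `none` has the outer frame `f`. -/
def faceFrame (v w : (x : M) → TangentSpace (𝓡 n) x) (f : Set (Set M)) {k : ℕ}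
    (L : Fin k → Set M) : Option (Fin k) → Set (Set M)
  | some i => frame v w (L i)
  | none => f

/-- An oriented edge of the dual graph: it goes from the face `src` to another face `tgt` across a
critical edge `wall` which belongs to the frames of both. -/
@[ext] structure DualEdge (v w : (x : M) → TangentSpace (𝓡 n) x) (f : Set (Set M)) {k : ℕ}
    (L : Fin k → Set M) where
  src : Option (Fin k)
  tgt : Option (Fin k)
  wall : Set M
  ne : src ≠ tgt
  mem_src : wall ∈ faceFrame v w f L src
  mem_tgt : wall ∈ faceFrame v w f L tgt

/-- The direction of an oriented edge of the dual graph: the unit normal of the crossed critical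
edge that points from the face left to the face entered. -/
def DualEdge.dir {v w : (x : M) → TangentSpace (𝓡 n) x} {f : Set (Set M)} {k : ℕ}
    {L : Fin k → Set M} (fv fw : M → ℝ) (e : DualEdge v w f L) : Plane :=
  match e.src, e.tgt with
  | some i, _ => outwardNormal v w fv fw (L i) e.wall
  | none, some j => - outwardNormal v w fv fw (L j) e.wall
  | none, none => 0

/-- The dual graph with directions of the subdivision of the frame `f` given by the leaves `L i`:
finite vertices are the faces `L i`, edges between them are the critical edges common to two
frames, and edges to infinity are the edges of the outer frame. -/
def dualGraph (v w : (x : M) → TangentSpace (𝓡 n) x) (fv fw : M → ℝ) (f : Set (Set M)) {k : ℕ}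
    (L : Fin k → Set M) : DirGraph where
  V := Fin k
  E := DualEdge v w f L
  src e := e.src
  rev e := ⟨e.tgt, e.src, e.wall, e.ne.symm, e.mem_tgt, e.mem_src⟩
  rev_rev _ := rfl
  rev_ne e h := e.ne.symm (congrArg DualEdge.src h)
  dir e := e.dir fv fw

end Fields

end TwoMorse

end

/-! The two flows give an action of the plane of times whose potential F = (fv, fw) is strictly
monotone: if u moves x, then ⟨u, F(u·x) - F(x)⟩ > 0. On a leaf, τ ↦ F(τ·x) is injective, open and
monotone, and the range of an open monotone map is the interior of its convex hull. So a leaf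
projects homeomorphically onto an open convex set. F stays injective on the closure of the leaf,
because its fibres there are connected and a fibre off the leaf consists of isolated points. Hence
the boundary of the image is covered by the images of critical edges and of finitely many critical
points. The diagonal charts show that no critical point lies between two edges on one side, so
different edges have different outward normals (`IsNormal.eq_of_eq`). A generic ray leaves the image
through an edge, so every open half-plane contains a normal (`IsLeaf.exists_inner_pos`). These two
facts are the fan condition.

Leaves with the same frame have the same image P. The fibre argument, applied to the limit of the
leaves, shows that F is injective on the union of the closures of the limit leaves and maps it onto
the closure of P. The images of the limit leaves therefore tile P: an edge of a tile either belongs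
to the outer frame and to no other tile, or is shared with exactly one other tile, with the opposite
normal. This gives the axioms of a graph with directions.

The vertices of the web come from times. Take points of Λ m converging to a point of each L i, and
let y m i be the time that leads to them from a base point of Λ m. Times between points converging
inside one limit leaf converge. To pass from L i to L j across a common edge with normal n, follow
the one-parameter group of n, which fixes the edge. A local first integral stops the trajectory from
drifting along the edge, so it emerges in L j (`exists_crossing`). Thus y m j - y m i is β m • n
plus a convergent term, and β m → ∞, since no finite time leads from L i to L j. Linear algebra
(`exists_eq_zero_and_pos`) replaces this asymptotic solution by an exact one, in which y j - y i is
a positive multiple of n.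

Edges of the drawing do not cross because the y i behave like the gradients of a convex piecewise
linear function on the tiling: ⟨y j - y i, z' - z⟩ > 0 for z, z' in the tiles of i ≠ j
(`Degeneration.inner_pos`). This is seen by walking from z to z', where each crossed wall
contributes a positive term. The inequality extends to the points of the drawn edges. If two drawn
edges met, it would put their critical edges on a common line, and then make them equal
(`eq_of_crosses`). -/

noncomputable section

namespace TwoMorse

set_option linter.unusedSectionVars false

open Set Function Filter

/-! ### The global flow of a vector field on a compact manifold. -/

section Flow

variable {E : Type*} [NormedAddCommGroup E] [NormedSpace ℝ E] {H : Type*} [TopologicalSpace H]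
  {I : ModelWithCorners ℝ E H} {M : Type*} [TopologicalSpace M] [ChartedSpace H M]
  [IsManifold I 1 M]

/-- The vector field `v` in the preferred chart at `x₀`. -/
def chartField (I : ModelWithCorners ℝ E H) {M : Type*} [TopologicalSpace M] [ChartedSpace H M]
    [IsManifold I 1 M] (v : (x : M) → TangentSpace I x) (x₀ : M) (y : E) : E :=
  tangentCoordChange I ((extChartAt I x₀).symm y) x₀ ((extChartAt I x₀).symm y)
    (v ((extChartAt I x₀).symm y))

theorem contDiffAt_chartField [BoundarylessManifold I M] {v : (x : M) → TangentSpace I x} {x₀ : M}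
    (hv : CMDiffAt 1 (fun x ↦ (⟨x, v x⟩ : TangentBundle I M)) x₀) :
    ContDiffAt ℝ 1 (chartField I v x₀) (extChartAt I x₀ x₀) := by
  rw [contMDiffAt_iff] at hv
  exact (hv.2.contDiffAt
    (range_mem_nhds_isInteriorPoint BoundarylessManifold.isInteriorPoint)).snd

omit [IsManifold I 1 M] in
theorem hasDerivAt_of_hasMFDerivAt {f : ℝ → E} {t : ℝ} {D : ℝ →L[ℝ] E}
    (h : HasMFDerivAt 𝓘(ℝ, ℝ) 𝓘(ℝ, E) f t D) : HasDerivAt f (D 1) t := by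
  have h' : HasFDerivAt f D t := hasMFDerivAt_iff_hasFDerivAt.1 h
  exact h'.hasDerivAt

omit [IsManifold I 1 M] in
theorem hasMFDerivAt_of_hasDerivAt_chart_self {γ : ℝ → M} {t : ℝ} {X : E}
    (hc : ContinuousAt γ t) (h : HasDerivAt (extChartAt I (γ t) ∘ γ) X t) :
    HasMFDerivAt 𝓘(ℝ, ℝ) I γ t ((1 : ℝ →L[ℝ] ℝ).smulRight (X : TangentSpace I (γ t))) := by
  refine ⟨hc, ?_⟩
  have h' : HasFDerivWithinAt (extChartAt I (γ t) ∘ γ) ((1 : ℝ →L[ℝ] ℝ).smulRight X)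
      (range id) t := h.hasFDerivAt.hasFDerivWithinAt
  exact h'

/-- A curve which solves the equation in a chart is an integral curve. -/
theorem hasMFDerivAt_of_hasDerivAt_chart {v : (x : M) → TangentSpace I x} {x₀ : M} {f : ℝ → E}
    {t : ℝ} (hf : HasDerivAt f (chartField I v x₀ (f t)) t)
    (hf3 : f t ∈ interior (extChartAt I x₀).target) :
    HasMFDerivAt 𝓘(ℝ, ℝ) I ((extChartAt I x₀).symm ∘ f) t
      ((1 : ℝ →L[ℝ] ℝ).smulRight (v ((extChartAt I x₀).symm (f t)))) := by
  let xₜ : M := (extChartAt I x₀).symm (f t)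
  have h : HasDerivAt f (x := t) <| fderivWithin ℝ (extChartAt I x₀ ∘ (extChartAt I xₜ).symm)
    (range I) (extChartAt I xₜ xₜ) (v xₜ) := hf
  rw [← tangentCoordChange_def] at h
  have hf3' := mem_of_mem_of_subset hf3 interior_subset
  have hft1 := mem_preimage.mp <|
    mem_of_mem_of_subset hf3' (extChartAt I x₀).target_subset_preimage_source
  have hft2 := mem_extChartAt_source (I := I) xₜ
  refine hasMFDerivAt_of_hasDerivAt_chart_self
    ((continuousAt_extChartAt_symm'' hf3').comp h.continuousAt) ?_
  -- The coordinates in the chart at `x₀` are carried back to those of the chart at the moving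
  -- point, where a derivative is literally a tangent vector.
  have hback : ∀ V : E, tangentCoordChange I x₀ xₜ xₜ (tangentCoordChange I xₜ x₀ xₜ V) = V :=
    fun V => by
      rw [tangentCoordChange_comp ⟨⟨hft2, hft1⟩, hft2⟩, tangentCoordChange_self hft2]
  have h5 : HasDerivAt ((extChartAt I xₜ ∘ (extChartAt I x₀).symm) ∘ f)
      (tangentCoordChange I x₀ xₜ xₜ (tangentCoordChange I xₜ x₀ xₜ (v xₜ))) t := by
    apply HasFDerivAt.comp_hasDerivAt _ _ h
    apply HasFDerivWithinAt.hasFDerivAt (s := range I) _ <|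
      mem_nhds_iff.mpr ⟨interior (extChartAt I x₀).target,
        subset_trans interior_subset (extChartAt_target_subset_range ..),
        isOpen_interior, hf3⟩
    rw [← (extChartAt I x₀).right_inv hf3']
    exact hasFDerivWithinAt_tangentCoordChange ⟨hft1, hft2⟩
  exact h5.congr_deriv (hback _)

/-- An integral curve solves the equation in a chart. -/
theorem hasDerivAt_chart_of_hasMFDerivAt {v : (x : M) → TangentSpace I x} {x₀ : M} {γ : ℝ → M}
    {t : ℝ} (hγ : HasMFDerivAt 𝓘(ℝ, ℝ) I γ t ((1 : ℝ →L[ℝ] ℝ).smulRight (v (γ t))))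
    (hs : γ t ∈ (extChartAt I x₀).source) :
    HasDerivAt (extChartAt I x₀ ∘ γ) (chartField I v x₀ (extChartAt I x₀ (γ t))) t := by
  have hsrc := hs
  rw [extChartAt_source I x₀] at hsrc
  refine (hasDerivAt_of_hasMFDerivAt
    (HasMFDerivAt.comp t (hasMFDerivAt_extChartAt (I := I) hsrc) hγ)).congr_deriv ?_
  change mfderiv I I (chartAt H x₀) (γ t) ((1 : ℝ) • v (γ t)) = _
  rw [one_smul, mfderiv_chartAt_eq_tangentCoordChange hsrc, chartField,
    (extChartAt I x₀).left_inv hs]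
  rfl

variable [CompleteSpace E] [BoundarylessManifold I M]

/-- The Picard–Lindelöf theorem in a chart gives solutions that are jointly continuous in time and
initial value; this joint continuity is what the action of the plane needs later. -/
theorem exists_local_flow {v : (x : M) → TangentSpace I x}
    (hv : CMDiff 1 (fun x ↦ (⟨x, v x⟩ : TangentBundle I M))) (x₀ : M) :
    ∃ U ∈ 𝓝 x₀, ∃ ε > 0, ∃ ψ : ℝ → M → M, ContinuousOn (uncurry ψ) (Ioo (-ε) ε ×ˢ U) ∧
      ∀ x ∈ U, ψ 0 x = x ∧ IsMIntegralCurveOn (fun t => ψ t x) v (Ioo (-ε) ε) := by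
  have hf := contDiffAt_chartField (hv x₀)
  set e := extChartAt I x₀ with he
  set y₀ := e x₀ with hy₀
  obtain ⟨ε, hε, a, r, L, K, hr, hP⟩ := IsPicardLindelof.of_contDiffAt_one hf
  obtain ⟨α, hα, hαc⟩ := (hP 0).exists_forall_mem_closedBall_eq_hasDerivWithinAt_continuousOn
  simp only [zero_sub, zero_add] at hα hαc
  have hT : interior e.target ∈ 𝓝 y₀ := isOpen_interior.mem_nhds
    ((I.isInteriorPoint_iff).mp BoundarylessManifold.isInteriorPoint)
  have hnb : Metric.closedBall y₀ r ×ˢ Icc (-ε) ε ∈ 𝓝 (y₀, (0 : ℝ)) :=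
    prod_mem_nhds (Metric.closedBall_mem_nhds _ hr) (Icc_mem_nhds (by linarith) hε)
  have h0 : α (y₀, 0) = y₀ := (hα y₀ (Metric.mem_closedBall_self r.2)).1
  -- Time and neighbourhood are shrunk until the solutions stay in the chart, where they can be
  -- pulled back to the manifold.
  have hpre : α ⁻¹' interior e.target ∈ 𝓝 (y₀, (0 : ℝ)) :=
    (hαc.continuousAt hnb).preimage_mem_nhds (by rwa [h0])
  obtain ⟨V, hV, W, hW, hVW⟩ := mem_nhds_prod_iff.mp (inter_mem hpre hnb)
  obtain ⟨δ, hδ, hδW⟩ := Metric.mem_nhds_iff.mp hW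
  rw [Real.ball_eq_Ioo] at hδW
  simp only [zero_sub, zero_add] at hδW
  refine ⟨e.source ∩ e ⁻¹' V, inter_mem (extChartAt_source_mem_nhds x₀)
    ((continuousAt_extChartAt x₀).preimage_mem_nhds hV), δ, hδ,
    fun t x => e.symm (α (e x, t)), ?_, ?_⟩
  · have h1 : ContinuousOn (fun p : ℝ × M => (e p.2, p.1))
        (Ioo (-δ) δ ×ˢ (e.source ∩ e ⁻¹' V)) := by
      refine ContinuousOn.prodMk ?_ continuousOn_fst
      exact (continuousOn_extChartAt x₀).comp continuousOn_snd (fun p hp => hp.2.1)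
    refine (continuousOn_extChartAt_symm x₀).comp ((hαc.comp h1 ?_)) ?_
    · exact fun p hp => (hVW (mk_mem_prod hp.2.2 (hδW hp.1))).2
    · exact fun p hp => interior_subset (hVW (mk_mem_prod hp.2.2 (hδW hp.1))).1
  · intro x hx
    have hm : ∀ t ∈ Ioo (-δ) δ, α (e x, t) ∈ interior e.target ∧
        e x ∈ Metric.closedBall y₀ r ∧ t ∈ Icc (-ε) ε := fun t ht =>
      ⟨(hVW (mk_mem_prod hx.2 (hδW ht))).1, (hVW (mk_mem_prod hx.2 (hδW ht))).2⟩
    have h00 : (0 : ℝ) ∈ Ioo (-δ) δ := ⟨by linarith, hδ⟩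
    refine ⟨?_, fun t ht => HasMFDerivAt.hasMFDerivWithinAt ?_⟩
    · simp only [(hα _ (hm 0 h00).2.1).1, e.left_inv hx.1]
    · refine hasMFDerivAt_of_hasDerivAt_chart (x₀ := x₀) (f := fun t => α (e x, t)) ?_ (hm t ht).1
      have hsub : Ioo (-δ) δ ⊆ Icc (-ε) ε := fun s hs => (hm s hs).2.2
      exact ((hα _ (hm t ht).2.1).2 t (hm t ht).2.2).hasDerivAt
        (mem_of_superset (Ioo_mem_nhds ht.1 ht.2) hsub)

variable [T2Space M] [CompactSpace M]

/-- A `C¹` vector field on a compact manifold has a global continuous flow. -/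
theorem exists_continuous_flow {v : (x : M) → TangentSpace I x}
    (hv : CMDiff 1 (fun x ↦ (⟨x, v x⟩ : TangentBundle I M))) :
    ∃ φ : ℝ → M → M, Continuous (uncurry φ) ∧
      ∀ x, φ 0 x = x ∧ IsMIntegralCurve (fun t => φ t x) v := by
  choose U hU ε hε ψ hψc hψ using exists_local_flow hv
  obtain ⟨s, -, hs⟩ := isCompact_univ.elim_nhds_subcover (fun x => interior (U x))
    (fun x _ => isOpen_interior.mem_nhds (mem_interior_iff_mem_nhds.2 (hU x)))
  -- Compactness gives one time of existence for all initial points, which is what makes the curves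
  -- extend to all times.
  obtain ⟨δ, hδ, hδε⟩ : ∃ δ > 0, ∀ x ∈ s, δ ≤ ε x := by
    rcases s.eq_empty_or_nonempty with rfl | hne
    · exact ⟨1, one_pos, by simp⟩
    · exact ⟨s.inf' hne ε, (Finset.lt_inf'_iff hne).2 fun x _ => hε x,
        fun x hx => Finset.inf'_le _ hx⟩
  have hcov : ∀ x, ∃ y ∈ s, x ∈ interior (U y) := fun x => by
    simpa using hs (mem_univ x)
  have hglob : ∀ x : M, ∃ γ : ℝ → M, γ 0 = x ∧ IsMIntegralCurve γ v :=
    exists_isMIntegralCurve_of_isMIntegralCurveOn hv hδ fun x => by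
      obtain ⟨y, hy, hx'⟩ := hcov x
      have hx := interior_subset hx'
      exact ⟨fun t => ψ y t x, (hψ y x hx).1, (hψ y x hx).2.mono
        (Ioo_subset_Ioo (neg_le_neg (hδε y hy)) (hδε y hy))⟩
  choose γ hγ0 hγ using hglob
  have hadd : ∀ s t x, γ x (s + t) = γ (γ x t) s := fun s t x => by
    have := isMIntegralCurve_Ioo_eq_of_contMDiff_boundaryless (t₀ := 0) hv
      ((hγ x).comp_add t) (hγ (γ x t)) (by simp [hγ0])
    exact congrFun this s
  have hloc : ContinuousOn (fun p : ℝ × M => γ p.2 p.1) (Ioo (-δ) δ ×ˢ univ) := by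
    rintro ⟨t, x⟩ ⟨ht, -⟩
    obtain ⟨y, hy, hx⟩ : ∃ y ∈ s, U y ∈ 𝓝 x := by
      obtain ⟨y, hy, hx⟩ := hcov x
      exact ⟨y, hy, mem_interior_iff_mem_nhds.1 hx⟩
    have heq : ∀ z ∈ U y, EqOn (γ z) (fun t => ψ y t z) (Ioo (-δ) δ) := fun z hz =>
      isMIntegralCurveOn_Ioo_eqOn_of_contMDiff_boundaryless (t₀ := 0) ⟨by linarith, hδ⟩ hv
        ((hγ z).isMIntegralCurveOn _) ((hψ y z hz).2.mono
        (Ioo_subset_Ioo (neg_le_neg (hδε y hy)) (hδε y hy))) (by rw [hγ0, (hψ y z hz).1])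
    have hnb : Ioo (-δ) δ ×ˢ U y ∈ 𝓝 (t, x) := prod_mem_nhds (Ioo_mem_nhds ht.1 ht.2) hx
    have hsub : Ioo (-δ) δ ×ˢ U y ⊆ Ioo (-ε y) (ε y) ×ˢ U y :=
      prod_mono (Ioo_subset_Ioo (neg_le_neg (hδε y hy)) (hδε y hy)) subset_rfl
    have h1 := (hψc y).continuousAt (mem_of_superset hnb hsub)
    exact (h1.congr (mem_of_superset hnb fun p hp => (heq p.2 hp.2 hp.1).symm)).continuousWithinAt
  -- The map at time t is the map at time t/2 applied twice, so continuity spreads from the interval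
  -- of radius δ to those of radius 2^N δ.
  have hdouble : ∀ N : ℕ, ContinuousOn (fun p : ℝ × M => γ p.2 p.1)
      (Ioo (-(2 ^ N * δ)) (2 ^ N * δ) ×ˢ univ) := fun N => by
    induction N with
    | zero => simpa using hloc
    | succ N ih =>
      have h2 : ∀ p : ℝ × M, γ p.2 p.1 = γ (γ p.2 (p.1 / 2)) (p.1 / 2) := fun p => by
        rw [← hadd]; congr 1; ring
      have hm : MapsTo (fun p : ℝ × M => ((p.1 / 2, p.2) : ℝ × M))
          (Ioo (-(2 ^ (N + 1) * δ)) (2 ^ (N + 1) * δ) ×ˢ univ)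
          (Ioo (-(2 ^ N * δ)) (2 ^ N * δ) ×ˢ univ) := fun p hp => by
        have := hp.1
        rw [pow_succ] at this
        exact ⟨⟨by linarith [this.1], by linarith [this.2]⟩, mem_univ _⟩
      have hin : ContinuousOn (fun p : ℝ × M => ((p.1 / 2, p.2) : ℝ × M))
          (Ioo (-(2 ^ (N + 1) * δ)) (2 ^ (N + 1) * δ) ×ˢ univ) := by fun_prop
      refine (ih.comp ((hin.fst).prodMk (ih.comp hin hm)) ?_).congr fun p _ => h2 p
      exact fun p hp => ⟨(hm hp).1, mem_univ _⟩
  refine ⟨fun t x => γ x t, continuous_iff_continuousAt.2 ?_, fun x => ⟨hγ0 x, hγ x⟩⟩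
  rintro ⟨t, x⟩
  obtain ⟨N, hN⟩ := pow_unbounded_of_one_lt (|t| / δ) one_lt_two
  rw [div_lt_iff₀ hδ, abs_lt] at hN
  exact (hdouble N).continuousAt (prod_mem_nhds (Ioo_mem_nhds hN.1 hN.2) univ_mem)

end Flow

/-! ### The action of the plane in abstract form. -/

/-- A gradient-like action of the plane of times on the closed part `dom` of a space, together with
its potential `F`, with isolated fixed points, which are linearizable, and isolated
one-dimensional orbits. -/
structure PlaneAction (M : Type*) [TopologicalSpace M] where
  act : Plane → M → M
  F : M → Plane
  dom : Set M
  isClosed_dom : IsClosed dom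
  continuous_act : Continuous fun p : Plane × M => act p.1 p.2
  continuous_F : Continuous F
  act_mem : ∀ {x}, x ∈ dom → ∀ τ, act τ x ∈ dom
  act_zero : ∀ {x}, x ∈ dom → act 0 x = x
  act_add : ∀ {x}, x ∈ dom → ∀ σ τ, act (σ + τ) x = act σ (act τ x)
  mono : ∀ {x}, x ∈ dom → ∀ u, act u x ≠ x → 0 < inner ℝ u (F (act u x) - F x)
  act_smul : ∀ {x}, x ∈ dom → ∀ u, act u x = x → ∀ r : ℝ, act (r • u) x = x
  isOpenMap : ∀ {x}, x ∈ dom → (∀ u, act u x = x → u = 0) → IsOpenMap fun τ => F (act τ x)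
  isolated_fixed : ∀ {p}, p ∈ dom → (∀ u, act u p = p) →
    ∃ U ∈ 𝓝 p, ∀ q ∈ U, q ∈ dom → (∀ u, act u q = q) → q = p
  isolated_edge : ∀ {q}, q ∈ dom → (¬ ∀ u, act u q = q) → (∃ u, u ≠ 0 ∧ act u q = q) →
    ∃ U ∈ 𝓝 q, ∀ x ∈ U, x ∈ dom → (¬ ∀ u, act u x = x) → (∃ u, u ≠ 0 ∧ act u x = x) →
      ∃ τ, x = act τ q
  chart : ∀ {p}, p ∈ dom → (∀ u, act u p = p) → ∃ (n : ℕ) (U : Set M) (y : M → Fin n → ℝ)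
    (wt : Fin n → Plane), IsOpen U ∧ p ∈ U ∧ ContinuousOn y U ∧ InjOn y U ∧ y p = 0 ∧
      ∀ x ∈ dom, ∀ u, (∀ r ∈ Icc (0 : ℝ) 1, act (r • u) x ∈ U) →
        ∀ i, y (act u x) i = Real.exp (inner ℝ (wt i) u) * y x i

namespace PlaneAction

variable {M : Type*} [TopologicalSpace M] (A : PlaneAction M)

/-- The stabilizer is trivial. -/
def Free (x : M) : Prop := ∀ u, A.act u x = x → u = 0

/-- The stabilizer is everything. -/
def Fixed (x : M) : Prop := ∀ u, A.act u x = x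

def orbit (x : M) : Set M := range fun τ => A.act τ x

def IsLeaf (S : Set M) : Prop := ∃ x ∈ A.dom, A.Free x ∧ S = A.orbit x

def IsEdge (c : Set M) : Prop := ∃ q ∈ A.dom, ¬ A.Free q ∧ ¬ A.Fixed q ∧ c = A.orbit q

end PlaneAction

/-! ### Joint integral curves of two fields. -/

section Joint

variable {n : ℕ} {M : Type*} [TopologicalSpace M] [T2Space M]
    [ChartedSpace (EuclideanSpace ℝ (Fin n)) M] [IsManifold (𝓡 n) 1 M]
    {v w : (x : M) → TangentSpace (𝓡 n) x}

/-- `φ` is the flow of the vector field `v`. -/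
structure IsFlow (v : (x : M) → TangentSpace (𝓡 n) x) (φ : ℝ → M → M) : Prop where
  continuous : Continuous (uncurry φ)
  zero : ∀ x, φ 0 x = x
  integral : ∀ x, IsMIntegralCurve (I := 𝓡 n) (fun t => φ t x) v

theorem IsFlow.eq {φ : ℝ → M → M} (hφ : IsFlow v φ)
    (hv : ContMDiff (𝓡 n) (𝓡 n).tangent 1 (fun x => (⟨x, v x⟩ : TangentBundle (𝓡 n) M)))
    {γ : ℝ → M} (hγ : IsMIntegralCurve (I := 𝓡 n) γ v) (t : ℝ) : γ t = φ t (γ 0) :=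
  congrFun (isMIntegralCurve_Ioo_eq_of_contMDiff_boundaryless (t₀ := 0) hv hγ
    (hφ.integral (γ 0)) (hφ.zero _).symm) t

theorem IsJointIntegral.eq_flow {φ ψ : ℝ → M → M} (hφ : IsFlow v φ) (hψ : IsFlow w ψ)
    (hv : ContMDiff (𝓡 n) (𝓡 n).tangent 1 (fun x => (⟨x, v x⟩ : TangentBundle (𝓡 n) M)))
    (hw : ContMDiff (𝓡 n) (𝓡 n).tangent 1 (fun x => (⟨x, w x⟩ : TangentBundle (𝓡 n) M)))
    {γ : ℝ → ℝ → M} (hγ : IsJointIntegral v w γ) (s t : ℝ) : γ s t = φ s (ψ t (γ 0 0)) := by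
  rw [hφ.eq hv (hγ.1 t) s, hψ.eq hw (hγ.2 0) t]

/-- Both sides are `γ s t`. So every orbit of the pair lies in the set where the two flows commute,
and the whole argument can take place on that set. -/
theorem IsJointIntegral.flow_comm {φ ψ : ℝ → M → M} (hφ : IsFlow v φ) (hψ : IsFlow w ψ)
    (hv : ContMDiff (𝓡 n) (𝓡 n).tangent 1 (fun x => (⟨x, v x⟩ : TangentBundle (𝓡 n) M)))
    (hw : ContMDiff (𝓡 n) (𝓡 n).tangent 1 (fun x => (⟨x, w x⟩ : TangentBundle (𝓡 n) M)))
    {γ : ℝ → ℝ → M} (hγ : IsJointIntegral v w γ) (s t : ℝ) :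
    φ s (ψ t (γ 0 0)) = ψ t (φ s (γ 0 0)) := by
  rw [← hγ.eq_flow hφ hψ hv hw, hψ.eq hw (hγ.2 s) t, hφ.eq hv (hγ.1 0) s]

theorem isJointIntegral_of_comm {φ ψ : ℝ → M → M} (hφ : IsFlow v φ) (hψ : IsFlow w ψ) {x : M}
    (h : ∀ s t, φ s (ψ t x) = ψ t (φ s x)) : IsJointIntegral v w fun s t => φ s (ψ t x) := by
  refine ⟨fun t => hφ.integral _, fun s => ?_⟩
  simp only [h]
  exact hψ.integral _

theorem chartField_add_smul (a b : ℝ) (x₀ : M) (y : EuclideanSpace ℝ (Fin n)) :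
    chartField (𝓡 n) (fun x => a • v x + b • w x) x₀ y =
      a • chartField (𝓡 n) v x₀ y + b • chartField (𝓡 n) w x₀ y := by
  have h : ∀ (T : EuclideanSpace ℝ (Fin n) →L[ℝ] EuclideanSpace ℝ (Fin n)) (p q),
      T (a • p + b • q) = a • T p + b • T q := fun T p q => by rw [map_add, map_smul, map_smul]
  exact h _ _ _

/-- Along a line in the plane of times, a joint integral curve is an integral curve of the
corresponding linear combination of the fields. -/
theorem IsJointIntegral.line {γ : ℝ → ℝ → M} (hγ : IsJointIntegral v w γ)
    (hv : ContMDiff (𝓡 n) (𝓡 n).tangent 1 (fun x => (⟨x, v x⟩ : TangentBundle (𝓡 n) M)))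
    (hw : ContMDiff (𝓡 n) (𝓡 n).tangent 1 (fun x => (⟨x, w x⟩ : TangentBundle (𝓡 n) M)))
    (hc : Continuous (uncurry γ)) (a b s t : ℝ) :
    IsMIntegralCurve (I := 𝓡 n) (fun r => γ (s + r * a) (t + r * b))
      (fun x => a • v x + b • w x) := by
  intro r
  set P : ℝ × ℝ := (s + r * a, t + r * b) with hP
  set x₀ : M := γ P.1 P.2 with hx₀
  set e := extChartAt (𝓡 n) x₀ with he
  have hsrc : ∀ᶠ p in 𝓝 P, γ p.1 p.2 ∈ e.source :=
    hc.continuousAt.eventually_mem (extChartAt_source_mem_nhds (I := 𝓡 n) x₀)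
  have hec : ContinuousAt (fun p : ℝ × ℝ => e (γ p.1 p.2)) P :=
    ContinuousAt.comp (g := e) (continuousAt_extChartAt x₀) hc.continuousAt
  have hV : ContinuousAt (fun p : ℝ × ℝ => chartField (𝓡 n) v x₀ (e (γ p.1 p.2))) P :=
    ContinuousAt.comp (g := chartField (𝓡 n) v x₀) (contDiffAt_chartField (hv x₀)).continuousAt hec
  have hW : ContinuousAt (fun p : ℝ × ℝ => chartField (𝓡 n) w x₀ (e (γ p.1 p.2))) P :=
    ContinuousAt.comp (g := chartField (𝓡 n) w x₀) (contDiffAt_chartField (hw x₀)).continuousAt hec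
  -- In the chart both partial derivatives are continuous, so the total derivative exists and the
  -- chain rule applies along the line.
  have hstrict := hasStrictFDerivAt_uncurry_coprod (𝕜 := ℝ) (u := P)
    (f := fun s t => e (γ s t))
    (f₁ := fun s t => (1 : ℝ →L[ℝ] ℝ).smulRight (chartField (𝓡 n) v x₀ (e (γ s t))))
    (f₂ := fun s t => (1 : ℝ →L[ℝ] ℝ).smulRight (chartField (𝓡 n) w x₀ (e (γ s t))))
    (hsrc.mono fun p hp => (hasDerivAt_chart_of_hasMFDerivAt (hγ.1 p.2 p.1) hp).hasFDerivAt)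
    (hsrc.mono fun p hp => (hasDerivAt_chart_of_hasMFDerivAt (hγ.2 p.1 p.2) hp).hasFDerivAt)
    (by
      change ContinuousAt (fun p : ℝ × ℝ =>
        (1 : ℝ →L[ℝ] ℝ).smulRight (chartField (𝓡 n) v x₀ (e (γ p.1 p.2)))) P
      exact ((ContinuousLinearMap.smulRightL ℝ ℝ _ 1).continuous.continuousAt).comp hV)
    (by
      change ContinuousAt (fun p : ℝ × ℝ =>
        (1 : ℝ →L[ℝ] ℝ).smulRight (chartField (𝓡 n) w x₀ (e (γ p.1 p.2)))) P
      exact ((ContinuousLinearMap.smulRightL ℝ ℝ _ 1).continuous.continuousAt).comp hW)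
  have hline : HasDerivAt (fun r : ℝ => ((s + r * a, t + r * b) : ℝ × ℝ)) (a, b) r := by
    refine HasDerivAt.prodMk ?_ ?_
    · simpa using ((hasDerivAt_id r).mul_const a).const_add s
    · simpa using ((hasDerivAt_id r).mul_const b).const_add t
  have hcomp := (hstrict.hasFDerivAt).comp_hasDerivAt r hline
  have hlc : ContinuousAt (fun r => γ (s + r * a) (t + r * b)) r :=
    (hc.comp (by fun_prop : Continuous fun r : ℝ => (s + r * a, t + r * b))).continuousAt
  have key := hasMFDerivAt_of_hasDerivAt_chart (I := 𝓡 n) (v := fun x => a • v x + b • w x)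
    (x₀ := x₀) (f := fun r => e (γ (s + r * a) (t + r * b))) (t := r) (by
      rw [chartField_add_smul]
      exact hcomp.congr_deriv rfl) (by
      refine mem_interior_iff_mem_nhds.2 ?_
      exact extChartAt_target_mem_nhds (I := 𝓡 n) x₀)
  have h2 : e.symm (e (γ (s + r * a) (t + r * b))) = γ (s + r * a) (t + r * b) :=
    e.left_inv (mem_extChartAt_source x₀)
  rw [h2] at key
  refine key.congr_of_eventuallyEq ?_
  filter_upwards [hlc.eventually_mem (extChartAt_source_mem_nhds (I := 𝓡 n) x₀)] with r' hr'
  exact (e.left_inv hr').symm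

end Joint

/-! ### The joint flow on the set where the two flows commute, and the monotonicity of the
potential. -/

section Pair

variable {n : ℕ} {M : Type*} [TopologicalSpace M] [T2Space M]
    [ChartedSpace (EuclideanSpace ℝ (Fin n)) M] [IsManifold (𝓡 n) ∞ M]
    {v w : (x : M) → TangentSpace (𝓡 n) x} {fv fw : M → ℝ}

instance : IsManifold (𝓡 n) 1 M := IsManifold.of_le (n := ∞) (by norm_num)

/-- The field which moves points in the direction `u` of the plane of times. -/
def combField (v w : (x : M) → TangentSpace (𝓡 n) x) (u : Plane) (x : M) :
    TangentSpace (𝓡 n) x := u 0 • v x + u 1 • w x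

/-- The joint flow. It is an action where the two flows commute. -/
def jointFlow (φ ψ : ℝ → M → M) (τ : Plane) (x : M) : M := φ (τ 0) (ψ (τ 1) x)

/-- The set where the two flows commute. -/
def commSet (φ ψ : ℝ → M → M) : Set M := {x | ∀ s t, φ s (ψ t x) = ψ t (φ s x)}

section Flows

variable {φ ψ : ℝ → M → M} (hφ : IsFlow v φ) (hψ : IsFlow w ψ)
  (hvw : IsTwoMorsePair v w fv fw)

include hvw in
theorem IsTwoMorsePair.contMDiff_v :
    ContMDiff (𝓡 n) (𝓡 n).tangent 1 (fun x => (⟨x, v x⟩ : TangentBundle (𝓡 n) M)) :=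
  hvw.smooth_v.of_le (by norm_num)

include hvw in
theorem IsTwoMorsePair.contMDiff_w :
    ContMDiff (𝓡 n) (𝓡 n).tangent 1 (fun x => (⟨x, w x⟩ : TangentBundle (𝓡 n) M)) :=
  hvw.smooth_w.of_le (by norm_num)

include hvw in
theorem contMDiff_combField (u : Plane) : ContMDiff (𝓡 n) (𝓡 n).tangent 1
    (fun x => (⟨x, combField v w u x⟩ : TangentBundle (𝓡 n) M)) :=
  (hvw.contMDiff_v.const_smul_section (a := u 0)).add_section
    (hvw.contMDiff_w.const_smul_section (a := u 1))

theorem IsFlow.add {v : (x : M) → TangentSpace (𝓡 n) x} {φ : ℝ → M → M} (hφ : IsFlow v φ)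
    (hv : ContMDiff (𝓡 n) (𝓡 n).tangent 1 (fun x => (⟨x, v x⟩ : TangentBundle (𝓡 n) M)))
    (s t : ℝ) (x : M) : φ (s + t) x = φ s (φ t x) := by
  have := hφ.eq hv ((hφ.integral x).comp_add t) s
  simpa using this

include hφ hψ in
theorem continuous_jointFlow : Continuous fun p : Plane × M => jointFlow φ ψ p.1 p.2 := by
  unfold jointFlow
  have h1 : Continuous fun p : Plane × M => ψ (p.1 1) p.2 :=
    hψ.continuous.comp (f := fun p : Plane × M => (p.1 1, p.2)) (by fun_prop)
  exact hφ.continuous.comp (f := fun p : Plane × M => (p.1 0, ψ (p.1 1) p.2))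
    (((by fun_prop : Continuous fun p : Plane × M => p.1 0)).prodMk h1)

include hφ hψ in
-- Closedness keeps the closures of leaves inside the domain of the action.
theorem isClosed_commSet : IsClosed (commSet φ ψ) := by
  have hφc : ∀ s, Continuous (φ s) := fun s =>
    hφ.continuous.comp (f := fun x => (s, x)) (by fun_prop)
  have hψc : ∀ s, Continuous (ψ s) := fun s =>
    hψ.continuous.comp (f := fun x => (s, x)) (by fun_prop)
  simp only [commSet, ofPred_forall]
  exact isClosed_iInter fun s => isClosed_iInter fun t =>
    isClosed_eq ((hφc s).comp (hψc t)) ((hψc t).comp (hφc s))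

include hφ hψ hvw in
theorem jointFlow_add {x : M} (hx : x ∈ commSet φ ψ) (σ τ : Plane) :
    jointFlow φ ψ (σ + τ) x = jointFlow φ ψ σ (jointFlow φ ψ τ x) := by
  simp only [jointFlow, PiLp.add_apply, hφ.add hvw.contMDiff_v]
  rw [hx (τ 0) (σ 1 + τ 1), hψ.add hvw.contMDiff_w, ← hx]

include hφ hψ hvw in
theorem jointFlow_mem {x : M} (hx : x ∈ commSet φ ψ) (τ : Plane) :
    jointFlow φ ψ τ x ∈ commSet φ ψ := fun s t => by
  simp only [jointFlow]
  rw [hx (τ 0), ← hψ.add hvw.contMDiff_w, ← hx, ← hφ.add hvw.contMDiff_v, hx,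
    hψ.add hvw.contMDiff_w, ← hx, ← hx, hφ.add hvw.contMDiff_v]

include hφ hψ in
theorem jointFlow_zero (x : M) : jointFlow φ ψ 0 x = x := by
  simp [jointFlow, hφ.zero, hψ.zero]

include hφ hψ hvw in
theorem isMIntegralCurve_jointFlow {x : M} (hx : x ∈ commSet φ ψ) (τ u : Plane) :
    IsMIntegralCurve (I := 𝓡 n) (fun r : ℝ => jointFlow φ ψ (τ + r • u) x) (combField v w u) := by
  have h := isJointIntegral_of_comm hφ hψ hx
  have hc : Continuous (uncurry fun s t => φ s (ψ t x)) := by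
    refine hφ.continuous.comp (f := fun p : ℝ × ℝ => (p.1, ψ p.2 x)) ?_
    exact continuous_fst.prodMk (hψ.continuous.comp (f := fun p : ℝ × ℝ => (p.2, x)) (by fun_prop))
  exact h.line hvw.contMDiff_v hvw.contMDiff_w hc (u 0) (u 1) (τ 0) (τ 1)

theorem hasDerivAt_comp_potential {g : Bundle.ContMDiffRiemannianMetric (𝓡 n) ∞
      (EuclideanSpace ℝ (Fin n)) (fun x : M => TangentSpace (𝓡 n) x)}
    {f : M → ℝ} {X Y : (x : M) → TangentSpace (𝓡 n) x} (hf : IsGradient g f Y) {γ : ℝ → M}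
    (hγ : IsMIntegralCurve (I := 𝓡 n) γ X) (r : ℝ) :
    HasDerivAt (fun r => f (γ r)) (g.inner (γ r) (Y (γ r)) (X (γ r))) r := by
  have h1 : HasMFDerivAt (𝓡 n) 𝓘(ℝ, ℝ) f (γ r) (mfderiv (𝓡 n) 𝓘(ℝ, ℝ) f (γ r)) :=
    ((hf.1 (γ r)).mdifferentiableAt (by norm_num)).hasMFDerivAt
  refine (hasDerivAt_of_hasMFDerivAt (h1.comp r (hγ r))).congr_deriv ?_
  change mfderiv (𝓡 n) 𝓘(ℝ, ℝ) f (γ r) ((1 : ℝ) • X (γ r)) = _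
  rw [one_smul, ← hf.2]

include hφ hψ hvw in
-- The component of the projection along u is a potential of `combField v w u`, so its derivative
-- along that field is the squared length of the field.
theorem hasDerivAt_inner_proj {g : Bundle.ContMDiffRiemannianMetric (𝓡 n) ∞
      (EuclideanSpace ℝ (Fin n)) (fun x : M => TangentSpace (𝓡 n) x)}
    (hgv : IsGradient g fv v) (hgw : IsGradient g fw w) {x : M} (hx : x ∈ commSet φ ψ)
    (u : Plane) (r : ℝ) :
    HasDerivAt (fun r : ℝ => inner ℝ u (proj fv fw (jointFlow φ ψ (r • u) x)))
      (g.inner (jointFlow φ ψ (r • u) x) (combField v w u (jointFlow φ ψ (r • u) x))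
        (combField v w u (jointFlow φ ψ (r • u) x))) r := by
  have hγ := isMIntegralCurve_jointFlow hφ hψ hvw hx 0 u
  simp only [zero_add] at hγ
  have h := ((hasDerivAt_comp_potential hgv hγ r).const_mul (u 0)).add
    ((hasDerivAt_comp_potential hgw hγ r).const_mul (u 1))
  refine (h.congr_deriv ?_).congr_of_eventuallyEq (Eventually.of_forall fun r => ?_)
  · conv_rhs => rw [combField]
    simp only [map_add, map_smul, add_apply, smul_apply, smul_eq_mul, combField]
    rw [g.symm _ (w _) (v _)]
  · simp [proj, PiLp.inner_apply, Fin.sum_univ_two, mul_comm]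

include hφ hψ hvw in
-- The height in the direction u never decreases along the flow of u. If it has not grown after time
-- 1, it is constant on [0, 1], and its derivative at 0, a squared length, vanishes.
theorem combField_eq_zero_of_le {x : M} (hx : x ∈ commSet φ ψ) (u : Plane)
    (hle : inner ℝ u (proj fv fw (jointFlow φ ψ u x)) ≤ inner ℝ u (proj fv fw x)) :
    combField v w u x = 0 := by
  obtain ⟨g, hgv, hgw⟩ := hvw.gradient
  have hd := hasDerivAt_inner_proj hφ hψ hvw hgv hgw hx u
  set h : ℝ → ℝ := fun r => inner ℝ u (proj fv fw (jointFlow φ ψ (r • u) x)) with hh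
  have hpos : ∀ y : M, 0 ≤ g.inner y (combField v w u y) (combField v w u y) := fun y => by
    by_cases h0 : combField v w u y = 0
    · rw [h0, map_zero]
    · exact (g.pos y _ h0).le
  have hmono : Monotone h := monotone_of_deriv_nonneg (fun r => (hd r).differentiableAt)
    fun r => by rw [(hd r).deriv]; exact hpos _
  have h0 : h 0 = inner ℝ u (proj fv fw x) := by simp [hh, jointFlow_zero hφ hψ]
  have h1 : h 1 ≤ h 0 := by rw [h0]; simpa [hh] using hle
  have hconst : ∀ r ∈ Icc (0 : ℝ) 1, h r = h 0 := fun r hr =>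
    le_antisymm ((hmono hr.2).trans h1) (hmono hr.1)
  have hd0 : HasDerivWithinAt h 0 (Icc 0 1) 0 :=
    (hasDerivWithinAt_const (0 : ℝ) (Icc 0 1) (h 0)).congr hconst rfl
  have heq := (uniqueDiffOn_Icc (zero_lt_one' ℝ) 0 (by simp)).eq_deriv _
    hd0 (hd 0).hasDerivWithinAt
  by_contra hne
  -- The point is generalized because the field at the time-0 image of `x` and the field at `x` live
  -- in different tangent spaces.
  have key : ∀ y, y = x → 0 = g.inner y (combField v w u y) (combField v w u y) → False := by
    rintro y rfl h
    exact (g.pos y _ hne).ne h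
  exact key _ (by simp [jointFlow_zero hφ hψ]) heq

include hφ hψ hvw in
theorem jointFlow_smul_eq_of_combField {x : M} (hx : x ∈ commSet φ ψ) {u : Plane}
    (hu : combField v w u x = 0) (r : ℝ) : jointFlow φ ψ (r • u) x = x := by
  have hγ := isMIntegralCurve_jointFlow hφ hψ hvw hx 0 u
  simp only [zero_add] at hγ
  have := isMIntegralCurve_Ioo_eq_of_contMDiff_boundaryless (t₀ := 0) (contMDiff_combField hvw u) hγ
    (isMIntegralCurve_const hu) (by simp [jointFlow_zero hφ hψ])
  exact congrFun this r

include hφ hψ hvw in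
-- A gradient flow has no periodic orbits except its zeros. Stabilizers of the action are thus read
-- off from the fields at a point.
theorem combField_eq_zero_iff {x : M} (hx : x ∈ commSet φ ψ) {u : Plane} :
    combField v w u x = 0 ↔ jointFlow φ ψ u x = x :=
  ⟨fun h => by simpa using jointFlow_smul_eq_of_combField hφ hψ hvw hx h 1,
    fun h => combField_eq_zero_of_le hφ hψ hvw hx u (by rw [h])⟩

theorem continuous_mfderiv_apply {f : M → ℝ} (hf : ContMDiff (𝓡 n) 𝓘(ℝ, ℝ) ∞ f)
    {X : (x : M) → TangentSpace (𝓡 n) x}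
    (hX : ContMDiff (𝓡 n) (𝓡 n).tangent 1 (fun x => (⟨x, X x⟩ : TangentBundle (𝓡 n) M))) :
    Continuous fun x => (mfderiv (𝓡 n) 𝓘(ℝ, ℝ) f x (X x) : ℝ) := by
  have h1 := (hf.continuous_tangentMap (by norm_num)).comp hX.continuous
  exact (contMDiff_snd_tangentBundle_modelSpace ℝ 𝓘(ℝ, ℝ) (n := 1)).continuous.comp h1

end Flows
end Pair

/-! ### Openness of the projection on leaves, and diagonal charts at critical points. -/

section Pair

variable {n : ℕ} {M : Type*} [TopologicalSpace M] [T2Space M]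
    [ChartedSpace (EuclideanSpace ℝ (Fin n)) M] [IsManifold (𝓡 n) ∞ M]
    {v w : (x : M) → TangentSpace (𝓡 n) x} {fv fw : M → ℝ}

section Flows

variable {φ ψ : ℝ → M → M} (hφ : IsFlow v φ) (hψ : IsFlow w ψ)
  (hvw : IsTwoMorsePair v w fv fw)

include hvw in
-- The partial derivatives in the two times are continuous, hence the derivative is strict; this is
-- the form needed for the inverse function theorem.
theorem hasStrictFDerivAt_comp_jointIntegral {g : Bundle.ContMDiffRiemannianMetric (𝓡 n) ∞
      (EuclideanSpace ℝ (Fin n)) (fun x : M => TangentSpace (𝓡 n) x)}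
    {f : M → ℝ} {Y : (x : M) → TangentSpace (𝓡 n) x} (hf : IsGradient g f Y)
    {γ : ℝ → ℝ → M} (hγ : IsJointIntegral v w γ) (hc : Continuous (uncurry γ)) (P : ℝ × ℝ) :
    ∃ D : ℝ × ℝ →L[ℝ] ℝ, HasStrictFDerivAt (fun p : ℝ × ℝ => f (γ p.1 p.2)) D P ∧
      ∀ a b, D (a, b) = g.inner (γ P.1 P.2) (Y (γ P.1 P.2))
        (a • v (γ P.1 P.2) + b • w (γ P.1 P.2)) := by
  have h := hasStrictFDerivAt_uncurry_coprod (𝕜 := ℝ) (u := P) (f := fun s t => f (γ s t))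
    (f₁ := fun s t => (1 : ℝ →L[ℝ] ℝ).smulRight (g.inner (γ s t) (Y (γ s t)) (v (γ s t)) : ℝ))
    (f₂ := fun s t => (1 : ℝ →L[ℝ] ℝ).smulRight (g.inner (γ s t) (Y (γ s t)) (w (γ s t)) : ℝ))
    (Eventually.of_forall fun p => (hasDerivAt_comp_potential hf (hγ.1 p.2) p.1).hasFDerivAt)
    (Eventually.of_forall fun p => (hasDerivAt_comp_potential hf (hγ.2 p.1) p.2).hasFDerivAt)
    (by
      have h1 : Continuous fun p : ℝ × ℝ =>
          (g.inner (γ p.1 p.2) (Y (γ p.1 p.2)) (v (γ p.1 p.2)) : ℝ) := by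
        simp only [← hf.2]
        exact (continuous_mfderiv_apply hf.1 hvw.contMDiff_v).comp hc
      exact ((ContinuousLinearMap.smulRightL ℝ ℝ ℝ 1).continuous.comp h1).continuousAt)
    (by
      have h1 : Continuous fun p : ℝ × ℝ =>
          (g.inner (γ p.1 p.2) (Y (γ p.1 p.2)) (w (γ p.1 p.2)) : ℝ) := by
        simp only [← hf.2]
        exact (continuous_mfderiv_apply hf.1 hvw.contMDiff_w).comp hc
      exact ((ContinuousLinearMap.smulRightL ℝ ℝ ℝ 1).continuous.comp h1).continuousAt)
  refine ⟨_, h, fun a b => ?_⟩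
  rw [map_add, map_smul, map_smul]
  rfl

include hφ hψ hvw in
-- The derivative in the times is the Gram matrix of v and w, which is invertible where they are
-- linearly independent.
theorem isOpenMap_proj_jointFlow {x : M} (hx : x ∈ commSet φ ψ)
    (hfree : ∀ u, jointFlow φ ψ u x = x → u = 0) :
    IsOpenMap fun τ => proj fv fw (jointFlow φ ψ τ x) := by
  obtain ⟨g, hgv, hgw⟩ := hvw.gradient
  have hγ := isJointIntegral_of_comm hφ hψ hx
  have hc : Continuous (uncurry fun s t => φ s (ψ t x)) := by
    refine hφ.continuous.comp (f := fun p : ℝ × ℝ => (p.1, ψ p.2 x)) ?_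
    exact continuous_fst.prodMk (hψ.continuous.comp (f := fun p : ℝ × ℝ => (p.2, x)) (by fun_prop))
  have hopen : IsOpenMap fun p : ℝ × ℝ => (fv (φ p.1 (ψ p.2 x)), fw (φ p.1 (ψ p.2 x))) := by
    refine isOpenMap_iff_nhds_le.2 fun P => ?_
    obtain ⟨D₁, hD₁, hD₁'⟩ := hasStrictFDerivAt_comp_jointIntegral hvw hgv hγ hc P
    obtain ⟨D₂, hD₂, hD₂'⟩ := hasStrictFDerivAt_comp_jointIntegral hvw hgw hγ hc P
    have hinj : Injective (D₁.prod D₂ : ℝ × ℝ →ₗ[ℝ] ℝ × ℝ) := by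
      rw [← LinearMap.ker_eq_bot, LinearMap.ker_eq_bot']
      rintro ⟨a, b⟩ hab
      have h1 : D₁ (a, b) = 0 := congrArg Prod.fst hab
      have h2 : D₂ (a, b) = 0 := congrArg Prod.snd hab
      rw [hD₁'] at h1
      rw [hD₂'] at h2
      set y := φ P.1 (ψ P.2 x) with hy
      -- A vector in the kernel gives a combination of v and w that is orthogonal to v and to w,
      -- hence to itself.
      have h3 : combField v w !₂[a, b] y = 0 := by
        by_contra hne
        refine (g.pos y _ hne).ne' ?_
        have : combField v w !₂[a, b] y = a • v y + b • w y := by simp [combField]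
        rw [this, map_add, map_smul, map_smul, g.symm _ _ (v y), g.symm _ _ (w y), h1, h2]
        simp
      have hyx : y = jointFlow φ ψ !₂[P.1, P.2] x := by simp [jointFlow, hy]
      have hycomm : y ∈ commSet φ ψ := hyx ▸ jointFlow_mem hφ hψ hvw hx _
      have h4 := (combField_eq_zero_iff hφ hψ hvw hycomm).1 h3
      have h5 : (!₂[a, b] : Plane) = 0 := by
        refine hfree _ ?_
        have : jointFlow φ ψ (-!₂[P.1, P.2]) (jointFlow φ ψ (!₂[a, b]) y) = x := by
          rw [h4, hyx, ← jointFlow_add hφ hψ hvw hx, neg_add_cancel, jointFlow_zero hφ hψ]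
        rw [hyx, ← jointFlow_add hφ hψ hvw hx, ← jointFlow_add hφ hψ hvw hx] at this
        rwa [show (-!₂[P.1, P.2] + (!₂[a, b] + !₂[P.1, P.2]) : Plane) = !₂[a, b] by abel] at this
      have h6 := congrArg (fun z : Plane => z 0) h5
      have h7 := congrArg (fun z : Plane => z 1) h5
      simp at h6 h7
      rw [h6, h7]; rfl
    have hsurj : (D₁.prod D₂).range = ⊤ :=
      LinearMap.range_eq_top.2 (LinearMap.injective_iff_surjective.1 hinj)
    exact ((hD₁.prodMk hD₂).map_nhds_eq_of_surj hsurj).ge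
  let e : Plane ≃L[ℝ] ℝ × ℝ :=
    (EuclideanSpace.equiv (Fin 2) ℝ).trans (ContinuousLinearEquiv.finTwoArrow ℝ ℝ)
  have := (e.symm.toHomeomorph.isOpenMap.comp hopen).comp e.toHomeomorph.isOpenMap
  convert this using 1
  funext τ
  ext i
  fin_cases i <;> rfl

theorem hasDerivAt_comp_chart {e : OpenPartialHomeomorph M (EuclideanSpace ℝ (Fin n))}
    (he : e ∈ IsManifold.maximalAtlas (𝓡 n) 1 M) {X : (x : M) → TangentSpace (𝓡 n) x}
    {γ : ℝ → M} (hγ : IsMIntegralCurve (I := 𝓡 n) γ X) {r : ℝ} (hr : γ r ∈ e.source) :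
    HasDerivAt (fun r => e (γ r)) (mfderiv (𝓡 n) (𝓡 n) e (γ r) (X (γ r))) r := by
  have h1 := (mdifferentiableAt_of_mem_maximalAtlas he hr).hasMFDerivAt
  refine (hasDerivAt_of_hasMFDerivAt (h1.comp r (hγ r))).congr_deriv ?_
  change mfderiv (𝓡 n) (𝓡 n) e (γ r) ((1 : ℝ) • X (γ r)) = _
  rw [one_smul]

include hφ hψ hvw in
-- As long as the path stays in the chart, each coordinate solves h' = c h, where c is the inner
-- product of its weight with u.
theorem exists_linear_chart {p : M} (hp : IsCriticalPoint v w p) :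
    ∃ (N : ℕ) (U : Set M) (y : M → Fin N → ℝ)
    (wt : Fin N → Plane), IsOpen U ∧ p ∈ U ∧ ContinuousOn y U ∧ InjOn y U ∧ y p = 0 ∧
      ∀ x ∈ commSet φ ψ, ∀ u, (∀ r ∈ Icc (0 : ℝ) 1, jointFlow φ ψ (r • u) x ∈ U) →
        ∀ i, y (jointFlow φ ψ u x) i = Real.exp (inner ℝ (wt i) u) * y x i := by
  obtain ⟨e, he, hpe, hp0, a, b, hab⟩ := hvw.linearization p hp
  refine ⟨n, e.source, fun x => WithLp.ofLp (e x), fun i => !₂[a i, b i], e.open_source, hpe, ?_,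
    ?_, ?_, ?_⟩
  · exact (PiLp.continuous_ofLp 2 _).comp_continuousOn e.continuousOn
  · intro x hx z hz h
    exact e.injOn hx hz (WithLp.ofLp_injective 2 h)
  · simp [hp0]
  · intro x hx u hu i
    have he1 : e ∈ IsManifold.maximalAtlas (𝓡 n) 1 M :=
      IsManifold.maximalAtlas_subset_of_le (by norm_num) he
    have hγ := isMIntegralCurve_jointFlow hφ hψ hvw hx 0 u
    simp only [zero_add] at hγ
    set c : ℝ := inner ℝ (!₂[a i, b i] : Plane) u with hc
    set h : ℝ → ℝ := fun r => e (jointFlow φ ψ (r • u) x) i with hh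
    have hder : ∀ r ∈ Icc (0 : ℝ) 1, HasDerivAt h (c * h r) r := by
      intro r hr
      have h1 := hasDerivAt_comp_chart he1 hγ (hu r hr)
      have h2 := (hasDerivAt_pi.1 ((PiLp.continuousLinearEquiv 2 ℝ
        (fun _ : Fin n => ℝ)).hasFDerivAt.comp_hasDerivAt r h1)) i
      refine h2.congr_deriv ?_
      obtain ⟨h3, h4⟩ := hab _ (hu r hr)
      have h5 : mfderiv (𝓡 n) (𝓡 n) e (jointFlow φ ψ (r • u) x)
          (combField v w u (jointFlow φ ψ (r • u) x)) =
          u 0 • WithLp.toLp 2 (fun i => a i * e (jointFlow φ ψ (r • u) x) i) +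
            u 1 • WithLp.toLp 2 (fun i => b i * e (jointFlow φ ψ (r • u) x) i) := by
        rw [← h3, ← h4, combField, map_add, map_smul, map_smul]
        rfl
      rw [h5]
      simp [hc, hh, PiLp.inner_apply, Fin.sum_univ_two]
      ring
    have hconst : ∀ r ∈ Icc (0 : ℝ) 1, Real.exp (-(c * r)) * h r = Real.exp (-(c * 0)) * h 0 := by
      refine constant_of_has_deriv_right_zero (f := fun r => Real.exp (-(c * r)) * h r) ?_ ?_
      · intro r hr
        exact (((by fun_prop : Continuous fun r => Real.exp (-(c * r))).continuousAt).mul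
          (hder r hr).continuousAt).continuousWithinAt
      · intro r hr
        have h1 : HasDerivAt (fun r => Real.exp (-(c * r))) (Real.exp (-(c * r)) * (-(c * 1))) r :=
          (((hasDerivAt_id r).const_mul c).neg).exp
        exact ((h1.mul (hder r ⟨hr.1, hr.2.le⟩)).congr_deriv (by ring)).hasDerivWithinAt
    have h1 := hconst 1 (by simp)
    have h2 : h 0 = e x i := by simp [hh, jointFlow_zero hφ hψ]
    have h3 : h 1 = e (jointFlow φ ψ u x) i := by simp [hh]
    rw [h2, h3] at h1
    simp only [mul_zero, neg_zero, Real.exp_zero, one_mul, mul_one] at h1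
    change e (jointFlow φ ψ u x) i = Real.exp c * e x i
    rw [← h1, ← mul_assoc, ← Real.exp_add]
    simp

end Flows
end Pair

/-! ### Dimension of the span of two vectors. -/

section Rank

variable {E : Type*} [AddCommGroup E] [Module ℝ E]

theorem finrank_span_pair_eq_two {a b : E} :
    Module.finrank ℝ (Submodule.span ℝ ({a, b} : Set E)) = 2 ↔
      ∀ s t : ℝ, s • a + t • b = 0 → s = 0 ∧ t = 0 := by
  have h := linearIndependent_iff_card_eq_finrank_span (R := ℝ) (b := ![a, b])
  rw [LinearIndependent.pair_iff, Matrix.range_cons_cons_empty] at h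
  rw [h, Fintype.card_fin, Set.finrank]
  exact eq_comm

theorem finrank_span_pair_eq_one {a b : E} :
    Module.finrank ℝ (Submodule.span ℝ ({a, b} : Set E)) = 1 ↔
      ¬ (a = 0 ∧ b = 0) ∧ ¬ ∀ s t : ℝ, s • a + t • b = 0 → s = 0 ∧ t = 0 := by
  rw [← finrank_span_pair_eq_two]
  have h2 : Module.finrank ℝ (Submodule.span ℝ ({a, b} : Set E)) ≤ 2 := by
    have h := finrank_range_le_card (R := ℝ) (b := ![a, b])
    rwa [Matrix.range_cons_cons_empty, Fintype.card_fin, Set.finrank] at h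
  have : FiniteDimensional ℝ (Submodule.span ℝ ({a, b} : Set E)) :=
    FiniteDimensional.span_of_finite ℝ (by simp)
  have h0 : Module.finrank ℝ (Submodule.span ℝ ({a, b} : Set E)) = 0 ↔ a = 0 ∧ b = 0 := by
    rw [Submodule.finrank_eq_zero, Submodule.span_eq_bot]
    simp
  rw [← h0]
  omega

end Rank

/-! ### Orbits of the pair of fields as orbits of the action. -/

section Pair

variable {n : ℕ} {M : Type*} [TopologicalSpace M] [T2Space M]
    [ChartedSpace (EuclideanSpace ℝ (Fin n)) M] [IsManifold (𝓡 n) ∞ M]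
    {v w : (x : M) → TangentSpace (𝓡 n) x} {fv fw : M → ℝ}

section Flows

variable {φ ψ : ℝ → M → M} (hφ : IsFlow v φ) (hψ : IsFlow w ψ)
  (hvw : IsTwoMorsePair v w fv fw)

include hφ hψ hvw in
theorem jointFlow_fixed_iff {x : M} (hx : x ∈ commSet φ ψ) :
    (∀ u, jointFlow φ ψ u x = x) ↔ IsCriticalPoint v w x := by
  simp only [← combField_eq_zero_iff hφ hψ hvw hx, IsCriticalPoint, combField]
  refine ⟨fun h => ⟨?_, ?_⟩, fun h u => by simp [h.1, h.2]⟩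
  · simpa using h !₂[1, 0]
  · simpa using h !₂[0, 1]

include hφ hψ hvw in
theorem jointFlow_free_iff {x : M} (hx : x ∈ commSet φ ψ) :
    (∀ u, jointFlow φ ψ u x = x → u = 0) ↔ ∀ s t : ℝ, s • v x + t • w x = 0 → s = 0 ∧ t = 0 := by
  simp only [← combField_eq_zero_iff hφ hψ hvw hx, combField]
  refine ⟨fun h s t hst => ?_, fun h u hu => ?_⟩
  · have := h !₂[s, t] (by simpa using hst)
    exact ⟨by simpa using congrArg (fun z : Plane => z 0) this,
      by simpa using congrArg (fun z : Plane => z 1) this⟩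
  · obtain ⟨h0, h1⟩ := h _ _ hu
    ext i
    fin_cases i
    · exact h0
    · exact h1

include hφ hψ hvw in
theorem jointFlow_stab_iff {x : M} (hx : x ∈ commSet φ ψ) (τ u : Plane) :
    jointFlow φ ψ u (jointFlow φ ψ τ x) = jointFlow φ ψ τ x ↔ jointFlow φ ψ u x = x := by
  constructor
  · intro h
    have h1 := congrArg (jointFlow φ ψ (-τ)) h
    rw [← jointFlow_add hφ hψ hvw hx, ← jointFlow_add hφ hψ hvw hx,
      ← jointFlow_add hφ hψ hvw hx, neg_add_cancel, jointFlow_zero hφ hψ] at h1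
    rwa [show -τ + (u + τ) = u by abel] at h1
  · intro h
    rw [← jointFlow_add hφ hψ hvw hx, add_comm, jointFlow_add hφ hψ hvw hx, h]

include hφ hψ hvw in
/-- The orbits of the pair of fields are the orbits of the joint flow. -/
theorem isOrbit_iff (d : ℕ) (S : Set M) : IsOrbit v w d S ↔ ∃ x ∈ commSet φ ψ,
    S = range (fun τ => jointFlow φ ψ τ x) ∧ ∀ y ∈ S,
      Module.finrank ℝ (Submodule.span ℝ ({v y, w y} : Set (TangentSpace (𝓡 n) y))) = d := by
  constructor
  · rintro ⟨⟨γ, hγ, hS⟩, hd⟩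
    refine ⟨γ 0 0, hγ.flow_comm hφ hψ hvw.contMDiff_v hvw.contMDiff_w, ?_, hd⟩
    rw [hS]
    ext y
    constructor
    · rintro ⟨s, t, rfl⟩
      exact ⟨!₂[s, t], (hγ.eq_flow hφ hψ hvw.contMDiff_v hvw.contMDiff_w s t).symm⟩
    · rintro ⟨τ, rfl⟩
      exact ⟨τ 0, τ 1, (hγ.eq_flow hφ hψ hvw.contMDiff_v hvw.contMDiff_w _ _).symm⟩
  · rintro ⟨x, hx, hS, hd⟩
    refine ⟨⟨_, isJointIntegral_of_comm hφ hψ hx, ?_⟩, hd⟩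
    rw [hS]
    ext y
    constructor
    · rintro ⟨τ, rfl⟩
      exact ⟨τ 0, τ 1, rfl⟩
    · rintro ⟨s, t, rfl⟩
      exact ⟨!₂[s, t], rfl⟩

include hφ hψ hvw in
theorem isLeaf_iff (S : Set M) : IsLeaf v w S ↔ ∃ x ∈ commSet φ ψ,
    (∀ u, jointFlow φ ψ u x = x → u = 0) ∧ S = range fun τ => jointFlow φ ψ τ x := by
  rw [IsLeaf, isOrbit_iff hφ hψ hvw]
  constructor
  · rintro ⟨x, hx, hS, hd⟩
    refine ⟨x, hx, ?_, hS⟩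
    rw [jointFlow_free_iff hφ hψ hvw hx]
    exact finrank_span_pair_eq_two.1 (hd x (hS ▸ ⟨0, jointFlow_zero hφ hψ x⟩))
  · rintro ⟨x, hx, hf, hS⟩
    refine ⟨x, hx, hS, ?_⟩
    rw [hS]
    rintro _ ⟨τ, rfl⟩
    refine finrank_span_pair_eq_two.2 ((jointFlow_free_iff hφ hψ hvw
      (jointFlow_mem hφ hψ hvw hx τ)).1 ?_)
    simpa only [jointFlow_stab_iff hφ hψ hvw hx] using hf

include hφ hψ hvw in
theorem isCriticalEdge_iff (S : Set M) : IsCriticalEdge v w S ↔ ∃ x ∈ commSet φ ψ,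
    (¬ ∀ u, jointFlow φ ψ u x = x → u = 0) ∧ (¬ ∀ u, jointFlow φ ψ u x = x) ∧
      S = range fun τ => jointFlow φ ψ τ x := by
  rw [IsCriticalEdge, isOrbit_iff hφ hψ hvw]
  constructor
  · rintro ⟨x, hx, hS, hd⟩
    refine ⟨x, hx, ?_, ?_, hS⟩
    · rw [jointFlow_free_iff hφ hψ hvw hx]
      exact (finrank_span_pair_eq_one.1 (hd x (hS ▸ ⟨0, jointFlow_zero hφ hψ x⟩))).2
    · rw [jointFlow_fixed_iff hφ hψ hvw hx]
      exact (finrank_span_pair_eq_one.1 (hd x (hS ▸ ⟨0, jointFlow_zero hφ hψ x⟩))).1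
  · rintro ⟨x, hx, hf, hc, hS⟩
    refine ⟨x, hx, hS, ?_⟩
    rw [hS]
    rintro _ ⟨τ, rfl⟩
    have hm := jointFlow_mem hφ hψ hvw hx τ
    refine finrank_span_pair_eq_one.2 ⟨?_, ?_⟩
    · refine fun h => hc ?_
      have := (jointFlow_fixed_iff hφ hψ hvw hm).2 h
      simpa only [jointFlow_stab_iff hφ hψ hvw hx] using this
    · refine fun h => hf ?_
      have := (jointFlow_free_iff hφ hψ hvw hm).2 h
      simpa only [jointFlow_stab_iff hφ hψ hvw hx] using this

end Flows

variable [CompactSpace M]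

/-- The joint flow of a two-dimensional Morse pair as an action of the plane. -/
theorem exists_planeAction (hvw : IsTwoMorsePair v w fv fw) : ∃ A : PlaneAction M,
    A.F = proj fv fw ∧ (∀ S, IsLeaf v w S ↔ A.IsLeaf S) ∧
      (∀ c, IsCriticalEdge v w c ↔ A.IsEdge c) ∧
        ∀ x ∈ A.dom, ∀ u, combField v w u x = 0 ↔ A.act u x = x := by
  obtain ⟨φ, hφc, hφ'⟩ := exists_continuous_flow hvw.contMDiff_v
  obtain ⟨ψ, hψc, hψ'⟩ := exists_continuous_flow hvw.contMDiff_w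
  have hφ : IsFlow v φ := ⟨hφc, fun x => (hφ' x).1, fun x => (hφ' x).2⟩
  have hψ : IsFlow w ψ := ⟨hψc, fun x => (hψ' x).1, fun x => (hψ' x).2⟩
  have hedge : ∀ {q}, q ∈ commSet φ ψ → (¬ ∀ u, jointFlow φ ψ u q = q) →
      (∃ u, u ≠ 0 ∧ jointFlow φ ψ u q = q) →
      IsCriticalEdge v w (range fun τ => jointFlow φ ψ τ q) := by
    intro q hq hc hf
    refine (isCriticalEdge_iff hφ hψ hvw _).2 ⟨q, hq, ?_, hc, rfl⟩
    obtain ⟨u, hu, hu'⟩ := hf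
    exact fun h => hu (h u hu')
  refine ⟨{
    act := jointFlow φ ψ
    F := proj fv fw
    dom := commSet φ ψ
    isClosed_dom := isClosed_commSet hφ hψ
    continuous_act := continuous_jointFlow hφ hψ
    continuous_F := ?_
    act_mem := fun hx τ => jointFlow_mem hφ hψ hvw hx τ
    act_zero := fun hx => jointFlow_zero hφ hψ _
    act_add := fun hx σ τ => jointFlow_add hφ hψ hvw hx σ τ
    mono := ?_
    act_smul := fun hx u hu r => jointFlow_smul_eq_of_combField hφ hψ hvw hx
      ((combField_eq_zero_iff hφ hψ hvw hx).2 hu) r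
    isOpenMap := fun hx hf => isOpenMap_proj_jointFlow hφ hψ hvw hx hf
    isolated_fixed := ?_
    isolated_edge := ?_
    chart := ?_ }, rfl, isLeaf_iff hφ hψ hvw, isCriticalEdge_iff hφ hψ hvw,
      fun x hx u => combField_eq_zero_iff hφ hψ hvw hx⟩
  · obtain ⟨g, hgv, hgw⟩ := hvw.gradient
    have h1 := hgv.1.continuous
    have h2 := hgw.1.continuous
    refine (PiLp.continuous_toLp 2 _).comp (continuous_pi fun i => ?_)
    fin_cases i
    · exact h1
    · exact h2
  · intro x hx u hu
    rw [inner_sub_right, sub_pos]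
    by_contra! hle
    exact hu ((combField_eq_zero_iff hφ hψ hvw hx).1
      (combField_eq_zero_of_le hφ hψ hvw hx u hle))
  · intro p hp hfix
    obtain ⟨U, hU, h⟩ := hvw.isolated_points p ((jointFlow_fixed_iff hφ hψ hvw hp).1 hfix)
    exact ⟨U, hU, fun q hq hqd hqf => h q hq ((jointFlow_fixed_iff hφ hψ hvw hqd).1 hqf)⟩
  · intro q hq hc hf
    have hqmem : q ∈ range fun τ => jointFlow φ ψ τ q := ⟨0, jointFlow_zero hφ hψ q⟩
    obtain ⟨U, hU, h⟩ := hvw.isolated_edges _ (hedge hq hc hf) q hqmem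
    refine ⟨U, hU, fun x hxU hx hxc hxf => ?_⟩
    have hxmem : x ∈ range fun τ => jointFlow φ ψ τ x := ⟨0, jointFlow_zero hφ hψ x⟩
    have := h _ (hedge hx hxc hxf) ⟨x, hxmem, hxU⟩
    rw [this] at hxmem
    obtain ⟨τ, hτ⟩ := hxmem
    exact ⟨τ, hτ.symm⟩
  · intro p hp hfix
    exact exists_linear_chart hφ hψ hvw ((jointFlow_fixed_iff hφ hψ hvw hp).1 hfix)

end Pair

/-! ### Geometry of the Euclidean plane. -/

section PlaneGeometry

/-- Rotation by a right angle. -/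
def rot (u : Plane) : Plane := !₂[-u 1, u 0]

theorem inner_plane (u v : Plane) : inner ℝ u v = u 0 * v 0 + u 1 * v 1 := by
  simp [PiLp.inner_apply, Fin.sum_univ_two, mul_comm]

@[simp] theorem rot_zero_apply (u : Plane) : rot u 0 = -u 1 := rfl
@[simp] theorem rot_one_apply (u : Plane) : rot u 1 = u 0 := rfl

@[simp] theorem inner_rot_self (u : Plane) : inner ℝ u (rot u) = (0 : ℝ) := by
  rw [inner_plane]; simp; ring

@[simp] theorem inner_rot_self' (u : Plane) : inner ℝ (rot u) u = (0 : ℝ) := by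
  rw [inner_plane]; simp; ring

theorem rot_neg (u : Plane) : rot (-u) = - rot u := by
  ext i; fin_cases i <;> simp [rot]

theorem plane_norm_sq (u : Plane) : ‖u‖ ^ 2 = u 0 * u 0 + u 1 * u 1 := by
  rw [← real_inner_self_eq_norm_sq, inner_plane]

theorem norm_rot (u : Plane) : ‖rot u‖ = ‖u‖ := by
  rw [← sq_eq_sq₀ (norm_nonneg _) (norm_nonneg _), plane_norm_sq, plane_norm_sq]
  simp; ring

theorem inner_rot_rot (u v : Plane) : inner ℝ (rot u) (rot v) = (inner ℝ u v : ℝ) := by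
  rw [inner_plane, inner_plane]; simp; ring

theorem plane_decomp {n : Plane} (hn : ‖n‖ = 1) (u : Plane) :
    u = (inner ℝ n u : ℝ) • n + (inner ℝ (rot n) u : ℝ) • rot n := by
  have h : n 0 * n 0 + n 1 * n 1 = 1 := by rw [← plane_norm_sq, hn, one_pow]
  simp only [inner_plane]
  ext i; fin_cases i
  · simp [rot]; linear_combination (-u 0) * h
  · simp [rot]; linear_combination (-u 1) * h

theorem eq_smul_of_inner_rot_eq_zero {n : Plane} (hn : ‖n‖ = 1) {u : Plane}
    (h : inner ℝ (rot n) u = (0 : ℝ)) : u = (inner ℝ n u : ℝ) • n := by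
  conv_lhs => rw [plane_decomp hn u, h, zero_smul, add_zero]

theorem eq_smul_rot_of_inner_eq_zero {n : Plane} (hn : ‖n‖ = 1) {u : Plane}
    (h : inner ℝ n u = (0 : ℝ)) : u = (inner ℝ (rot n) u : ℝ) • rot n := by
  conv_lhs => rw [plane_decomp hn u, h, zero_smul, zero_add]

theorem inner_self_eq_one {n : Plane} (hn : ‖n‖ = 1) : inner ℝ n n = (1 : ℝ) := by
  rw [real_inner_self_eq_norm_sq, hn, one_pow]

theorem eq_or_eq_neg_of_inner_rot_eq_zero {n u : Plane} (hn : ‖n‖ = 1) (hu : ‖u‖ = 1)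
    (h : inner ℝ (rot n) u = (0 : ℝ)) : u = n ∨ u = -n := by
  have h1 := eq_smul_of_inner_rot_eq_zero hn h
  have h2 := congrArg norm h1
  rw [norm_smul, hn, hu, mul_one, Real.norm_eq_abs] at h2
  rcases abs_eq zero_le_one |>.1 h2.symm with h3 | h3 <;> rw [h3] at h1
  · left; simpa using h1
  · right; simpa using h1

/-- An open convex set lies strictly on one side of a line through a point outside. -/
theorem exists_inner_lt_of_notMem {P : Set Plane} (hP : Convex ℝ P) (ho : IsOpen P) {z : Plane}
    (hz : z ∉ P) (hne : P.Nonempty) : ∃ u : Plane, u ≠ 0 ∧ ∀ y ∈ P, inner ℝ u y < (inner ℝ u z : ℝ) := by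
  obtain ⟨f, hf⟩ := geometric_hahn_banach_open_point hP ho hz
  refine ⟨(InnerProductSpace.toDual ℝ Plane).symm f, ?_, fun y hy => ?_⟩
  · rintro h0
    obtain ⟨y, hy⟩ := hne
    have := hf y hy
    rw [show f = 0 by simpa using h0] at this
    simp at this
  · simpa [InnerProductSpace.toDual_symm_apply] using hf y hy

end PlaneGeometry

/-! ### Convexity of the range of a monotone map. -/

section Monotone

variable {E : Type*} [NormedAddCommGroup E] [InnerProductSpace ℝ E] [FiniteDimensional ℝ E]

/-- The range of a continuous open monotone map is the interior of its convex hull. -/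
theorem range_eq_interior_convexHull_of_monotone {G : E → E} (hc : Continuous G)
    (ho : IsOpenMap G) (hm : ∀ σ τ, 0 ≤ (inner ℝ (σ - τ) (G σ - G τ) : ℝ)) :
    range G = interior (convexHull ℝ (range G)) := by
  refine (interior_maximal (subset_convexHull ℝ _) ho.isOpen_range).antisymm ?_
  have hconn : IsPreconnected (interior (convexHull ℝ (range G))) :=
    (convex_convexHull ℝ _).interior.isPreconnected
  refine hconn.subset_of_closure_inter_subset ho.isOpen_range ?_ ?_
  · refine ⟨G 0, ?_, mem_range_self 0⟩
    exact interior_maximal (subset_convexHull ℝ _) ho.isOpen_range (mem_range_self 0)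
  rintro z ⟨hz, hzi⟩
  have hl : (comap G (𝓝 z)).NeBot := by
    rw [comap_neBot_iff]
    intro t ht
    obtain ⟨_, hy, τ, rfl⟩ := mem_closure_iff_nhds.1 hz t ht
    exact ⟨τ, hy⟩
  set p := Ultrafilter.of (comap G (𝓝 z))
  have hp : Tendsto G p (𝓝 z) := tendsto_comap.mono_left (Ultrafilter.of_le _)
  -- If the preimages stay bounded, they accumulate at a preimage of z. If not, their directions
  -- accumulate at a unit vector u, and monotonicity in the limit puts the whole range behind the
  -- line through z orthogonal to u, which is impossible for an interior point of the hull.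
  by_cases hb : ∃ R : ℝ, Metric.closedBall (0 : E) R ∈ p
  · obtain ⟨R, hR⟩ := hb
    obtain ⟨τ, -, hτ⟩ := (isCompact_closedBall (0 : E) R).ultrafilter_le_nhds p
      (le_principal_iff.2 hR)
    exact ⟨τ, tendsto_nhds_unique ((hc.tendsto τ).mono_left hτ) hp⟩
  exfalso
  push Not at hb
  have hnorm : Tendsto (fun τ : E => ‖τ‖) p atTop := by
    refine tendsto_atTop.2 fun R => ?_
    have := Ultrafilter.compl_mem_iff_notMem.2 (hb R)
    filter_upwards [this] with τ hτ
    simp at hτ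
    exact hτ.le
  have hinv : Tendsto (fun τ : E => ‖τ‖⁻¹) p (𝓝 0) := tendsto_inv_atTop_zero.comp hnorm
  have hu : ∃ u : E, Tendsto (fun τ : E => ‖τ‖⁻¹ • τ) p (𝓝 u) := by
    obtain ⟨u, -, hu⟩ := (isCompact_closedBall (0 : E) 1).ultrafilter_le_nhds
      (p.map fun τ : E => ‖τ‖⁻¹ • τ) (le_principal_iff.2 (by
        refine mem_map.2 (Filter.univ_mem' fun τ => ?_)
        change ‖τ‖⁻¹ • τ ∈ Metric.closedBall (0 : E) 1
        rw [mem_closedBall_zero_iff, norm_smul, norm_inv, norm_norm]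
        exact inv_mul_le_one))
    exact ⟨u, hu⟩
  obtain ⟨u, hu⟩ := hu
  have hu1 : ‖u‖ = 1 := by
    refine tendsto_nhds_unique hu.norm (tendsto_const_nhds.congr' ?_)
    filter_upwards [hnorm.eventually_gt_atTop 0] with τ hτ
    rw [norm_smul, norm_inv, norm_norm, inv_mul_cancel₀ hτ.ne']
  have hhalf : convexHull ℝ (range G) ⊆ {y | inner ℝ u y ≤ (inner ℝ u z : ℝ)} := by
    refine convexHull_min ?_ (convex_halfSpace_le (f := fun y => (inner ℝ u y : ℝ))
      ⟨fun a b => inner_add_right _ _ _, fun c a => by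
        rw [inner_smul_right, smul_eq_mul]⟩ _)
    rintro _ ⟨σ, rfl⟩
    have h1 : Tendsto (fun τ : E => (inner ℝ (‖τ‖⁻¹ • τ - ‖τ‖⁻¹ • σ) (G τ - G σ) : ℝ)) p
        (𝓝 (inner ℝ (u - (0 : ℝ) • σ) (z - G σ))) :=
      (hu.sub (hinv.smul_const σ)).inner (hp.sub_const _)
    have h2 := ge_of_tendsto' h1 fun τ => by
      rw [← smul_sub, real_inner_smul_left]
      exact mul_nonneg (inv_nonneg.2 (norm_nonneg _)) (hm τ σ)
    rw [zero_smul, sub_zero, inner_sub_right, sub_nonneg] at h2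
    exact h2
  obtain ⟨ε, hε, hball⟩ := Metric.mem_nhds_iff.1 (mem_interior_iff_mem_nhds.1 hzi)
  have h3 : z + (ε / 2) • u ∈ Metric.ball z ε := by
    rw [mem_ball_iff_norm, add_sub_cancel_left, norm_smul, hu1, mul_one, Real.norm_eq_abs,
      abs_of_pos (half_pos hε)]
    exact half_lt_self hε
  have h4 := hhalf (hball h3)
  rw [mem_ofPred, inner_add_right, real_inner_smul_right, real_inner_self_eq_norm_sq, hu1] at h4
  linarith

end Monotone

/-! ### Connectedness of the fibres of a limit of sets. -/

section Fibres

variable {X : Type*} [TopologicalSpace X]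

theorem IsPreconnected.subset_singleton_of_isolated [T1Space X] {T : Set X} (hT : IsPreconnected T)
    {x : X} (hx : x ∈ T) {U : Set X} (hU : U ∈ 𝓝 x) (h : U ∩ T ⊆ {x}) : T ⊆ {x} := by
  intro y hy
  by_contra hne
  obtain ⟨z, hz, hzU, hzx⟩ := hT (interior U) {x}ᶜ isOpen_interior isOpen_compl_singleton
    (fun z _ => by
      by_cases hzx : z = x
      · exact .inl (hzx ▸ mem_interior_iff_mem_nhds.2 hU)
      · exact .inr hzx) ⟨x, hx, mem_interior_iff_mem_nhds.2 hU⟩ ⟨y, hy, hne⟩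
  exact hzx (h ⟨interior_subset hzU, hz⟩)

theorem IsPreconnected.subsingleton_of_finite [T1Space X] {T : Set X} (hT : IsPreconnected T)
    (hf : T.Finite) : T.Subsingleton := by
  intro x hx y hy
  have := IsPreconnected.subset_singleton_of_isolated hT hx (U := (T \ {x})ᶜ)
    ((hf.subset sdiff_subset).isClosed.isOpen_compl.mem_nhds (by simp))
    (fun z hz => by
      by_contra hne
      exact hz.1 ⟨hz.2, hne⟩)
  exact (this hy).symm

/-- The fibres of a limit of sets with connected fibres over balls are connected. -/
theorem isPreconnected_fibre_of_limit [CompactSpace X] [T2Space X] {ι : Type*} {l : Filter ι}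
    [l.NeBot] {F : X → Plane} (hF : Continuous F) {S : ι → Set X} {K : Set X} (hK : IsClosed K)
    (hupper : ∀ U, IsOpen U → K ⊆ U → ∀ᶠ m in l, S m ⊆ U)
    (hlower : ∀ U, IsOpen U → (K ∩ U).Nonempty → ∀ᶠ m in l, (S m ∩ U).Nonempty)
    (hconn : ∀ m z ε, IsPreconnected (S m ∩ F ⁻¹' Metric.ball z ε)) (z : Plane) :
    IsPreconnected (K ∩ F ⁻¹' {z}) := by
  have hTc : IsClosed (K ∩ F ⁻¹' {z}) := hK.inter (isClosed_singleton.preimage hF)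
  rw [isPreconnected_iff_subset_of_disjoint_closed]
  intro u v hu hv huv hdisj
  by_contra! hcon
  obtain ⟨⟨b, hbT, hbu⟩, ⟨a, haT, hav⟩⟩ := hcon.imp not_subset.1 not_subset.1
  have hau : a ∈ u := (huv haT).resolve_right hav
  have hbv : b ∈ v := (huv hbT).resolve_left hbu
  obtain ⟨U, V, hU, hV, hAU, hBV, hUV⟩ : SeparatedNhds (K ∩ F ⁻¹' {z} ∩ u) (K ∩ F ⁻¹' {z} ∩ v) :=
    SeparatedNhds.of_isCompact_isCompact (hTc.inter hu).isCompact (hTc.inter hv).isCompact (by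
      rw [Set.disjoint_iff]
      rintro y ⟨⟨hy, hyu⟩, -, hyv⟩
      exact hdisj.le ⟨hy, hyu, hyv⟩)
  -- Away from the two separating open sets, K maps to a compact set that misses z, so it misses a
  -- ball about z. Over a smaller ball the sets S m eventually lie in U ∪ V and meet both.
  have hRc : IsCompact (K ∩ (U ∪ V)ᶜ) := (hK.inter (hU.union hV).isClosed_compl).isCompact
  have hz : z ∈ (F '' (K ∩ (U ∪ V)ᶜ))ᶜ := by
    rintro ⟨y, ⟨hyK, hy⟩, rfl⟩
    rcases huv ⟨hyK, rfl⟩ with h | h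
    · exact hy (.inl (hAU ⟨⟨hyK, rfl⟩, h⟩))
    · exact hy (.inr (hBV ⟨⟨hyK, rfl⟩, h⟩))
  obtain ⟨ε, hε, hball⟩ := Metric.isOpen_iff.1 (hRc.image hF).isClosed.isOpen_compl z hz
  have h1 := hupper ((U ∪ V) ∪ F ⁻¹' (Metric.closedBall z (ε / 2))ᶜ)
    ((hU.union hV).union (Metric.isClosed_closedBall.isOpen_compl.preimage hF)) (fun y hy => by
      by_contra hn
      rw [mem_union, not_or] at hn
      have h2 : F y ∈ Metric.closedBall z (ε / 2) := not_not.1 hn.2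
      exact hball (Metric.closedBall_subset_ball (half_lt_self hε) h2) ⟨y, ⟨hy, hn.1⟩, rfl⟩)
  have hB : IsOpen (F ⁻¹' Metric.ball z (ε / 2)) := Metric.isOpen_ball.preimage hF
  have hzB : ∀ y ∈ F ⁻¹' {z}, y ∈ F ⁻¹' Metric.ball z (ε / 2) := fun y hy => by
    rw [mem_preimage, mem_singleton_iff] at hy
    rw [mem_preimage, hy]
    exact Metric.mem_ball_self (half_pos hε)
  have h2 := hlower _ (hU.inter hB) ⟨a, haT.1, hAU ⟨haT, hau⟩, hzB a haT.2⟩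
  have h3 := hlower _ (hV.inter hB) ⟨b, hbT.1, hBV ⟨hbT, hbv⟩, hzB b hbT.2⟩
  obtain ⟨m, hm1, ⟨y₂, hy₂⟩, ⟨y₃, hy₃⟩⟩ := (h1.and (h2.and h3)).exists
  obtain ⟨y, -, hy⟩ := hconn m z (ε / 2) U V hU hV (fun y hy => by
    rcases hm1 hy.1 with h | h
    · exact h
    · exact absurd (Metric.ball_subset_closedBall hy.2) h)
    ⟨y₂, ⟨hy₂.1, hy₂.2.2⟩, hy₂.2.1⟩ ⟨y₃, ⟨hy₃.1, hy₃.2.2⟩, hy₃.2.1⟩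
  exact Set.disjoint_iff.1 hUV hy

/-- A continuous map which is injective on a compact set reflects convergence. -/
theorem tendsto_of_tendsto_image [T2Space X] {Y : Type*} [TopologicalSpace Y] [T2Space Y]
    {F : X → Y} (hF : Continuous F) {K : Set X} (hK : IsCompact K) (hinj : InjOn F K) {ι : Type*}
    {l : Filter ι} {y : ι → X} {p : X} (hy : ∀ᶠ m in l, y m ∈ K) (hp : p ∈ K)
    (h : Tendsto (fun m => F (y m)) l (𝓝 (F p))) : Tendsto y l (𝓝 p) := by
  refine tendsto_iff_ultrafilter _ _ _ |>.2 fun g hg => ?_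
  obtain ⟨q, hq, hq'⟩ := hK.ultrafilter_le_nhds (g.map y) (le_principal_iff.2 (hg hy))
  have h1 : Tendsto (fun m => F (y m)) g (𝓝 (F q)) := (hF.tendsto q).comp hq'
  have h2 := hinj hq hp (tendsto_nhds_unique h1 (h.mono_left hg))
  rwa [← h2]

end Fibres

/-! ### The image of a leaf, and injectivity of the potential on its closure. -/

namespace PlaneAction

variable {M : Type*} [TopologicalSpace M] [T2Space M] [CompactSpace M] (A : PlaneAction M)

section Basic

variable {A} {x y q : M}

theorem continuous_act_left (x : M) : Continuous fun τ => A.act τ x :=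
  A.continuous_act.comp (f := fun τ => (τ, x)) (by fun_prop)

theorem continuous_act_right (τ : Plane) : Continuous fun x => A.act τ x :=
  A.continuous_act.comp (f := fun x => (τ, x)) (by fun_prop)

theorem act_act_eq_iff (hx : x ∈ A.dom) (τ u : Plane) :
    A.act u (A.act τ x) = A.act τ x ↔ A.act u x = x := by
  constructor
  · intro h
    have h1 := congrArg (A.act (-τ)) h
    rw [← A.act_add hx, ← A.act_add hx, ← A.act_add hx, neg_add_cancel, A.act_zero hx] at h1
    rwa [show -τ + (u + τ) = u by abel] at h1
  · intro h
    rw [← A.act_add hx, add_comm, A.act_add hx, h]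

theorem free_act_iff (hx : x ∈ A.dom) (τ : Plane) : A.Free (A.act τ x) ↔ A.Free x := by
  simp only [Free, act_act_eq_iff hx]

theorem mem_orbit_self (hx : x ∈ A.dom) : x ∈ A.orbit x := ⟨0, A.act_zero hx⟩

theorem act_mem_orbit (τ : Plane) : A.act τ x ∈ A.orbit x := ⟨τ, rfl⟩

theorem orbit_subset_dom (hx : x ∈ A.dom) : A.orbit x ⊆ A.dom := by
  rintro _ ⟨τ, rfl⟩
  exact A.act_mem hx τ

theorem closure_orbit_subset_dom (hx : x ∈ A.dom) : closure (A.orbit x) ⊆ A.dom :=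
  closure_minimal (orbit_subset_dom hx) A.isClosed_dom

theorem orbit_eq_of_mem (hx : x ∈ A.dom) (hy : y ∈ A.orbit x) : A.orbit y = A.orbit x := by
  obtain ⟨τ, rfl⟩ := hy
  ext z
  constructor
  · rintro ⟨σ, rfl⟩
    exact ⟨σ + τ, A.act_add hx σ τ⟩
  · rintro ⟨σ, rfl⟩
    refine ⟨σ - τ, ?_⟩
    simp only
    rw [← A.act_add hx, sub_add_cancel]

theorem act_mem_closure_orbit (hx : x ∈ A.dom) (hy : y ∈ closure (A.orbit x)) (τ : Plane) :
    A.act τ y ∈ closure (A.orbit x) := by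
  refine map_mem_closure (continuous_act_right τ) hy ?_
  rintro _ ⟨σ, rfl⟩
  exact ⟨τ + σ, A.act_add hx τ σ⟩

theorem orbit_subset_closure_orbit (hx : x ∈ A.dom) (hy : y ∈ closure (A.orbit x)) :
    A.orbit y ⊆ closure (A.orbit x) := by
  rintro _ ⟨τ, rfl⟩
  exact act_mem_closure_orbit hx hy τ

theorem inner_pos_of_ne (hx : x ∈ A.dom) {σ τ : Plane} (h : A.act σ x ≠ A.act τ x) :
    0 < (inner ℝ (σ - τ) (A.F (A.act σ x) - A.F (A.act τ x)) : ℝ) := by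
  have h1 : A.act σ x = A.act (σ - τ) (A.act τ x) := by rw [← A.act_add hx, sub_add_cancel]
  rw [h1] at h ⊢
  exact A.mono (A.act_mem hx τ) _ h

theorem inner_nonneg (hx : x ∈ A.dom) (σ τ : Plane) :
    0 ≤ (inner ℝ (σ - τ) (A.F (A.act σ x) - A.F (A.act τ x)) : ℝ) := by
  by_cases h : A.act σ x = A.act τ x
  · simp [h]
  · exact (inner_pos_of_ne hx h).le

theorem injOn_F_orbit (hx : x ∈ A.dom) : InjOn A.F (A.orbit x) := by
  rintro _ ⟨σ, rfl⟩ _ ⟨τ, rfl⟩ h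
  by_contra hne
  have := inner_pos_of_ne hx hne
  simp only at h
  simp [h] at this

theorem Free.act_injective (hf : A.Free x) (hx : x ∈ A.dom) : Injective fun τ => A.act τ x := by
  intro σ τ h
  simp only at h
  have h1 : A.act (σ - τ) (A.act τ x) = A.act τ x := by rw [← A.act_add hx, sub_add_cancel, h]
  exact sub_eq_zero.1 (hf _ ((act_act_eq_iff hx _ _).1 h1))

theorem Free.F_act_injective (hf : A.Free x) (hx : x ∈ A.dom) :
    Injective fun τ => A.F (A.act τ x) := fun _ _ h =>
  hf.act_injective hx (injOn_F_orbit hx ⟨_, rfl⟩ ⟨_, rfl⟩ h)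

theorem image_orbit (x : M) : A.F '' A.orbit x = range fun τ => A.F (A.act τ x) :=
  (range_comp _ _).symm

/-- The fixed points form a closed discrete subset of a compact space. -/
theorem finite_fixed : {p | p ∈ A.dom ∧ A.Fixed p}.Finite := by
  have hcl : IsClosed {p | p ∈ A.dom ∧ A.Fixed p} := by
    have h : {p | p ∈ A.dom ∧ A.Fixed p} = A.dom ∩ ⋂ u, {p | A.act u p = p} := by
      ext; simp [Fixed]
    rw [h]
    exact A.isClosed_dom.inter
      (isClosed_iInter fun u => isClosed_eq (continuous_act_right u) continuous_id)
  have h : ∀ p : M, ∃ U ∈ 𝓝 p, U ∩ {p | p ∈ A.dom ∧ A.Fixed p} ⊆ {p} := fun p => by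
    by_cases hp : p ∈ {p | p ∈ A.dom ∧ A.Fixed p}
    · obtain ⟨U, hU, h⟩ := A.isolated_fixed hp.1 hp.2
      exact ⟨U, hU, fun q hq => h q hq.1 hq.2.1 hq.2.2⟩
    · exact ⟨_, hcl.isOpen_compl.mem_nhds hp, fun q hq => absurd hq.2 hq.1⟩
  choose U hU hU' using h
  obtain ⟨s, -, hs⟩ := hcl.isCompact.elim_nhds_subcover U fun p _ => hU p
  refine s.finite_toSet.subset fun p hp => ?_
  obtain ⟨y, hy, hpy⟩ := mem_iUnion₂.1 (hs hp)
  rw [hU' y ⟨hpy, hp⟩]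
  exact hy

end Basic

section Leaf

variable {A} {x q : M} (hx : x ∈ A.dom) (hf : A.Free x)

include hx hf

theorem isOpen_image_orbit : IsOpen (A.F '' A.orbit x) := by
  rw [image_orbit]
  exact (A.isOpenMap hx hf).isOpen_range

theorem convex_image_orbit : Convex ℝ (A.F '' A.orbit x) := by
  rw [image_orbit, range_eq_interior_convexHull_of_monotone (G := fun τ => A.F (A.act τ x))
    (A.continuous_F.comp (continuous_act_left x)) (A.isOpenMap hx hf) (inner_nonneg hx)]
  exact (convex_convexHull ℝ _).interior

theorem isOpenEmbedding_F_act : Topology.IsOpenEmbedding fun τ => A.F (A.act τ x) :=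
  .of_continuous_injective_isOpenMap (A.continuous_F.comp (continuous_act_left x))
    (hf.F_act_injective hx) (A.isOpenMap hx hf)

omit hf in
omit hx in
theorem image_closure_orbit (x : M) : A.F '' closure (A.orbit x) = closure (A.F '' A.orbit x) :=
  image_closure_of_isCompact isClosed_closure.isCompact A.continuous_F.continuousOn

/-- Let q be a limit of τ_k·x. The values F(τ_k·x) converge to a point of the image, and τ ↦ F(τ·x)
is an embedding, so the times τ_k converge. -/
theorem mem_orbit_of_F_mem (hq : q ∈ closure (A.orbit x)) (h : A.F q ∈ A.F '' A.orbit x) :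
    q ∈ A.orbit x := by
  rw [image_orbit] at h
  obtain ⟨τ, hτ⟩ := h
  obtain ⟨g, hg, hgq⟩ := mem_closure_iff_ultrafilter.1 hq
  have hmap : ∃ p : Ultrafilter Plane, Tendsto (fun τ => A.act τ x) p (𝓝 q) := by
    refine ⟨Ultrafilter.ofComapInfPrincipal (m := fun τ => A.act τ x) (s := univ) (g := g)
      (by rwa [image_univ]), ?_⟩
    rw [Tendsto, ← Ultrafilter.coe_map, Ultrafilter.ofComapInfPrincipal_eq_of_map]
    exact hgq
  obtain ⟨p, hp⟩ := hmap
  have h1 : Tendsto (fun τ => A.F (A.act τ x)) p (𝓝 (A.F (A.act τ x))) := by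
    simp only at hτ
    rw [hτ]
    exact (A.continuous_F.tendsto q).comp hp
  have h2 : Tendsto id (p : Filter Plane) (𝓝 τ) :=
    ((isOpenEmbedding_F_act hx hf).isInducing.tendsto_nhds_iff).2 h1
  have h3 := ((continuous_act_left (A := A) x).tendsto τ).comp h2
  exact ⟨τ, tendsto_nhds_unique h3 hp⟩

/-- The image of the orbit of q is an open subset of the closure of an open convex set, hence is
contained in that convex set. -/
theorem mem_orbit_of_free (hq : q ∈ closure (A.orbit x)) (hqf : A.Free q) : q ∈ A.orbit x := by
  have hqd := closure_orbit_subset_dom hx hq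
  refine mem_orbit_of_F_mem hx hf hq ?_
  have h1 : A.F '' A.orbit q ⊆ closure (A.F '' A.orbit x) := by
    rw [← image_closure_orbit]
    exact image_mono (orbit_subset_closure_orbit hx hq)
  have h2 := interior_maximal h1 (isOpen_image_orbit hqd hqf) ⟨q, mem_orbit_self hqd, rfl⟩
  rwa [(convex_image_orbit hx hf).interior_closure_eq_interior_of_nonempty_interior,
    (isOpen_image_orbit hx hf).interior_eq] at h2
  rw [(isOpen_image_orbit hx hf).interior_eq]
  exact ⟨_, x, mem_orbit_self hx, rfl⟩

theorem F_notMem_of_not_free (hq : q ∈ closure (A.orbit x)) (hqf : ¬ A.Free q) :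
    A.F q ∉ A.F '' A.orbit x := fun h => hqf <| by
  obtain ⟨τ, rfl⟩ := mem_orbit_of_F_mem hx hf hq h
  exact (free_act_iff hx τ).2 hf

/-- Under the embedding τ ↦ F(τ·x) this set of times corresponds to the intersection of a ball with
a convex set. It is the input for the connectedness of fibres. -/
theorem isPreconnected_orbit_inter (z : Plane) (ε : ℝ) :
    IsPreconnected (A.orbit x ∩ A.F ⁻¹' Metric.ball z ε) := by
  have h1 : IsPreconnected ((fun τ => A.F (A.act τ x)) ⁻¹' Metric.ball z ε) := by
    rw [← (isOpenEmbedding_F_act hx hf).isInducing.isPreconnected_image, image_preimage_eq_inter_range,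
      ← image_orbit]
    exact ((convex_ball z ε).inter (convex_image_orbit hx hf)).isPreconnected
  have h2 := h1.image (fun τ => A.act τ x) (continuous_act_left x).continuousOn
  convert h2 using 1
  ext y
  constructor
  · rintro ⟨⟨τ, rfl⟩, h⟩
    exact ⟨τ, h, rfl⟩
  · rintro ⟨τ, h, rfl⟩
    exact ⟨⟨τ, rfl⟩, h⟩

/-- The potential is injective on the closure of a leaf. -/
theorem injOn_F_closure_orbit : InjOn A.F (closure (A.orbit x)) := by
  intro a ha b hb hab
  -- The fibre is connected, the closure being the limit of the constant sequence given by the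
  -- orbit. If the fibre meets the orbit, it lies in it, where F is injective; otherwise it suffices
  -- to find one isolated point in it.
  set T := closure (A.orbit x) ∩ A.F ⁻¹' {A.F a} with hT
  have hpre : IsPreconnected T := isPreconnected_fibre_of_limit (l := (pure () : Filter Unit))
    A.continuous_F (S := fun _ => A.orbit x) isClosed_closure
    (fun U _ h => by simpa using subset_closure.trans h)
    (fun U hU h => by simpa using (closure_inter_open_nonempty_iff hU).1 h)
    (fun _ z ε => isPreconnected_orbit_inter hx hf z ε) (A.F a)
  have haT : a ∈ T := ⟨ha, rfl⟩
  have hbT : b ∈ T := ⟨hb, hab.symm⟩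
  have hdom : ∀ y ∈ T, y ∈ A.dom := fun y hy => closure_orbit_subset_dom hx hy.1
  by_cases h1 : ∃ y ∈ T, A.Free y
  · obtain ⟨y, hy, hyf⟩ := h1
    have hyo := mem_orbit_of_free hx hf hy.1 hyf
    have h2 : ∀ c ∈ T, c ∈ A.orbit x := fun c hc =>
      mem_orbit_of_F_mem hx hf hc.1 ⟨y, hyo, hy.2.trans hc.2.symm⟩
    exact injOn_F_orbit hx (h2 a haT) (h2 b hbT) hab
  push Not at h1
  have hsub : ∀ y ∈ T, (∃ U ∈ 𝓝 y, U ∩ T ⊆ {y}) → a = b := by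
    rintro y hy ⟨U, hU, h⟩
    have := IsPreconnected.subset_singleton_of_isolated hpre hy hU h
    rw [this haT, this hbT]
  by_cases h2 : ∃ y ∈ T, ¬ A.Fixed y
  · obtain ⟨y, hy, hyc⟩ := h2
    have hnf : ∀ z ∈ T, ∃ u, u ≠ 0 ∧ A.act u z = z := fun z hz => by
      have := h1 z hz
      simp only [Free, not_forall] at this
      obtain ⟨u, hu, hu0⟩ := this
      exact ⟨u, hu0, hu⟩
    obtain ⟨U, hU, h⟩ := A.isolated_edge (hdom y hy) hyc (hnf y hy)
    have hopen : {z | ¬ A.Fixed z} ∈ 𝓝 y := by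
      refine IsOpen.mem_nhds ?_ hyc
      simp only [Fixed, not_forall, ofPred_exists]
      exact isOpen_iUnion fun u => (isClosed_eq (continuous_act_right u)
        continuous_id).isOpen_compl
    -- Points of the fibre near y are not fixed, so they lie on the one-dimensional orbit of y,
    -- where F is injective.
    refine hsub y hy ⟨_, inter_mem hU hopen, ?_⟩
    rintro z ⟨⟨hzU, hzc⟩, hzT⟩
    obtain ⟨τ, hτ⟩ := h z hzU (hdom z hzT) hzc (hnf z hzT)
    exact injOn_F_orbit (hdom y hy) ⟨τ, hτ.symm⟩ (mem_orbit_self (hdom y hy))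
      (hzT.2.trans hy.2.symm)
  · push Not at h2
    obtain ⟨U, hU, h⟩ := A.isolated_fixed (hdom a haT) (h2 a haT)
    exact hsub a haT ⟨U, hU, fun z hz => h z hz.1 (hdom z hz.2) (h2 z hz.2)⟩

end Leaf

end PlaneAction

/-! ### One-dimensional orbits and their end points. -/

namespace PlaneAction

variable {M : Type*} [TopologicalSpace M] [T2Space M] [CompactSpace M] (A : PlaneAction M)

/-- `q` lies on a one-dimensional orbit, with stabilizer spanned by the unit vector `n`. -/
structure EdgeAt (q : M) (n : Plane) : Prop where
  mem : q ∈ A.dom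
  norm : ‖n‖ = 1
  stab : ∀ u, A.act u q = q ↔ inner ℝ (rot n) u = (0 : ℝ)

variable {A} {q : M} {n : Plane}

/-- If the stabilizer had an element off the line of a nonzero element, it would contain two
independent lines, because it contains the real multiples of its elements. -/
theorem exists_edgeAt (hq : q ∈ A.dom) (hf : ¬ A.Free q) (hc : ¬ A.Fixed q) :
    ∃ n, A.EdgeAt q n := by
  simp only [Free, not_forall] at hf
  obtain ⟨u, hu, hu0⟩ := hf
  have hun : ‖u‖ ≠ 0 := norm_ne_zero_iff.2 hu0
  have hn1 : ‖‖u‖⁻¹ • u‖ = 1 := by rw [norm_smul, norm_inv, norm_norm, inv_mul_cancel₀ hun]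
  have hstabn : ∀ r : ℝ, A.act (r • (‖u‖⁻¹ • u)) q = q := fun r => by
    rw [smul_smul]; exact A.act_smul hq u hu _
  refine ⟨‖u‖⁻¹ • u, hq, hn1, fun w => ⟨fun hw => ?_, fun hw => ?_⟩⟩
  · by_contra hne
    refine hc fun z => ?_
    set n := ‖u‖⁻¹ • u
    set b : ℝ := inner ℝ (rot n) w
    have h1 : A.act (b • rot n) q = q := by
      have h2 : b • rot n = w + (-(inner ℝ n w : ℝ)) • n := by
        have h0 : w = (inner ℝ n w : ℝ) • n + b • rot n := plane_decomp hn1 w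
        rw [neg_smul, ← sub_eq_add_neg, eq_sub_iff_add_eq, add_comm]
        exact h0.symm
      rw [h2, A.act_add hq, hstabn, hw]
    have h2 : A.act (rot n) q = q := by
      have := A.act_smul hq _ h1 b⁻¹
      rwa [smul_smul, inv_mul_cancel₀ hne, one_smul] at this
    rw [plane_decomp hn1 z, A.act_add hq, A.act_smul hq _ h2, hstabn]
  · rw [eq_smul_of_inner_rot_eq_zero hn1 hw]
    exact hstabn _

namespace EdgeAt

variable (h : A.EdgeAt q n)

include h

theorem act (τ : Plane) : A.EdgeAt (A.act τ q) n :=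
  ⟨A.act_mem h.mem τ, h.norm, fun u => by rw [act_act_eq_iff h.mem, h.stab]⟩

theorem of_mem_orbit {y : M} (hy : y ∈ A.orbit q) : A.EdgeAt y n := by
  obtain ⟨τ, rfl⟩ := hy
  exact h.act τ

theorem neg : A.EdgeAt q (-n) :=
  ⟨h.mem, by rw [norm_neg, h.norm], fun u => by rw [h.stab, rot_neg, inner_neg_left, neg_eq_zero]⟩

theorem not_free : ¬ A.Free q := fun hf => by
  have h1 := hf n ((h.stab n).2 (inner_rot_self' n))
  have h2 := h.norm
  rw [h1, norm_zero] at h2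
  exact zero_ne_one h2

theorem not_fixed : ¬ A.Fixed q := fun hc => by
  have h1 := (h.stab _).1 (hc (rot n))
  rw [inner_rot_rot, inner_self_eq_one h.norm] at h1
  exact one_ne_zero h1

theorem isEdge : A.IsEdge (A.orbit q) := ⟨q, h.mem, h.not_free, h.not_fixed, rfl⟩

theorem eq_or_eq_neg {m : Plane} (h' : A.EdgeAt q m) : m = n ∨ m = -n :=
  eq_or_eq_neg_of_inner_rot_eq_zero h.norm h'.norm
    ((h.stab m).1 ((h'.stab m).2 (inner_rot_self' m)))

theorem act_eq (u : Plane) : A.act u q = A.act ((inner ℝ (rot n) u : ℝ) • rot n) q := by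
  conv_lhs => rw [plane_decomp h.norm u, add_comm, A.act_add h.mem]
  rw [(h.stab _).2]
  rw [real_inner_smul_right, inner_rot_self', mul_zero]

theorem orbit_eq : A.orbit q = range fun t : ℝ => A.act (t • rot n) q := by
  ext y
  constructor
  · rintro ⟨u, rfl⟩
    exact ⟨_, (h.act_eq u).symm⟩
  · rintro ⟨t, rfl⟩
    exact ⟨_, rfl⟩

/-- The time u + r n acts on q like u for every real r. Monotonicity then bounds an affine function
of r from below, so the coefficient of r vanishes and the edge projects into a line orthogonal to n.
-/
theorem inner_F_act (u : Plane) : inner ℝ n (A.F (A.act u q)) = (inner ℝ n (A.F q) : ℝ) := by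
  have key : ∀ r : ℝ, 0 ≤ (inner ℝ u (A.F (A.act u q) - A.F q) : ℝ)
      + r * inner ℝ n (A.F (A.act u q) - A.F q) := fun r => by
    have h1 := inner_nonneg h.mem (u + r • n) 0
    rw [A.act_zero h.mem, A.act_add h.mem, (h.stab (r • n)).2, sub_zero, inner_add_left,
      real_inner_smul_left] at h1
    · exact h1
    · rw [real_inner_smul_right, inner_rot_self', mul_zero]
  set a : ℝ := inner ℝ u (A.F (A.act u q) - A.F q)
  set b : ℝ := inner ℝ n (A.F (A.act u q) - A.F q) with hb
  have hb0 : b = 0 := by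
    by_contra hne
    have := key (-(a + 1) / b)
    rw [div_mul_cancel₀ _ hne] at this
    linarith
  rw [hb, inner_sub_right, sub_eq_zero] at hb0
  exact hb0

theorem inner_F_of_mem {y : M} (hy : y ∈ A.orbit q) :
    inner ℝ n (A.F y) = (inner ℝ n (A.F q) : ℝ) := by
  obtain ⟨τ, rfl⟩ := hy
  exact h.inner_F_act τ

theorem strictMono : StrictMono fun t : ℝ => (inner ℝ (rot n) (A.F (A.act (t • rot n) q)) : ℝ) := by
  intro s t hst
  have hne : A.act (t • rot n) q ≠ A.act (s • rot n) q := by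
    intro heq
    have h1 : A.act (t • rot n - s • rot n) (A.act (s • rot n) q) = A.act (s • rot n) q := by
      rw [← A.act_add h.mem, sub_add_cancel, heq]
    rw [act_act_eq_iff h.mem, h.stab, ← sub_smul, real_inner_smul_right, inner_rot_rot,
      inner_self_eq_one h.norm, mul_one] at h1
    linarith
  have h2 := inner_pos_of_ne h.mem hne
  rw [← sub_smul, real_inner_smul_left, inner_sub_right] at h2
  have := (pos_iff_pos_of_mul_pos h2).1 (sub_pos.2 hst)
  exact sub_pos.1 this

theorem continuous_height :
    Continuous fun t : ℝ => (inner ℝ (rot n) (A.F (A.act (t • rot n) q)) : ℝ) := by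
  have h1 : Continuous fun t : ℝ => A.F (A.act (t • rot n) q) :=
    A.continuous_F.comp ((continuous_act_left q).comp (by fun_prop))
  fun_prop

theorem F_act_eq (t : ℝ) : A.F (A.act (t • rot n) q) = A.F q +
    ((inner ℝ (rot n) (A.F (A.act (t • rot n) q)) : ℝ) - inner ℝ (rot n) (A.F q)) • rot n := by
  have h1 : inner ℝ n (A.F (A.act (t • rot n) q) - A.F q) = (0 : ℝ) := by
    rw [inner_sub_right, h.inner_F_act, sub_self]
  have h2 := eq_smul_rot_of_inner_eq_zero h.norm h1
  rw [inner_sub_right] at h2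
  rw [← h2]
  abel

/-- The image of a critical edge contains a neighbourhood of each point in its line. -/
theorem exists_segment : ∃ ε > 0, ∀ s : ℝ, |s| < ε → A.F q + s • rot n ∈ A.F '' A.orbit q := by
  set k : ℝ → ℝ := fun t => inner ℝ (rot n) (A.F (A.act (t • rot n) q)) with hk
  have hk0 : k 0 = inner ℝ (rot n) (A.F q) := by simp [hk, A.act_zero h.mem]
  have h1 : 0 < k 1 - k 0 := sub_pos.2 (h.strictMono one_pos)
  have h2 : 0 < k 0 - k (-1) := sub_pos.2 (h.strictMono (by norm_num))
  refine ⟨min (k 1 - k 0) (k 0 - k (-1)), lt_min h1 h2, fun s hs => ?_⟩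
  rw [lt_min_iff, abs_lt, abs_lt] at hs
  obtain ⟨t, -, ht⟩ := intermediate_value_Icc (by norm_num : (-1 : ℝ) ≤ 1)
    h.continuous_height.continuousOn (show k 0 + s ∈ Icc (k (-1)) (k 1) from
      ⟨by linarith [hs.2.1], by linarith [hs.1.2]⟩)
  refine ⟨_, ⟨t • rot n, rfl⟩, ?_⟩
  have h3 := h.F_act_eq t
  simp only at h3 ht
  rw [h3, ht, ← hk0, add_sub_cancel_left]

/-- Every critical edge has an end point. -/
theorem exists_endpoint : ∃ p ∈ A.dom, A.Fixed p ∧ p ∈ closure (A.orbit q) ∧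
    ∃ b : ℝ, 0 < b ∧ A.F p = A.F q + b • rot n ∧
      (∀ s : ℝ, 0 ≤ s → s < b → A.F q + s • rot n ∈ A.F '' A.orbit q) ∧
      (∀ y ∈ A.orbit q, (inner ℝ (rot n) (A.F y) : ℝ) < inner ℝ (rot n) (A.F p)) ∧
      Tendsto (fun t : ℝ => A.F (A.act (t • rot n) q)) atTop (𝓝 (A.F p)) := by
  set k : ℝ → ℝ := fun t => inner ℝ (rot n) (A.F (A.act (t • rot n) q)) with hk
  have hk0 : k 0 = inner ℝ (rot n) (A.F q) := by simp [hk, A.act_zero h.mem]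
  have hmono : StrictMono k := h.strictMono
  have hbdd : BddAbove (range k) := by
    have : IsCompact (range fun y : M => (inner ℝ (rot n) (A.F y) : ℝ)) :=
      isCompact_range (by have := A.continuous_F; fun_prop)
    refine this.bddAbove.mono ?_
    rintro _ ⟨t, rfl⟩
    exact ⟨_, rfl⟩
  have hlim : Tendsto k atTop (𝓝 (⨆ t, k t)) := tendsto_atTop_ciSup hmono.monotone hbdd
  have hlt : ∀ t, k t < ⨆ t, k t := fun t =>
    (hmono (lt_add_one t)).trans_le (le_ciSup hbdd (t + 1))
  obtain ⟨p, hp⟩ : ∃ p, MapClusterPt p atTop (fun t : ℝ => A.act (t • rot n) q) := by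
    obtain ⟨p, -, hp⟩ := isCompact_univ (X := M) (f := map (fun t : ℝ => A.act (t • rot n) q) atTop)
      (by simp)
    exact ⟨p, hp⟩
  have hpcl : p ∈ closure (A.orbit q) :=
    (hp.mem_closure_of_mem (s := A.orbit q) (mem_map.2 (univ_mem' fun t => ⟨_, rfl⟩)))
  have hpd : p ∈ A.dom := closure_orbit_subset_dom h.mem hpcl
  obtain ⟨g, hg, hgp⟩ := mapClusterPt_iff_ultrafilter.1 hp
  -- The height has already reached its supremum at p, and moving p along the edge direction keeps
  -- that value. By strict monotonicity p does not move.
  have hval : ∀ s : ℝ, (inner ℝ (rot n) (A.F (A.act (s • rot n) p)) : ℝ) = ⨆ t, k t := fun s => by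
    have h1 : Tendsto (fun t : ℝ => (inner ℝ (rot n) (A.F (A.act (s • rot n)
        (A.act (t • rot n) q))) : ℝ)) g (𝓝 (inner ℝ (rot n) (A.F (A.act (s • rot n) p)))) := by
      have hc : Continuous fun y => (inner ℝ (rot n) (A.F (A.act (s • rot n) y)) : ℝ) := by
        have := A.continuous_F.comp (continuous_act_right (A := A) (s • rot n))
        simp only [comp_def] at this
        fun_prop
      exact (hc.tendsto p).comp hgp
    have h2 : Tendsto (fun t : ℝ => k (s + t)) g (𝓝 (⨆ t, k t)) :=
      (hlim.comp (tendsto_atTop_add_const_left atTop s tendsto_id)).mono_left hg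
    refine tendsto_nhds_unique h1 (h2.congr fun t => ?_)
    simp only [hk]
    rw [← A.act_add h.mem, add_smul]
  have hp0 : (inner ℝ (rot n) (A.F p) : ℝ) = ⨆ t, k t := by
    simpa [A.act_zero hpd] using hval 0
  have hrot : A.act (rot n) p = p := by
    by_contra hne
    have h1 := A.mono hpd _ hne
    rw [inner_sub_right, hp0, ← one_smul ℝ (rot n), one_smul ℝ (rot n)] at h1
    have h2 := hval 1
    rw [one_smul] at h2
    linarith
  have hn : A.act n p = p := by
    have hcl : IsClosed {y | A.act n y = y} := isClosed_eq (continuous_act_right n) continuous_id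
    refine (closure_minimal ?_ hcl) hpcl
    rintro _ ⟨τ, rfl⟩
    exact (act_act_eq_iff h.mem _ _).2 ((h.stab n).2 (inner_rot_self' n))
  have hfix : A.Fixed p := fun u => by
    rw [plane_decomp h.norm u, A.act_add hpd, A.act_smul hpd _ hrot, A.act_smul hpd _ hn]
  have hnF : (inner ℝ n (A.F p) : ℝ) = inner ℝ n (A.F q) := by
    have hcl : IsClosed {y | (inner ℝ n (A.F y) : ℝ) = inner ℝ n (A.F q)} :=
      isClosed_eq (by have := A.continuous_F; fun_prop) continuous_const
    exact closure_minimal (fun y hy => h.inner_F_of_mem hy) hcl hpcl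
  have hFp : A.F p = A.F q + ((⨆ t, k t) - k 0) • rot n := by
    have h1 : inner ℝ n (A.F p - A.F q) = (0 : ℝ) := by rw [inner_sub_right, hnF, sub_self]
    have h2 := eq_smul_rot_of_inner_eq_zero h.norm h1
    rw [inner_sub_right, hp0, ← hk0] at h2
    rw [← h2]; abel
  refine ⟨p, hpd, hfix, hpcl, (⨆ t, k t) - k 0, sub_pos.2 (hlt 0), hFp, fun s hs hsb => ?_,
    fun y hy => ?_, ?_⟩
  · obtain ⟨T, hT0, hT⟩ := ((eventually_ge_atTop (0 : ℝ)).and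
      (hlim.eventually (lt_mem_nhds (show k 0 + s < ⨆ t, k t by linarith)))).exists
    obtain ⟨t, -, ht⟩ := intermediate_value_Icc hT0
      h.continuous_height.continuousOn (show k 0 + s ∈ Icc (k 0) (k T) from
        ⟨by linarith, hT.le⟩)
    refine ⟨_, ⟨t • rot n, rfl⟩, ?_⟩
    have h3 := h.F_act_eq t
    simp only at h3 ht
    rw [h3, ht, ← hk0, add_sub_cancel_left]
  · rw [h.orbit_eq] at hy
    obtain ⟨t, rfl⟩ := hy
    rw [hp0]
    exact hlt t
  · have h1 : Tendsto (fun t : ℝ => A.F q + (k t - k 0) • rot n) atTop (𝓝 (A.F p)) := by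
      rw [hFp]
      exact tendsto_const_nhds.add ((hlim.sub_const _).smul_const _)
    refine h1.congr fun t => ?_
    rw [h.F_act_eq t, hk0]

end EdgeAt

end PlaneAction

/-! ### Frames and outward normals of leaves. -/

namespace PlaneAction

variable {M : Type*} [TopologicalSpace M] [T2Space M] [CompactSpace M] (A : PlaneAction M)

/-- The critical edges in the closure of a leaf. -/
def frame (L : Set M) : Set (Set M) := {c | A.IsEdge c ∧ c ⊆ closure L}

/-- `n` is the outward unit normal of the image of the leaf `L` at the edge `c`. -/
structure IsNormal (L c : Set M) (n : Plane) : Prop where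
  norm : ‖n‖ = 1
  stab : ∀ q ∈ c, A.act n q = q
  lt : ∀ x ∈ L, ∀ q ∈ c, (inner ℝ n (A.F x) : ℝ) < inner ℝ n (A.F q)

variable {A} {L c c' : Set M} {n m : Plane} {q x : M}

theorem EdgeAt.of_stab (h : A.EdgeAt q m) (hn : ‖n‖ = 1) (hs : A.act n q = q) : A.EdgeAt q n := by
  rcases eq_or_eq_neg_of_inner_rot_eq_zero h.norm hn ((h.stab n).1 hs) with rfl | rfl
  · exact h
  · exact h.neg

namespace IsEdge

variable (hc : A.IsEdge c)

include hc

theorem nonempty : c.Nonempty := by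
  obtain ⟨q, hq, -, -, rfl⟩ := hc
  exact ⟨q, mem_orbit_self hq⟩

theorem eq_orbit (hq : q ∈ c) : c = A.orbit q := by
  obtain ⟨q', hq', -, -, rfl⟩ := hc
  exact (orbit_eq_of_mem hq' hq).symm

theorem exists_edgeAt : ∃ n, ∀ q ∈ c, A.EdgeAt q n := by
  obtain ⟨q', hq', hf, hx, rfl⟩ := hc
  obtain ⟨n, hn⟩ := PlaneAction.exists_edgeAt hq' hf hx
  exact ⟨n, fun q hq => hn.of_mem_orbit hq⟩

theorem eq_of_mem_of_mem (hc' : A.IsEdge c') (hq : q ∈ c) (hq' : q ∈ c') : c = c' := by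
  rw [hc.eq_orbit hq, hc'.eq_orbit hq']

/-- An edge projects onto the open segment between the images of its two ends, so it contains a
point over their midpoint. In a closure where F is injective this recovers the edge from a pair of
fixed points, which makes frames finite. -/
theorem exists_fixed_pair : ∃ p p' : M, (p ∈ A.dom ∧ A.Fixed p) ∧ (p' ∈ A.dom ∧ A.Fixed p') ∧
    midpoint ℝ (A.F p) (A.F p') ∈ A.F '' c := by
  obtain ⟨n, hn⟩ := hc.exists_edgeAt
  obtain ⟨q, hq⟩ := hc.nonempty
  obtain ⟨p, hp, hpf, -, b, hb, hpF, hseg, -⟩ := (hn q hq).exists_endpoint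
  obtain ⟨p', hp', hpf', -, b', hb', hpF', hseg', -⟩ := (hn q hq).neg.exists_endpoint
  refine ⟨p, p', ⟨hp, hpf⟩, ⟨hp', hpf'⟩, ?_⟩
  rw [hc.eq_orbit hq]
  rw [rot_neg] at hpF' hseg'
  have hmid : midpoint ℝ (A.F p) (A.F p') = A.F q + ((b - b') / 2) • rot n := by
    rw [midpoint_eq_smul_add, hpF, hpF']
    simp only [invOf_eq_inv]
    module
  rcases le_total b' b with h | h
  · rw [hmid]
    exact hseg _ (by linarith) (by linarith)
  · have := hseg' ((b' - b) / 2) (by linarith) (by linarith)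
    rw [hmid]
    convert this using 2
    module

end IsEdge

namespace IsLeaf

variable (hL : A.IsLeaf L)

include hL

theorem subset_dom : L ⊆ A.dom := by
  obtain ⟨x, hx, -, rfl⟩ := hL
  exact orbit_subset_dom hx

theorem closure_subset_dom : closure L ⊆ A.dom :=
  closure_minimal hL.subset_dom A.isClosed_dom

theorem nonempty : L.Nonempty := by
  obtain ⟨x, hx, -, rfl⟩ := hL
  exact ⟨x, mem_orbit_self hx⟩

theorem eq_orbit (hx : x ∈ L) : L = A.orbit x := by
  obtain ⟨y, hy, -, rfl⟩ := hL
  exact (orbit_eq_of_mem hy hx).symm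

theorem free (hx : x ∈ L) : A.Free x := by
  obtain ⟨y, hy, hf, rfl⟩ := hL
  obtain ⟨τ, rfl⟩ := hx
  exact (free_act_iff hy τ).2 hf

theorem act_mem (hx : x ∈ L) (τ : Plane) : A.act τ x ∈ L := by
  rw [hL.eq_orbit hx]
  exact act_mem_orbit τ

theorem orbit_subset_closure (hq : q ∈ closure L) : A.orbit q ⊆ closure L := by
  obtain ⟨y, hy, -, rfl⟩ := hL
  exact orbit_subset_closure_orbit hy hq

theorem isOpen_image : IsOpen (A.F '' L) := by
  obtain ⟨x, hx, hf, rfl⟩ := hL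
  exact isOpen_image_orbit hx hf

theorem convex_image : Convex ℝ (A.F '' L) := by
  obtain ⟨x, hx, hf, rfl⟩ := hL
  exact convex_image_orbit hx hf

theorem image_closure : A.F '' closure L = closure (A.F '' L) := by
  obtain ⟨x, hx, hf, rfl⟩ := hL
  exact image_closure_orbit x

theorem interior_closure : interior (closure (A.F '' L)) = A.F '' L := by
  rw [hL.convex_image.interior_closure_eq_interior_of_nonempty_interior,
    hL.isOpen_image.interior_eq]
  rw [hL.isOpen_image.interior_eq]
  exact hL.nonempty.image _

theorem injOn_closure : InjOn A.F (closure L) := by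
  obtain ⟨x, hx, hf, rfl⟩ := hL
  exact injOn_F_closure_orbit hx hf

theorem mem_of_free (hq : q ∈ closure L) (h : A.Free q) : q ∈ L := by
  obtain ⟨x, hx, hf, rfl⟩ := hL
  exact mem_orbit_of_free hx hf hq h

theorem F_notMem (hq : q ∈ closure L) (h : ¬ A.Free q) : A.F q ∉ A.F '' L := by
  obtain ⟨x, hx, hf, rfl⟩ := hL
  exact F_notMem_of_not_free hx hf hq h

theorem isPreconnected_inter (z : Plane) (ε : ℝ) :
    IsPreconnected (L ∩ A.F ⁻¹' Metric.ball z ε) := by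
  obtain ⟨x, hx, hf, rfl⟩ := hL
  exact isPreconnected_orbit_inter hx hf z ε

theorem eq_of_mem_of_mem {L' : Set M} (hL' : A.IsLeaf L') (hq : q ∈ L) (hq' : q ∈ L') :
    L = L' := by
  rw [hL.eq_orbit hq, hL'.eq_orbit hq']

theorem orbit_mem_frame (hq : A.EdgeAt q n) (hqL : q ∈ closure L) : A.orbit q ∈ A.frame L :=
  ⟨hq.isEdge, hL.orbit_subset_closure hqL⟩

/-- A point of the closure over the boundary of the image is fixed or lies on the frame. -/
theorem exists_of_mem_closure_of_notMem {z : Plane} (hz : z ∈ closure (A.F '' L))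
    (hz' : z ∉ A.F '' L) : ∃ q ∈ closure L, A.F q = z ∧
      (A.Fixed q ∨ ∃ n, A.EdgeAt q n ∧ A.orbit q ∈ A.frame L) := by
  rw [← hL.image_closure] at hz
  obtain ⟨q, hq, rfl⟩ := hz
  refine ⟨q, hq, rfl, ?_⟩
  by_cases hc : A.Fixed q
  · exact .inl hc
  · have hf : ¬ A.Free q := fun hf => hz' ⟨q, hL.mem_of_free hq hf, rfl⟩
    obtain ⟨n, hn⟩ := exists_edgeAt (hL.closure_subset_dom hq) hf hc
    exact .inr ⟨n, hn, hL.orbit_mem_frame hn hq⟩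

/-- A line that supports the image of a leaf at a point of an edge is the line of the edge. -/
theorem eq_smul_of_support (hq : A.EdgeAt q m) (hqL : q ∈ closure L)
    (h : ∀ x ∈ L, (inner ℝ n (A.F x) : ℝ) ≤ inner ℝ n (A.F q)) :
    n = (inner ℝ m n : ℝ) • m := by
  have hcl : ∀ z ∈ closure (A.F '' L), (inner ℝ n z : ℝ) ≤ inner ℝ n (A.F q) := fun z hz =>
    closure_minimal (t := {z | (inner ℝ n z : ℝ) ≤ inner ℝ n (A.F q)})
      (by rintro _ ⟨x, hx, rfl⟩; exact h x hx) (isClosed_le (by fun_prop) continuous_const) hz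
  obtain ⟨ε, hε, hseg⟩ := hq.exists_segment
  have h1 : ∀ s : ℝ, |s| < ε → s * (inner ℝ n (rot m) : ℝ) ≤ 0 := fun s hs => by
    have h2 := hcl _ (hL.image_closure ▸ image_mono (hL.orbit_subset_closure hqL) (hseg s hs))
    rw [inner_add_right, real_inner_smul_right] at h2
    linarith
  have h2 := h1 (ε / 2) (by rw [abs_of_pos (half_pos hε)]; linarith)
  have h3 := h1 (-(ε / 2)) (by rw [abs_neg, abs_of_pos (half_pos hε)]; linarith)
  refine eq_smul_of_inner_rot_eq_zero hq.norm ?_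
  rw [real_inner_comm]
  nlinarith

/-- A point of the edge projects outside the open convex image, so a line separates it. As that line
supports the image at an inner point of a segment, it is the line of the segment. -/
theorem exists_isNormal (hc : c ∈ A.frame L) : ∃ n, A.IsNormal L c n := by
  obtain ⟨m, hm⟩ := hc.1.exists_edgeAt
  obtain ⟨q, hq⟩ := hc.1.nonempty
  have hqe := hm q hq
  obtain ⟨u, hu0, hu⟩ := exists_inner_lt_of_notMem hL.convex_image hL.isOpen_image
    (hL.F_notMem (hc.2 hq) hqe.not_free) (hL.nonempty.image _)
  have hum := hL.eq_smul_of_support hqe (hc.2 hq) fun x hx => (hu _ ⟨x, hx, rfl⟩).le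
  have hun : 0 < ‖u‖ := norm_pos_iff.2 hu0
  refine ⟨‖u‖⁻¹ • u, ?_, fun q' hq' => ?_, fun x hx q' hq' => ?_⟩
  · rw [norm_smul, norm_inv, norm_norm, inv_mul_cancel₀ hun.ne']
  · rw [(hm q' hq').stab, hum, smul_smul, real_inner_smul_right, inner_rot_self', mul_zero]
  · have h1 : (inner ℝ u (A.F q') : ℝ) = inner ℝ u (A.F q) := by
      rw [hc.1.eq_orbit hq] at hq'
      rw [hum, real_inner_smul_left, real_inner_smul_left, hqe.inner_F_of_mem hq']
    rw [real_inner_smul_left, real_inner_smul_left, h1]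
    exact mul_lt_mul_of_pos_left (hu _ ⟨x, hx, rfl⟩) (inv_pos.2 hun)

end IsLeaf

namespace IsNormal

variable (h : A.IsNormal L c n)

include h

theorem edgeAt (hc : A.IsEdge c) (hq : q ∈ c) : A.EdgeAt q n := by
  obtain ⟨m, hm⟩ := hc.exists_edgeAt
  exact (hm q hq).of_stab h.norm (h.stab q hq)

theorem ne_zero : n ≠ 0 := by
  rintro rfl
  simpa using h.norm

theorem ne_neg : n ≠ -n := fun heq => h.ne_zero <| by
  have h1 : (2 : ℝ) • n = 0 := by
    rw [two_smul]
    nth_rewrite 2 [heq]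
    exact add_neg_cancel n
  exact (smul_eq_zero.1 h1).resolve_left two_ne_zero

theorem eq (hL : A.IsLeaf L) (hc : A.IsEdge c) (h' : A.IsNormal L c m) : m = n := by
  obtain ⟨q, hq⟩ := hc.nonempty
  obtain ⟨x, hx⟩ := hL.nonempty
  rcases (h.edgeAt hc hq).eq_or_eq_neg (h'.edgeAt hc hq) with rfl | rfl
  · rfl
  · have h1 := h.lt x hx q hq
    have h2 := h'.lt x hx q hq
    rw [inner_neg_left, inner_neg_left] at h2
    linarith

theorem lt_of_mem {z : Plane} (hz : z ∈ A.F '' L) (hq : q ∈ c) :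
    (inner ℝ n z : ℝ) < inner ℝ n (A.F q) := by
  obtain ⟨x, hx, rfl⟩ := hz
  exact h.lt x hx q hq

theorem le_of_mem_closure {z : Plane} (hz : z ∈ closure (A.F '' L)) (hq : q ∈ c) :
    (inner ℝ n z : ℝ) ≤ inner ℝ n (A.F q) :=
  closure_minimal (t := {z | (inner ℝ n z : ℝ) ≤ inner ℝ n (A.F q)})
    (fun _ hz => (h.lt_of_mem hz hq).le) (isClosed_le (by fun_prop) continuous_const) hz

/-- Near a point of a side, the image of the leaf is the open half-plane behind the side. -/
theorem eventually_mem (hL : A.IsLeaf L) (hc : c ∈ A.frame L) (hq : q ∈ c) :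
    ∀ᶠ z in 𝓝 (A.F q), (inner ℝ n z : ℝ) < inner ℝ n (A.F q) → z ∈ A.F '' L := by
  obtain ⟨x, hx⟩ := hL.nonempty
  obtain ⟨ε, hε, hseg⟩ := (h.edgeAt hc.1 hq).exists_segment
  set o := A.F x
  have hA : 0 < (inner ℝ n (A.F q - o) : ℝ) := by
    rw [inner_sub_right, sub_pos]; exact h.lt x hx q hq
  set a : ℝ := inner ℝ n (A.F q - o) with ha
  -- The parameters write z as a combination, with weight `lam z`, of the interior point o and the
  -- point at offset `mu z` on the line of the edge. Near F q the second point lies in the edge, and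
  -- behind the line `lam z` is positive, so z is interior.
  set lam : Plane → ℝ := fun z => inner ℝ n (A.F q - z) / a with hlam
  set mu : Plane → ℝ := fun z => (inner ℝ (rot n) (z - A.F q) - lam z * inner ℝ (rot n) (o - A.F q)) /
    (1 - lam z) with hmu
  have hlamc : Continuous lam := by simp only [hlam]; fun_prop
  have hlam0 : lam (A.F q) = 0 := by simp [hlam]
  have hmuc : ContinuousAt mu (A.F q) := by
    have h1 := hlamc.continuousAt (x := A.F q)
    simp only [hmu]
    exact ContinuousAt.div (by fun_prop) (by fun_prop) (by rw [hlam0]; norm_num)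
  have hmu0 : mu (A.F q) = 0 := by simp [hmu, hlam0]
  have e1 : ∀ᶠ z in 𝓝 (A.F q), lam z < 1 :=
    hlamc.continuousAt.eventually (gt_mem_nhds (by rw [hlam0]; exact one_pos))
  have e2 : ∀ᶠ z in 𝓝 (A.F q), |mu z| < ε :=
    (hmuc.abs).eventually (gt_mem_nhds (by simp only [hmu0, abs_zero]; exact hε))
  filter_upwards [e1, e2] with z h1 h2 hlt
  have hl0 : 0 < lam z := div_pos (by rw [inner_sub_right]; linarith) hA
  have hb : A.F q + mu z • rot n ∈ closure (A.F '' L) := by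
    rw [← hL.image_closure]
    exact image_mono (hc.2) (hc.1.eq_orbit hq ▸ hseg _ h2)
  have ho : o ∈ interior (closure (A.F '' L)) := by
    rw [hL.interior_closure]; exact ⟨x, hx, rfl⟩
  rw [← hL.interior_closure]
  have h3 := hL.convex_image.closure.combo_closure_interior_mem_interior
    (subset_closure hb) ho (by linarith : 0 ≤ 1 - lam z) hl0 (by ring)
  have h4 : (1 - lam z) • (A.F q + mu z • rot n) + lam z • o = z := by
    have hm : (1 - lam z) * mu z = inner ℝ (rot n) (z - A.F q)
        - lam z * inner ℝ (rot n) (o - A.F q) := by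
      simp only [hmu]
      rw [mul_div_cancel₀]
      linarith
    have hla : lam z * a = inner ℝ n (A.F q - z) := div_mul_cancel₀ _ hA.ne'
    have d1 := plane_decomp h.norm (z - A.F q)
    have d2 := plane_decomp h.norm (o - A.F q)
    have h5 : (1 - lam z) • (A.F q + mu z • rot n) + lam z • o =
        A.F q + lam z • (o - A.F q) + ((1 - lam z) * mu z) • rot n := by module
    rw [h5, hm]
    have h7 : (inner ℝ n (z - A.F q) : ℝ) = lam z * inner ℝ n (o - A.F q) := by
      rw [← neg_sub (A.F q) o, ← neg_sub (A.F q) z, inner_neg_right, inner_neg_right, ← hla, ha]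
      ring
    generalize (inner ℝ (rot n) (z - A.F q) : ℝ) = s at *
    generalize (inner ℝ (rot n) (o - A.F q) : ℝ) = t at *
    rw [h7] at d1
    generalize (inner ℝ n (o - A.F q) : ℝ) = r at *
    have h6 : lam z • (o - A.F q) + (s - lam z * t) • rot n = z - A.F q := by
      rw [d1, d2]
      module
    rw [add_assoc, h6, add_sub_cancel]
  rwa [h4] at h3

end IsNormal

/-- Edges inject into pairs of fixed points through the midpoints of their images. -/
theorem IsLeaf.finite_frame (hL : A.IsLeaf L) : (A.frame L).Finite := by
  obtain ⟨x₀, -⟩ := hL.nonempty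
  have : Nonempty M := ⟨x₀⟩
  choose! p p' hp hp' hmid using fun c (hc : c ∈ A.frame L) => hc.1.exists_fixed_pair
  refine Set.Finite.of_injOn (f := fun c => (p c, p' c))
    (t := {p | p ∈ A.dom ∧ A.Fixed p} ×ˢ {p | p ∈ A.dom ∧ A.Fixed p})
    (fun c hc => ⟨hp c hc, hp' c hc⟩) ?_ (finite_fixed.prod finite_fixed)
  intro c hc c' hc' heq
  simp only [Prod.mk.injEq] at heq
  obtain ⟨q, hq, hqF⟩ := hmid c hc
  obtain ⟨q', hq', hqF'⟩ := hmid c' hc'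
  rw [heq.1, heq.2, ← hqF'] at hqF
  have := hL.injOn_closure (hc.2 hq) (hc'.2 hq') hqF
  exact hc.1.eq_of_mem_of_mem hc'.1 hq (this ▸ hq')

/-- Rays in a given direction that start near a given point of the image of a leaf leave it through
an edge. -/
theorem IsLeaf.exists_ray_edge (hL : A.IsLeaf L) {o u : Plane} (ho : o ∈ A.F '' L) (hu : u ≠ 0)
    {W : Set Plane} (hW : W ∈ 𝓝 o) : ∃ o' ∈ A.F '' L, o' ∈ W ∧ ∃ T : ℝ, 0 ≤ T ∧
      ∃ q ∈ closure L, A.F q = o' + T • u ∧ ∃ m, A.EdgeAt q m ∧ A.orbit q ∈ A.frame L := by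
  -- Only finitely many lines parallel to u contain the image of a fixed point. A small shift of the
  -- origin orthogonally to u avoids them, so the exit point of the ray lies on an edge.
  have hfin : ((fun p => (inner ℝ (rot u) (A.F p) : ℝ)) '' {p | p ∈ A.dom ∧ A.Fixed p}).Finite :=
    finite_fixed.image _
  have hev : ∀ᶠ s : ℝ in 𝓝[≠] 0, o + s • rot u ∈ A.F '' L ∩ W := by
    refine eventually_nhdsWithin_of_eventually_nhds ?_
    have hc : ContinuousAt (fun s : ℝ => o + s • rot u) 0 := by fun_prop
    exact hc.eventually (show A.F '' L ∩ W ∈ 𝓝 (o + (0 : ℝ) • rot u) by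
      rw [zero_smul, add_zero]; exact inter_mem (hL.isOpen_image.mem_nhds ho) hW)
  have huu : (inner ℝ (rot u) (rot u) : ℝ) ≠ 0 := by
    rw [inner_rot_rot]
    exact (real_inner_self_pos.2 hu).ne'
  have hinj : Injective fun s : ℝ => (inner ℝ (rot u) (o + s • rot u) : ℝ) := fun s t h => by
    simp only [inner_add_right, real_inner_smul_right] at h
    exact mul_right_cancel₀ huu (add_left_cancel h)
  have hev2 : ∀ᶠ s : ℝ in 𝓝[≠] 0, (inner ℝ (rot u) (o + s • rot u) : ℝ) ∉
      (fun p => (inner ℝ (rot u) (A.F p) : ℝ)) '' {p | p ∈ A.dom ∧ A.Fixed p} := by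
    have := (hfin.preimage hinj.injOn)
    filter_upwards [(this.subset (sdiff_subset (t := {0}))).isClosed.isOpen_compl.mem_nhds
      (show (0 : ℝ) ∈ _ by simp) |> mem_nhdsWithin_of_mem_nhds, self_mem_nhdsWithin] with s h1 h2 h3
    exact h1 ⟨h3, h2⟩
  obtain ⟨s, ⟨hs, hsW⟩, hs2⟩ := (hev.and hev2).exists
  set o' := o + s • rot u with ho'
  clear_value o'
  have hray : IsPreconnected ((fun t : ℝ => o' + t • u) '' Ici 0) :=
    (isPreconnected_Ici).image _ (by fun_prop)
  have hbdd : ∃ t : ℝ, 0 ≤ t ∧ o' + t • u ∉ A.F '' L := by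
    have hcomp : IsCompact (closure (A.F '' L)) := by
      rw [← hL.image_closure]
      exact isClosed_closure.isCompact.image A.continuous_F
    obtain ⟨R, hR⟩ := hcomp.isBounded.subset_closedBall o'
    have hun : 0 < ‖u‖ := norm_pos_iff.2 hu
    refine ⟨(|R| + 1) / ‖u‖, by positivity, fun hmem => ?_⟩
    have := hR (subset_closure hmem)
    rw [mem_closedBall_iff_norm, add_sub_cancel_left, norm_smul, Real.norm_of_nonneg
      (by positivity), div_mul_cancel₀ _ hun.ne'] at this
    linarith [le_abs_self R]
  obtain ⟨t, ht, hnot⟩ := hbdd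
  obtain ⟨_, ⟨T, hT, rfl⟩, hfr⟩ : ((fun t : ℝ => o' + t • u) '' Ici 0 ∩
      (closure (A.F '' L) \ A.F '' L)).Nonempty := by
    by_contra hne
    obtain ⟨z, hz, hzP, hzc⟩ := hray (A.F '' L) (closure (A.F '' L))ᶜ hL.isOpen_image
      isClosed_closure.isOpen_compl (fun z hz => by
        by_cases h1 : z ∈ A.F '' L
        · exact .inl h1
        · exact .inr fun h2 => hne ⟨z, hz, h2, h1⟩)
      ⟨o', ⟨0, by simp, by simp⟩, hs⟩ ⟨_, ⟨t, ht, rfl⟩, fun h2 => hne ⟨_, ⟨t, ht, rfl⟩, h2, hnot⟩⟩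
    exact hzc (subset_closure hzP)
  obtain ⟨q, hq, hqF, hq'⟩ := hL.exists_of_mem_closure_of_notMem hfr.1 hfr.2
  rcases hq' with hfix | ⟨m, hm, hmem⟩
  · refine absurd ⟨q, ⟨hL.closure_subset_dom hq, hfix⟩, ?_⟩ hs2
    simp only [hqF]
    rw [inner_add_right, real_inner_smul_right, inner_rot_self', mul_zero, add_zero]
  · exact ⟨o', hs, hsW, T, hT, q, hq, hqF, m, hm, hmem⟩

/-- Every open half-plane contains an outward normal. -/
theorem IsLeaf.exists_inner_pos (hL : A.IsLeaf L) {u : Plane} (hu : u ≠ 0) :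
    ∃ c ∈ A.frame L, ∃ n, A.IsNormal L c n ∧ 0 < (inner ℝ u n : ℝ) := by
  obtain ⟨o, ho⟩ := hL.nonempty.image A.F
  obtain ⟨o', ho', -, T, hT, q, hq, hqF, m, hm, hmem⟩ := hL.exists_ray_edge ho hu univ_mem
  obtain ⟨n, hn⟩ := hL.exists_isNormal hmem
  refine ⟨_, hmem, n, hn, ?_⟩
  have h1 := hn.lt_of_mem ho' (mem_orbit_self hm.mem)
  rw [hqF, inner_add_right, real_inner_smul_right] at h1
  rw [real_inner_comm]
  exact (pos_iff_pos_of_mul_pos (by linarith)).1 (lt_of_le_of_ne hT (by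
    rintro rfl; simp at h1))

/-- The image of a leaf is determined by the images of its edges. -/
theorem IsLeaf.closure_image_eq (hL : A.IsLeaf L) :
    closure (A.F '' L) = closure (convexHull ℝ (A.F '' ⋃₀ A.frame L)) := by
  refine subset_antisymm (closure_minimal (fun z hz => ?_) isClosed_closure)
    (closure_minimal (convexHull_min ?_ hL.convex_image.closure) isClosed_closure)
  · by_contra hnot
    -- A point of the image that is separated from the hull could be followed along a ray on which
    -- the separating functional does not decrease. A nearby ray of this kind ends on an edge, which
    -- belongs to the hull.
    obtain ⟨g, s, hgs, hsz⟩ := geometric_hahn_banach_closed_point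
      (convex_convexHull ℝ (A.F '' ⋃₀ A.frame L)).closure isClosed_closure hnot
    set u := (InnerProductSpace.toDual ℝ Plane).symm g with hu
    have hgu : ∀ w, g w = inner ℝ u w := fun w => by
      rw [hu, InnerProductSpace.toDual_symm_apply]
    have hu0 : u ≠ 0 := by
      intro h0
      obtain ⟨q, hq⟩ : (⋃₀ A.frame L).Nonempty := by
        obtain ⟨c, hc, -⟩ := hL.exists_inner_pos (u := !₂[1, 0]) (by
          intro h; simpa using congrArg (fun v : Plane => v 0) h)
        obtain ⟨q, hq⟩ := hc.1.nonempty
        exact ⟨q, c, hc, hq⟩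
      have h1 := hgs _ (subset_closure (subset_convexHull ℝ _ ⟨q, hq, rfl⟩))
      rw [hgu, h0, inner_zero_left] at h1 hsz
      linarith
    obtain ⟨o', -, ho', T, hT, q, -, hqF, m, hm, hmem⟩ := hL.exists_ray_edge hz hu0
      ((isOpen_lt continuous_const g.continuous).mem_nhds hsz)
    have h1 := hgs (A.F q) (subset_closure (subset_convexHull ℝ _
      ⟨q, ⟨_, hmem, mem_orbit_self hm.mem⟩, rfl⟩))
    have h2 : s < g o' := ho'
    rw [hqF, map_add, map_smul, smul_eq_mul, hgu u] at h1
    have := mul_nonneg hT (real_inner_self_nonneg (x := u))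
    linarith
  · rintro _ ⟨q, ⟨c, hc, hq⟩, rfl⟩
    rw [← hL.image_closure]
    exact ⟨q, hc.2 hq, rfl⟩

end PlaneAction

theorem IsPreconnected.eq_of_eventually_eq {X Y : Type*} [TopologicalSpace X] {T : Set X}
    (hT : IsPreconnected T) {h : X → Y} (hl : ∀ τ ∈ T, ∀ᶠ σ in 𝓝 τ, h σ = h τ) {σ τ : X}
    (hσ : σ ∈ T) (hτ : τ ∈ T) : h σ = h τ := by
  by_contra hne
  obtain ⟨ρ, -, h1, h2⟩ := hT {ρ | ∀ᶠ ρ' in 𝓝 ρ, h ρ' = h τ} {ρ | ∀ᶠ ρ' in 𝓝 ρ, h ρ' ≠ h τ}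
    isOpen_setOfPred_eventually_nhds isOpen_setOfPred_eventually_nhds (fun ρ hρ => by
      by_cases he : h ρ = h τ
      · exact .inl ((hl ρ hρ).mono fun _ h' => h'.trans he)
      · exact .inr ((hl ρ hρ).mono fun _ h' => h'.symm ▸ he))
    ⟨τ, hτ, hl τ hτ⟩ ⟨σ, hσ, (hl σ hσ).mono fun _ h' => h'.symm ▸ hne⟩
  exact h2.self_of_nhds h1.self_of_nhds

/-! ### Diagonal charts at an end point, and uniqueness of the edge on a side. -/

namespace PlaneAction

variable {M : Type*} [TopologicalSpace M] [T2Space M] [CompactSpace M] {A : PlaneAction M}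
  {L c c' : Set M} {n m : Plane} {p q q' x : M}

/-- `y` are coordinates on `U` in which the action is diagonal with weights `wt`. -/
def IsDiagonal (A : PlaneAction M) {d : ℕ} (U : Set M) (y : M → Fin d → ℝ)
    (wt : Fin d → Plane) : Prop :=
  ∀ x ∈ A.dom, ∀ u, (∀ r ∈ Icc (0 : ℝ) 1, A.act (r • u) x ∈ U) →
    ∀ i, y (A.act u x) i = Real.exp (inner ℝ (wt i) u) * y x i

/-- In a diagonal chart, the coordinates along a leaf over a convex open set are given by the
exponentials of the weights. -/
theorem IsLeaf.exists_chart_eq (hL : A.IsLeaf L) {d : ℕ} {U : Set M} {y : M → Fin d → ℝ}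
    {wt : Fin d → Plane} (hy : A.IsDiagonal U y wt) {B : Set Plane} (hB : Convex ℝ B)
    (hBo : IsOpen B) (hN : L ∩ A.F ⁻¹' B ⊆ U) {x x' : M} (hx : x ∈ L) (hxB : A.F x ∈ B)
    (hx' : x' ∈ L) (hxB' : A.F x' ∈ B) :
    ∃ σ, x' = A.act σ x ∧ ∀ i, y x' i = Real.exp (inner ℝ (wt i) σ) * y x i := by
  have hxd := hL.subset_dom hx
  have hemb := isOpenEmbedding_F_act hxd (hL.free hx)
  obtain ⟨σ, rfl⟩ : x' ∈ A.orbit x := hL.eq_orbit hx ▸ hx'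
  refine ⟨σ, rfl, fun i => ?_⟩
  set T : Set Plane := (fun τ => A.F (A.act τ x)) ⁻¹' B with hTdef
  have hTo : IsOpen T := hBo.preimage hemb.continuous
  have hT : IsPreconnected T := by
    rw [← hemb.isInducing.isPreconnected_image, image_preimage_eq_inter_range, ← image_orbit,
      ← hL.eq_orbit hx]
    exact (hB.inter hL.convex_image).isPreconnected
  have hTU : ∀ τ ∈ T, A.act τ x ∈ U := fun τ hτ => hN ⟨hL.act_mem hx τ, hτ⟩
  -- Local diagonality makes the coordinate divided by its expected exponential locally constant on
  -- the times in T, and T is connected because its image is convex.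
  have key := IsPreconnected.eq_of_eventually_eq hT
    (h := fun τ => Real.exp (-inner ℝ (wt i) τ) * y (A.act τ x) i) (fun τ hτ => ?_)
    (σ := σ) (τ := 0) hxB' (by simpa [hTdef, A.act_zero hxd] using hxB)
  · simp only [A.act_zero hxd, inner_zero_right, neg_zero, Real.exp_zero, one_mul] at key
    rw [← key, ← mul_assoc, ← Real.exp_add, add_neg_cancel, Real.exp_zero, one_mul]
  · obtain ⟨r, hr, hball⟩ := Metric.isOpen_iff.1 hTo τ hτ
    filter_upwards [Metric.ball_mem_nhds τ hr] with ρ hρ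
    have h1 := hy _ (A.act_mem hxd τ) (ρ - τ) (fun s hs => by
      rw [← A.act_add hxd]
      refine hTU _ (hball ?_)
      rw [mem_ball_iff_norm] at hρ ⊢
      rw [add_sub_cancel_right, norm_smul, Real.norm_of_nonneg hs.1]
      exact (mul_le_of_le_one_left (norm_nonneg _) hs.2).trans_lt hρ) i
    rw [← A.act_add hxd, sub_add_cancel] at h1
    rw [h1, ← mul_assoc, ← Real.exp_add, inner_sub_right]
    ring_nf

/-- An edge that ends at a fixed point, seen in a diagonal chart: some coordinate with weight along
the edge is contracted, and the expanded coordinates vanish. -/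
theorem EdgeAt.exists_contracted (h : A.EdgeAt q n) {d : ℕ} {U W : Set M} {y : M → Fin d → ℝ}
    {wt : Fin d → Plane} (hU : IsOpen U) (hpU : p ∈ U) (hyc : ContinuousOn y U) (hyi : InjOn y U)
    (hyp : y p = 0) (hy : A.IsDiagonal U y wt) (hW : W ∈ 𝓝 p) (hp : A.Fixed p)
    (ht : Tendsto (fun t : ℝ => A.act (t • rot n) q) atTop (𝓝 p)) :
    ∃ q₁ ∈ A.orbit q, q₁ ∈ W ∧ q₁ ∈ U ∧
      (∃ i, y q₁ i ≠ 0 ∧ ∃ a : ℝ, 0 < a ∧ wt i = -a • rot n) ∧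
      (∀ i, (inner ℝ (wt i) n : ℝ) ≠ 0 → y q₁ i = 0) ∧
      ∀ j, 0 < (inner ℝ (wt j) (rot n) : ℝ) → y q₁ j = 0 := by
  obtain ⟨t₀, ht₀⟩ := eventually_atTop.1 (ht.eventually (inter_mem hW (hU.mem_nhds hpU)))
  set q₁ := A.act (t₀ • rot n) q with hq₁
  have hq₁U : q₁ ∈ U := (ht₀ t₀ le_rfl).2
  have h₁ : A.EdgeAt q₁ n := h.act _
  have hact : ∀ t, A.act (t • rot n) q₁ = A.act ((t + t₀) • rot n) q := fun t => by
    rw [hq₁, ← A.act_add h.mem, add_smul]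
  have hstay : ∀ t : ℝ, 0 ≤ t → A.act (t • rot n) q₁ ∈ U := fun t ht => by
    rw [hact]; exact (ht₀ _ (by linarith)).2
  have hlim : ∀ i, Tendsto (fun t : ℝ => y (A.act (t • rot n) q₁) i) atTop (𝓝 0) := fun i => by
    have h2 : Tendsto (fun t : ℝ => A.act (t • rot n) q₁) atTop (𝓝 p) :=
      (ht.comp (tendsto_atTop_add_const_right _ t₀ tendsto_id)).congr fun t => (hact t).symm
    have h3 : ContinuousAt (fun z => y z i) p :=
      (continuous_apply i).continuousAt.comp (hyc.continuousAt (hU.mem_nhds hpU))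
    have := h3.tendsto.comp h2
    simpa [hyp, comp_def] using this
  have hval : ∀ i (t : ℝ), 0 ≤ t → y (A.act (t • rot n) q₁) i =
      Real.exp (t * inner ℝ (wt i) (rot n)) * y q₁ i := fun i t ht => by
    have := hy q₁ h₁.mem (t • rot n) (fun r hr => by
      rw [smul_smul]
      exact hstay _ (mul_nonneg hr.1 ht)) i
    rwa [real_inner_smul_right] at this
  -- A nonzero coordinate with nonnegative rate could not tend to its value 0 at p.
  have hpos : ∀ j, 0 ≤ (inner ℝ (wt j) (rot n) : ℝ) → y q₁ j = 0 := fun j hj => by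
    by_contra hne
    have h2 : ∀ᶠ t : ℝ in atTop, |y q₁ j| ≤ |y (A.act (t • rot n) q₁) j| := by
      filter_upwards [eventually_ge_atTop 0] with t ht
      rw [hval j t ht, abs_mul, Real.abs_exp]
      exact le_mul_of_one_le_left (abs_nonneg _) (Real.one_le_exp (mul_nonneg ht hj))
    have h3 := ge_of_tendsto ((hlim j).abs) h2
    rw [abs_zero] at h3
    exact hne (abs_nonpos_iff.1 h3)
  -- Since n fixes q₁, such a coordinate equals itself times a factor different from 1.
  have hstab : ∀ i, (inner ℝ (wt i) n : ℝ) ≠ 0 → y q₁ i = 0 := fun i hi => by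
    have hfix : ∀ r : ℝ, A.act (r • n) q₁ = q₁ := fun r => (h₁.stab _).2 (by
      rw [real_inner_smul_right, inner_rot_self', mul_zero])
    have h2 := hy q₁ h₁.mem n (fun r _ => by rw [hfix]; exact hq₁U) i
    rw [show A.act n q₁ = q₁ by simpa using hfix 1] at h2
    by_contra hne
    have h3 : Real.exp (inner ℝ (wt i) n) = 1 :=
      mul_right_cancel₀ hne (h2.symm.trans (one_mul _).symm)
    exact hi (Real.exp_eq_one_iff _ |>.1 h3)
  refine ⟨q₁, ⟨_, rfl⟩, (ht₀ t₀ le_rfl).1, hq₁U, ?_, hstab, fun j hj => hpos j hj.le⟩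
  obtain ⟨i, hi⟩ : ∃ i, y q₁ i ≠ 0 := by
    by_contra! hall
    have : q₁ = p := hyi hq₁U hpU (by ext i; rw [hall, hyp]; rfl)
    exact h₁.not_fixed (this ▸ hp)
  refine ⟨i, hi, -inner ℝ (wt i) (rot n), ?_, ?_⟩
  · by_contra hneg
    exact hi (hpos i (by linarith))
  · rw [neg_neg, real_inner_comm]
    refine eq_smul_rot_of_inner_eq_zero h.norm ?_
    by_contra hne
    exact hi (hstab i (by rwa [real_inner_comm]))

theorem IsLeaf.tendsto_act (hL : A.IsLeaf L) (hq : q ∈ closure L) (hp : p ∈ closure L)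
    (ht : Tendsto (fun t : ℝ => A.F (A.act (t • m) q)) atTop (𝓝 (A.F p))) :
    Tendsto (fun t : ℝ => A.act (t • m) q) atTop (𝓝 p) :=
  tendsto_of_tendsto_image A.continuous_F isClosed_closure.isCompact hL.injOn_closure
    (Eventually.of_forall fun _ => hL.orbit_subset_closure hq ⟨_, rfl⟩) hp ht

/-- A fixed point is not in the interior of a side of the image of a leaf. -/
theorem IsLeaf.false_of_opposite_edges (hL : A.IsLeaf L) (hpL : p ∈ closure L) (hp : A.Fixed p)
    (hq : A.EdgeAt q n) (hqL : q ∈ closure L) (hq' : A.EdgeAt q' n) (hqL' : q' ∈ closure L)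
    (ht : Tendsto (fun t : ℝ => A.F (A.act (t • rot n) q)) atTop (𝓝 (A.F p)))
    (ht' : Tendsto (fun t : ℝ => A.F (A.act (t • rot (-n)) q')) atTop (𝓝 (A.F p))) : False := by
  obtain ⟨d, U, y, wt, hU, hpU, hyc, hyi, hyp, hy⟩ := A.chart (hL.closure_subset_dom hpL) hp
  have hN : ∃ ε > 0, ∀ x ∈ closure L, A.F x ∈ Metric.ball (A.F p) ε → x ∈ U := by
    have hcomp : IsCompact (closure L \ U) := isClosed_closure.isCompact.diff hU
    have hnot : A.F p ∉ A.F '' (closure L \ U) := by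
      rintro ⟨z, hz, hzF⟩
      exact hz.2 (hL.injOn_closure hz.1 hpL hzF ▸ hpU)
    obtain ⟨ε, hε, hball⟩ := Metric.isOpen_iff.1 (hcomp.image A.continuous_F).isClosed.isOpen_compl
      _ hnot
    refine ⟨ε, hε, fun x hx hxF => ?_⟩
    by_contra hxU
    exact hball hxF ⟨x, ⟨hx, hxU⟩, rfl⟩
  obtain ⟨ε, hε, hN⟩ := hN
  set B := Metric.ball (A.F p) ε
  have hW : A.F ⁻¹' B ∈ 𝓝 p :=
    A.continuous_F.continuousAt.preimage_mem_nhds (Metric.ball_mem_nhds _ hε)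
  obtain ⟨q₁, hq₁, hq₁B, hq₁U, ⟨i, hi, a, ha, hwi⟩, -, hz₁⟩ :=
    hq.exists_contracted hU hpU hyc hyi hyp hy hW hp (hL.tendsto_act hqL hpL ht)
  obtain ⟨q₂, hq₂, hq₂B, hq₂U, ⟨j, hj, b, hb, hwj⟩, -, -⟩ :=
    hq'.neg.exists_contracted hU hpU hyc hyi hyp hy hW hp (hL.tendsto_act hqL' hpL ht')
  rw [rot_neg, smul_neg, neg_smul, neg_neg] at hwj
  have hq₁L := hL.orbit_subset_closure hqL hq₁
  have hq₂L := hL.orbit_subset_closure hqL' hq₂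
  have hyj : y q₁ j = 0 := hz₁ j (by
    rw [hwj, real_inner_smul_left, inner_rot_rot, inner_self_eq_one hq.norm]; linarith)
  have hBo : IsOpen (A.F ⁻¹' B) := Metric.isOpen_ball.preimage A.continuous_F
  have hcl₁ : q₁ ∈ closure (L ∩ A.F ⁻¹' B) := by
    rw [inter_comm]
    exact hBo.inter_closure ⟨hq₁B, hq₁L⟩
  have hcl₂ : q₂ ∈ closure (L ∩ A.F ⁻¹' B) := by
    rw [inter_comm]
    exact hBo.inter_closure ⟨hq₂B, hq₂L⟩
  obtain ⟨x, hxL, hxB⟩ : (L ∩ A.F ⁻¹' B).Nonempty := closure_nonempty_iff.1 ⟨q₁, hcl₁⟩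
  have key : ∀ x' ∈ L ∩ A.F ⁻¹' B, ∃ σ, x' = A.act σ x ∧
      ∀ i, y x' i = Real.exp (inner ℝ (wt i) σ) * y x i := fun x' hx' =>
    hL.exists_chart_eq hy (convex_ball _ _) Metric.isOpen_ball
      (fun z hz => hN z (subset_closure hz.1) hz.2) hxL hxB hx'.1 hx'.2
  have hclos : ∀ {z : M}, z ∈ U → z ∈ closure (L ∩ A.F ⁻¹' B) → ∀ {g : (Fin d → ℝ) → ℝ},
      Continuous g → ∀ {r : ℝ}, (∀ x' ∈ L ∩ A.F ⁻¹' B, g (y x') = r) → g (y z) = r := by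
    intro z hzU hz g hg r hgr
    have hc : ContinuousAt (fun z => g (y z)) z :=
      hg.continuousAt.comp (hyc.continuousAt (hU.mem_nhds hzU))
    have : (fun z => g (y z)) z ∈ closure {r} :=
      hc.continuousWithinAt.mem_closure hz hgr
    simpa using this
  -- The weights are -a • rot n and b • rot n, so |y i|^b |y j|^a is constant on the leaf near p. It
  -- vanishes at q₁, hence y i or y j vanishes on the leaf near p, and by continuity at q₁ or q₂
  -- too, where these coordinates are not zero.
  have hG := hclos hq₁U hcl₁ (g := fun v => |v i| ^ b * |v j| ^ a)
    ((continuous_abs.comp (continuous_apply i)).rpow_const (fun _ => .inr hb.le) |>.mul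
      ((continuous_abs.comp (continuous_apply j)).rpow_const (fun _ => .inr ha.le)))
    (r := |y x i| ^ b * |y x j| ^ a) (fun x' hx' => by
      obtain ⟨σ, -, hσ⟩ := key x' hx'
      simp only [hσ, abs_mul, Real.abs_exp]
      rw [Real.mul_rpow (Real.exp_pos _).le (abs_nonneg _),
        Real.mul_rpow (Real.exp_pos _).le (abs_nonneg _), ← Real.exp_mul, ← Real.exp_mul, hwi, hwj,
        real_inner_smul_left, real_inner_smul_left]
      have : Real.exp (-a * inner ℝ (rot n) σ * b) * Real.exp (b * inner ℝ (rot n) σ * a) = 1 := by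
        rw [← Real.exp_add, Real.exp_eq_one_iff]; ring
      linear_combination (|y x i| ^ b * |y x j| ^ a) * this)
  simp only [hyj, abs_zero, Real.zero_rpow ha.ne', mul_zero] at hG
  have hzero : ∀ k, y x k = 0 → ∀ {z : M}, z ∈ U → z ∈ closure (L ∩ A.F ⁻¹' B) → y z k = 0 :=
    fun k hk z hzU hz => hclos hzU hz (g := fun v => v k) (continuous_apply k) fun x' hx' => by
      obtain ⟨σ, -, hσ⟩ := key x' hx'
      rw [hσ, hk, mul_zero]
  rcases mul_eq_zero.1 hG.symm with h0 | h0
  · rw [Real.rpow_eq_zero (abs_nonneg _) hb.ne', abs_eq_zero] at h0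
    exact hi (hzero i h0 hq₁U hcl₁)
  · rw [Real.rpow_eq_zero (abs_nonneg _) ha.ne', abs_eq_zero] at h0
    exact hj (hzero j h0 hq₂U hcl₂)

/-- A side contains just one critical edge. -/
theorem IsNormal.eq_of_eq (hL : A.IsLeaf L) (hc : c ∈ A.frame L) (hc' : c' ∈ A.frame L)
    (h : A.IsNormal L c n) (h' : A.IsNormal L c' n) : c = c' := by
  by_contra hne
  obtain ⟨q, hq⟩ := hc.1.nonempty
  obtain ⟨q', hq'⟩ := hc'.1.nonempty
  have hnn : (inner ℝ n (A.F q) : ℝ) = inner ℝ n (A.F q') :=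
    le_antisymm (h'.le_of_mem_closure (hL.image_closure ▸ ⟨q, hc.2 hq, rfl⟩) hq')
      (h.le_of_mem_closure (hL.image_closure ▸ ⟨q', hc'.2 hq', rfl⟩) hq)
  have hnF : A.F q ≠ A.F q' := fun heq => hne (hc.1.eq_of_mem_of_mem hc'.1 hq
    (hL.injOn_closure (hc.2 hq) (hc'.2 hq') heq ▸ hq'))
  -- The edge c is taken to precede c' along their common line. Its forward end p then lies strictly
  -- before F q', and the part of the side just after p is examined.
  wlog hlt : (inner ℝ (rot n) (A.F q) : ℝ) < inner ℝ (rot n) (A.F q') generalizing c c' q q'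
  · refine this hc' hc h' h (Ne.symm hne) q' hq' q hq hnn.symm hnF.symm ?_
    refine lt_of_le_of_ne (not_lt.1 hlt) fun heq => hnF ?_
    rw [plane_decomp h.norm (A.F q), plane_decomp h.norm (A.F q'), hnn, heq]
  set g : ℝ := inner ℝ (rot n) (A.F q') - inner ℝ (rot n) (A.F q) with hg
  have hFq' : A.F q' = A.F q + g • rot n := by
    have h1 := eq_smul_rot_of_inner_eq_zero h.norm
      (show (inner ℝ n (A.F q' - A.F q) : ℝ) = 0 by rw [inner_sub_right, hnn, sub_self])
    rw [inner_sub_right, ← hg] at h1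
    rw [← h1]; abel
  have hqe := h.edgeAt hc.1 hq
  obtain ⟨p, hpd, hpf, hpcl, b, hb, hpF, hseg, -, htend⟩ := hqe.exists_endpoint
  have hpL : p ∈ closure L := by
    refine closure_minimal ?_ isClosed_closure hpcl
    rw [← hc.1.eq_orbit hq]
    exact hc.2
  have hbg : b < g := by
    by_contra hbg
    rcases (not_lt.1 hbg).lt_or_eq with hlt' | heq
    · obtain ⟨z, hz, hzF⟩ := hseg g (sub_pos.2 hlt).le hlt'
      rw [← hFq', ← hc.1.eq_orbit hq] at *
      exact hne (hc.1.eq_of_mem_of_mem hc'.1 hz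
        (hL.injOn_closure (hc.2 hz) (hc'.2 hq') hzF ▸ hq'))
    · rw [← heq, ← hFq'] at hpF
      have := hL.injOn_closure hpL (hc'.2 hq') hpF
      exact (h'.edgeAt hc'.1 hq').not_fixed (this ▸ hpf)
  have hfin : {s : ℝ | s ≠ 0 ∧ ∃ p', (p' ∈ A.dom ∧ A.Fixed p') ∧ A.F p' = A.F p + s • rot n}.Finite := by
    have hrot : rot n ≠ 0 := by
      rw [← norm_ne_zero_iff, norm_rot]; exact norm_ne_zero_iff.2 h.ne_zero
    refine ((finite_fixed (A := A)).image A.F).preimage (f := fun s : ℝ => A.F p + s • rot n)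
      (fun s _ t _ hst => smul_left_injective ℝ hrot (add_left_cancel hst)) |>.subset ?_
    rintro s ⟨-, p', hp', hF⟩
    exact ⟨p', hp', hF⟩
  have hev : ∀ᶠ s : ℝ in 𝓝 0, s ∉ {s : ℝ | s ≠ 0 ∧ ∃ p', (p' ∈ A.dom ∧ A.Fixed p') ∧
      A.F p' = A.F p + s • rot n} :=
    hfin.isClosed.isOpen_compl.mem_nhds (by simp)
  obtain ⟨δ, hδ, hball⟩ := Metric.eventually_nhds_iff.1 hev
  set s := min (δ / 2) ((g - b) / 2) with hs
  have hs0 : 0 < s := lt_min (by linarith) (by linarith)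
  have hsδ : s < δ := (min_le_left _ _).trans_lt (by linarith)
  have hsg : s < g - b := (min_le_right _ _).trans_lt (by linarith)
  have hsup : ∀ t : ℝ, (inner ℝ n (A.F q + t • rot n) : ℝ) = inner ℝ n (A.F q) := fun t => by
    rw [inner_add_right, real_inner_smul_right, inner_rot_self, mul_zero, add_zero]
  have hzcl : A.F p + s • rot n ∈ closure (A.F '' L) := by
    have h1 : A.F p ∈ closure (A.F '' L) := hL.image_closure ▸ ⟨p, hpL, rfl⟩
    have h2 : A.F q' ∈ closure (A.F '' L) := hL.image_closure ▸ ⟨q', hc'.2 hq', rfl⟩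
    have h3 := hL.convex_image.closure h1 h2 (a := 1 - s / (g - b)) (b := s / (g - b))
      (by rw [sub_nonneg, div_le_one (by linarith)]; exact hsg.le) (div_nonneg hs0.le (by linarith))
      (by ring)
    convert h3 using 1
    have h4 : s / (g - b) * (g - b) = s := div_mul_cancel₀ _ (by linarith)
    rw [hpF, hFq']
    match_scalars
    · ring
    · linear_combination -h4
  have hznot : A.F p + s • rot n ∉ A.F '' L := fun hmem => by
    have := h.lt_of_mem hmem hq
    rw [hpF, add_assoc, ← add_smul, hsup] at this
    exact lt_irrefl _ this
  -- No fixed point projects to this place or strictly between it and F p. So z is on an edge, whose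
  -- line is that of the side, and whose backward end can only be p. Then p separates two edges on
  -- one side.
  obtain ⟨z, hzL, hzF, hzc⟩ := hL.exists_of_mem_closure_of_notMem hzcl hznot
  rcases hzc with hfix | ⟨m, hm, -⟩
  · exact hball (by rwa [Real.dist_eq, sub_zero, abs_of_pos hs0])
      ⟨hs0.ne', z, ⟨hL.closure_subset_dom hzL, hfix⟩, hzF⟩
  have hnz : (inner ℝ n (A.F z) : ℝ) = inner ℝ n (A.F q) := by
    rw [hzF, hpF, add_assoc, ← add_smul, hsup]
  have hze : A.EdgeAt z n := hm.of_stab h.norm <| by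
    have := hL.eq_smul_of_support hm hzL (n := n) fun x hx => by
      rw [hnz]; exact (h.lt x hx q hq).le
    rw [hm.stab, this, real_inner_smul_right, inner_rot_self', mul_zero]
  obtain ⟨p', hpd', hpf', hpcl', b', hb', hpF', hseg', -, htend'⟩ := hze.neg.exists_endpoint
  have hpL' : p' ∈ closure L :=
    closure_minimal (hL.orbit_subset_closure hzL) isClosed_closure hpcl'
  rw [rot_neg] at hpF' hseg'
  have hpF'' : A.F p' = A.F p + (s - b') • rot n := by
    rw [hpF', hzF]; module
  have hbs : b' = s := by
    rcases lt_trichotomy b' s with hlt | heq | hgt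
    · refine absurd ⟨by linarith, p', ⟨hpd', hpf'⟩, hpF''⟩ (hball (y := s - b') ?_)
      rw [Real.dist_eq, sub_zero, abs_of_pos (by linarith)]
      linarith
    · exact heq
    · obtain ⟨z', hz', hzF'⟩ := hseg' s hs0.le hgt
      have h1 : A.F z' = A.F p := by rw [hzF', hzF]; module
      have h2 := hL.injOn_closure (hL.orbit_subset_closure hzL hz') hpL h1
      exact absurd (h2 ▸ hpf) (hze.of_mem_orbit hz').not_fixed
  rw [hbs, sub_self, zero_smul, add_zero] at hpF''
  have hpp := hL.injOn_closure hpL' hpL hpF''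
  rw [hpp] at htend'
  exact hL.false_of_opposite_edges hpL hpf hqe (hc.2 hq) hze hzL htend htend'

end PlaneAction

/-! ### Degenerations: the limit leaves tile the common image. -/

namespace PlaneAction

variable {M : Type*} [TopologicalSpace M] [T2Space M] [CompactSpace M]

/-- The leaves `Λ m` have the frame `f` and converge to the union of the distinct leaves `L i`. -/
structure Degeneration (A : PlaneAction M) (f : Set (Set M)) (Λ : ℕ → Set M) {ι : Type*}
    (L : ι → Set M) : Prop where
  leaf : ∀ m, A.IsLeaf (Λ m)
  frame_eq : ∀ m, A.frame (Λ m) = f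
  limit_leaf : ∀ i, A.IsLeaf (L i)
  injective : Injective L
  upper : ∀ U : Set M, IsOpen U → (⋃ i, closure (L i)) ⊆ U → ∀ᶠ m in atTop, closure (Λ m) ⊆ U
  lower : ∀ U : Set M, IsOpen U → ((⋃ i, closure (L i)) ∩ U).Nonempty →
    ∀ᶠ m in atTop, (closure (Λ m) ∩ U).Nonempty

variable {A : PlaneAction M} {L c c' : Set M} {n m : Plane} {q x : M}

theorem EdgeAt.infinite_image (h : A.EdgeAt q n) : (A.F '' A.orbit q).Infinite := by
  obtain ⟨ε, hε, hseg⟩ := h.exists_segment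
  have hrot : rot n ≠ 0 := by
    rw [← norm_ne_zero_iff, norm_rot, h.norm]; exact one_ne_zero
  have h1 : ((fun s : ℝ => A.F q + s • rot n) '' Ioo (-ε) ε).Infinite :=
    (Ioo_infinite (by linarith)).image
      fun s _ t _ hst => smul_left_injective ℝ hrot (add_left_cancel hst)
  refine h1.mono ?_
  rintro _ ⟨s, hs, rfl⟩
  exact hseg s (abs_lt.2 hs)

theorem IsEdge.exists_F_notMem (hc : A.IsEdge c) {S : Set Plane} (hS : S.Finite) :
    ∃ q ∈ c, A.F q ∉ S := by
  obtain ⟨n, hn⟩ := hc.exists_edgeAt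
  obtain ⟨q, hq⟩ := hc.nonempty
  obtain ⟨_, ⟨z, hz, rfl⟩, hzS⟩ := (hn q hq).infinite_image.exists_notMem_finite hS
  exact ⟨z, hc.eq_orbit hq ▸ hz, hzS⟩

namespace Degeneration

variable {f : Set (Set M)} {Λ : ℕ → Set M} {ι : Type*} [Finite ι] {L : ι → Set M}
  (D : A.Degeneration f Λ L) {i j k : ι}

include D

/-- A fibre is connected as a limit, and finite because each closure contributes at most one point.
This is what prevents the tiles from overlapping. -/
theorem injOn_F : InjOn A.F (⋃ i, closure (L i)) := by
  have hcl : IsClosed (⋃ i, closure (L i)) := isClosed_iUnion_of_finite fun i => isClosed_closure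
  intro a ha b hb hab
  have hpre := isPreconnected_fibre_of_limit (l := atTop) A.continuous_F (S := Λ) hcl
    (fun U hU h => (D.upper U hU h).mono fun m hm => subset_closure.trans hm)
    (fun U hU h => (D.lower U hU h).mono fun m hm => (closure_inter_open_nonempty_iff hU).1 hm)
    (fun m z ε => (D.leaf m).isPreconnected_inter z ε) (A.F a)
  refine IsPreconnected.subsingleton_of_finite hpre ?_ ⟨ha, rfl⟩ ⟨hb, hab.symm⟩
  rw [iUnion_inter]
  refine finite_iUnion fun i => Set.Subsingleton.finite ?_
  rintro y ⟨hy, hyF⟩ z ⟨hz, hzF⟩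
  exact (D.limit_leaf i).injOn_closure hy hz (hyF.trans hzF.symm)

theorem eq_of_F_eq {y z : M} (hy : y ∈ closure (L i)) (hz : z ∈ closure (L j))
    (h : A.F y = A.F z) : y = z :=
  D.injOn_F (mem_iUnion.2 ⟨i, hy⟩) (mem_iUnion.2 ⟨j, hz⟩) h

theorem closure_image_eq (m : ℕ) : closure (A.F '' Λ m) = closure (A.F '' Λ 0) := by
  rw [(D.leaf m).closure_image_eq, (D.leaf 0).closure_image_eq, D.frame_eq, D.frame_eq]

/-- All the leaves Λ m have the same closed image. One inclusion comes from the lower half of the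
convergence, the other from the upper half. -/
theorem image_iUnion : A.F '' (⋃ i, closure (L i)) = closure (A.F '' Λ 0) := by
  have hcl : IsClosed (⋃ i, closure (L i)) := isClosed_iUnion_of_finite fun i => isClosed_closure
  refine subset_antisymm ?_ fun z hz => ?_
  · rintro _ ⟨x, hx, rfl⟩
    by_contra hnot
    obtain ⟨m, y, hy, hyU⟩ := (D.lower (A.F ⁻¹' (closure (A.F '' Λ 0))ᶜ)
      (isClosed_closure.isOpen_compl.preimage A.continuous_F) ⟨x, hx, hnot⟩).exists
    refine hyU ?_
    rw [← D.closure_image_eq m, ← (D.leaf m).image_closure]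
    exact ⟨y, hy, rfl⟩
  · by_contra hnot
    obtain ⟨m, hm⟩ := (D.upper (A.F ⁻¹' {z}ᶜ) (isOpen_compl_singleton.preimage A.continuous_F)
      fun x hx hxz => hnot ⟨x, hx, hxz⟩).exists
    rw [← D.closure_image_eq m, ← (D.leaf m).image_closure] at hz
    obtain ⟨y, hy, hyz⟩ := hz
    exact hm hy hyz

theorem closure_image_subset (i : ι) : closure (A.F '' L i) ⊆ closure (A.F '' Λ 0) := by
  rw [← D.image_iUnion, ← (D.limit_leaf i).image_closure]
  exact image_mono (subset_iUnion (fun i => closure (L i)) i)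

theorem image_subset (i : ι) : A.F '' L i ⊆ A.F '' Λ 0 := by
  rw [← (D.leaf 0).interior_closure]
  exact interior_maximal (subset_closure.trans (D.closure_image_subset i))
    (D.limit_leaf i).isOpen_image

theorem exists_mem_closure {z : Plane} (hz : z ∈ closure (A.F '' Λ 0)) :
    ∃ i, z ∈ closure (A.F '' L i) := by
  rw [← D.image_iUnion] at hz
  obtain ⟨x, hx, rfl⟩ := hz
  obtain ⟨i, hi⟩ := mem_iUnion.1 hx
  exact ⟨i, (D.limit_leaf i).image_closure ▸ ⟨x, hi, rfl⟩⟩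

/-- Equal values mean equal points. The point is free, so it lies on both leaves, which then
coincide. -/
theorem eq_of_mem_image_of_mem_closure {z : Plane} (hi : z ∈ A.F '' L i)
    (hj : z ∈ closure (A.F '' L j)) : i = j := by
  obtain ⟨x, hx, rfl⟩ := hi
  rw [← (D.limit_leaf j).image_closure] at hj
  obtain ⟨y, hy, hyx⟩ := hj
  have := D.eq_of_F_eq hy (subset_closure hx) hyx
  subst this
  exact D.injective ((D.limit_leaf i).eq_of_mem_of_mem (D.limit_leaf j) hx
    ((D.limit_leaf j).mem_of_free hy ((D.limit_leaf i).free hx)))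

/-- The edge lies in the closures of all Λ m, hence in their limit. -/
theorem exists_mem_frame_of_mem (hc : c ∈ f) : ∃ i, c ∈ A.frame (L i) := by
  have hc0 := hc
  rw [← D.frame_eq 0] at hc0
  have hcl : IsClosed (⋃ i, closure (L i)) := isClosed_iUnion_of_finite fun i => isClosed_closure
  obtain ⟨q, hq⟩ := hc0.1.nonempty
  have hqK : q ∈ ⋃ i, closure (L i) := by
    by_contra hnot
    obtain ⟨m, hm⟩ := (D.upper {q}ᶜ isOpen_compl_singleton
      fun x hx hxq => hnot (hxq ▸ hx)).exists
    have : c ∈ A.frame (Λ m) := (D.frame_eq m).symm ▸ hc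
    exact hm (this.2 hq) rfl
  obtain ⟨i, hi⟩ := mem_iUnion.1 hqK
  exact ⟨i, hc0.1, by rw [hc0.1.eq_orbit hq]; exact (D.limit_leaf i).orbit_subset_closure hi⟩

/-- Take a point of c that does not project to the image of a fixed point. If it projects inside the
outer image, the points just beyond c belong to other tiles; if it projects to the boundary, the
outer leaf has an edge there, which must be c. -/
theorem mem_or_exists_mem (hc : c ∈ A.frame (L i)) : c ∈ f ∨ ∃ j, j ≠ i ∧ c ∈ A.frame (L j) := by
  obtain ⟨q, hq, hqF⟩ := hc.1.exists_F_notMem ((finite_fixed (A := A)).image A.F)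
  have hqQ : A.F q ∈ closure (A.F '' Λ 0) := by
    rw [← D.image_iUnion]
    exact ⟨q, mem_iUnion.2 ⟨i, hc.2 hq⟩, rfl⟩
  by_cases hqP : A.F q ∈ A.F '' Λ 0
  · right
    obtain ⟨n, hn⟩ := (D.limit_leaf i).exists_isNormal hc
    have hlim : Tendsto (fun s : ℝ => A.F q + s • n) (𝓝[>] 0) (𝓝 (A.F q)) := by
      have : ContinuousAt (fun s : ℝ => A.F q + s • n) 0 := by fun_prop
      have h1 := this.tendsto.mono_left (nhdsWithin_le_nhds (s := Ioi 0))
      simpa using h1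
    have h1 : ∀ᶠ s : ℝ in 𝓝[>] 0, ∃ j, j ≠ i ∧ A.F q + s • n ∈ closure (A.F '' L j) := by
      filter_upwards [hlim ((D.leaf 0).isOpen_image.mem_nhds hqP), self_mem_nhdsWithin] with s h1 h2
      obtain ⟨j, hj⟩ := D.exists_mem_closure (subset_closure h1)
      refine ⟨j, ?_, hj⟩
      rintro rfl
      have h3 := hn.le_of_mem_closure hj hq
      rw [inner_add_right, real_inner_smul_right, inner_self_eq_one hn.norm] at h3
      have : 0 < s := h2
      linarith
    -- There are finitely many tiles, so one of them contains points arbitrarily close to F q and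
    -- hence F q itself.
    obtain ⟨j, hj⟩ : ∃ j, ∃ᶠ s : ℝ in 𝓝[>] 0, j ≠ i ∧ A.F q + s • n ∈ closure (A.F '' L j) := by
      by_contra hcon
      simp only [not_exists, not_frequently] at hcon
      obtain ⟨s, h2, j, h3⟩ := ((eventually_all.2 hcon).and h1).exists
      exact h2 j h3
    have hji : j ≠ i := hj.exists.choose_spec.1
    have hqj : A.F q ∈ closure (A.F '' L j) :=
      isClosed_closure.mem_of_frequently_of_tendsto (hj.mono fun s hs => hs.2) hlim
    rw [← (D.limit_leaf j).image_closure] at hqj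
    obtain ⟨q', hq', hqq⟩ := hqj
    have := D.eq_of_F_eq hq' (hc.2 hq) hqq
    subst this
    exact ⟨j, hji, hc.1, by rw [hc.1.eq_orbit hq]; exact (D.limit_leaf j).orbit_subset_closure hq'⟩
  · left
    obtain ⟨q', hq', hqq, h⟩ := (D.leaf 0).exists_of_mem_closure_of_notMem hqQ hqP
    rcases h with hfix | ⟨m, hm, hmem⟩
    · exact absurd ⟨q', ⟨(D.leaf 0).closure_subset_dom hq', hfix⟩, hqq⟩ hqF
    · rw [D.frame_eq] at hmem
      obtain ⟨j, hj⟩ := D.exists_mem_frame_of_mem hmem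
      have := D.eq_of_F_eq (hj.2 (mem_orbit_self hm.mem)) (hc.2 hq) hqq
      subst this
      rwa [hc.1.eq_orbit hq]

theorem isNormal_of_outer (i : ι) (hn : A.IsNormal (Λ 0) c n) :
    A.IsNormal (L i) c n :=
  ⟨hn.norm, hn.stab, fun _ hx _ hq => hn.lt_of_mem (D.image_subset i ⟨_, hx, rfl⟩) hq⟩

/-- With equal normals both tiles would fill the same half-disc at a point of c. -/
theorem eq_neg_of_ne (hij : i ≠ j) (hc : c ∈ A.frame (L i)) (hc' : c ∈ A.frame (L j))
    (hn : A.IsNormal (L i) c n) (hm : A.IsNormal (L j) c m) : m = -n := by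
  obtain ⟨q, hq⟩ := hc.1.nonempty
  rcases (hn.edgeAt hc.1 hq).eq_or_eq_neg (hm.edgeAt hc.1 hq) with rfl | h
  · exfalso
    have hlim : Tendsto (fun s : ℝ => A.F q + s • m) (𝓝[<] 0) (𝓝 (A.F q)) := by
      have : ContinuousAt (fun s : ℝ => A.F q + s • m) 0 := by fun_prop
      have h1 := this.tendsto.mono_left (nhdsWithin_le_nhds (s := Iio 0))
      simpa using h1
    obtain ⟨s, ⟨h1, h2⟩, hs⟩ := ((hlim.eventually ((hn.eventually_mem (D.limit_leaf i) hc hq).and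
      (hm.eventually_mem (D.limit_leaf j) hc' hq))).and self_mem_nhdsWithin).exists
    have h3 : (inner ℝ m (A.F q + s • m) : ℝ) < inner ℝ m (A.F q) := by
      rw [inner_add_right, real_inner_smul_right, inner_self_eq_one hn.norm]
      have : s < 0 := hs
      linarith
    exact hij (D.eq_of_mem_image_of_mem_closure (h1 h3) (subset_closure (h2 h3)))
  · exact h

theorem eq_of_mem_of_mem_outer (hc : c ∈ f) (hi : c ∈ A.frame (L i)) (hj : c ∈ A.frame (L j)) :
    i = j := by
  by_contra hij
  rw [← D.frame_eq 0] at hc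
  obtain ⟨n, hn⟩ := (D.leaf 0).exists_isNormal hc
  have h1 := D.eq_neg_of_ne hij hi hj (D.isNormal_of_outer i hn) (D.isNormal_of_outer j hn)
  exact hn.ne_neg h1

/-- Three nonzero normals cannot be pairwise opposite. -/
theorem eq_of_mem_of_mem_of_mem (hi : c ∈ A.frame (L i)) (hj : c ∈ A.frame (L j))
    (hk : c ∈ A.frame (L k)) (hij : i ≠ j) (hik : i ≠ k) : j = k := by
  by_contra hjk
  obtain ⟨a, ha⟩ := (D.limit_leaf i).exists_isNormal hi
  obtain ⟨b, hb⟩ := (D.limit_leaf j).exists_isNormal hj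
  obtain ⟨c, hc⟩ := (D.limit_leaf k).exists_isNormal hk
  have h1 := D.eq_neg_of_ne hij hi hj ha hb
  have h2 := D.eq_neg_of_ne hik hi hk ha hc
  have h3 := D.eq_neg_of_ne hjk hj hk hb hc
  rw [h1, h2, neg_neg] at h3
  exact ha.ne_neg h3.symm

end Degeneration

end PlaneAction

/-! ### Exit times, small times near free points, and first integrals near an edge. -/

/-- A path that leaves an open set has a first exit time. -/
theorem exists_first_exit {X : Type*} [TopologicalSpace X] {O : Set X} (hO : IsOpen O) {γ : ℝ → X}
    (hγ : Continuous γ) (h0 : γ 0 ∈ O) {T : ℝ} (hT : 0 ≤ T) (hTO : γ T ∉ O) :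
    ∃ β, 0 < β ∧ γ β ∉ O ∧ (∀ s, 0 ≤ s → s < β → γ s ∈ O) ∧
      ∀ s, 0 ≤ s → s ≤ β → γ s ∈ closure O := by
  set S : Set ℝ := {s | 0 ≤ s ∧ γ s ∉ O} with hS
  have hcl : IsClosed S := isClosed_Ici.inter (hO.isClosed_compl.preimage hγ)
  have hbdd : BddBelow S := ⟨0, fun s hs => hs.1⟩
  have hmem : sInf S ∈ S := hcl.csInf_mem ⟨T, hT, hTO⟩ hbdd
  have hpos : 0 < sInf S := lt_of_le_of_ne hmem.1 fun h => hmem.2 (h ▸ h0)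
  have hlt : ∀ s, 0 ≤ s → s < sInf S → γ s ∈ O := fun s hs hs' => by
    by_contra hn
    exact not_le.2 hs' (csInf_le hbdd ⟨hs, hn⟩)
  refine ⟨sInf S, hpos, hmem.2, hlt, fun s hs hs' => ?_⟩
  have : s ∈ closure (Ico 0 (sInf S)) := by
    rw [closure_Ico hpos.ne]; exact ⟨hs, hs'⟩
  exact map_mem_closure hγ this fun r hr => hlt r hr.1 hr.2

namespace PlaneAction

variable {M : Type*} [TopologicalSpace M] [T2Space M] [CompactSpace M]

variable {A : PlaneAction M} {L c c' : Set M} {n m : Plane} {q x : M}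

/-- The forward orbits of a one-parameter subgroup accumulate at points that it fixes. -/
theorem exists_mapClusterPt (hx : x ∈ A.dom) (u : Plane) :
    ∃ p, MapClusterPt p atTop (fun t : ℝ => A.act (t • u) x) ∧ A.act u p = p := by
  obtain ⟨p, hp⟩ : ∃ p, MapClusterPt p atTop (fun t : ℝ => A.act (t • u) x) := by
    obtain ⟨p, -, hp⟩ := isCompact_univ (X := M) (f := map (fun t : ℝ => A.act (t • u) x) atTop)
      (by simp)
    exact ⟨p, hp⟩
  refine ⟨p, hp, ?_⟩
  set k : ℝ → ℝ := fun t => inner ℝ u (A.F (A.act (t • u) x)) with hk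
  have hmono : Monotone k := fun s t hst => by
    rcases hst.eq_or_lt with rfl | hlt
    · rfl
    have h1 := inner_nonneg hx (t • u) (s • u)
    rw [← sub_smul, real_inner_smul_left, inner_sub_right] at h1
    exact sub_nonneg.1 (nonneg_of_mul_nonneg_right h1 (sub_pos.2 hlt))
  have hbdd : BddAbove (range k) := by
    have : IsCompact (range fun y : M => (inner ℝ u (A.F y) : ℝ)) :=
      isCompact_range (by have := A.continuous_F; fun_prop)
    refine this.bddAbove.mono ?_
    rintro _ ⟨t, rfl⟩
    exact ⟨_, rfl⟩
  have hlim : Tendsto k atTop (𝓝 (⨆ t, k t)) := tendsto_atTop_ciSup hmono hbdd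
  obtain ⟨g, hg, hgp⟩ := mapClusterPt_iff_ultrafilter.1 hp
  have hpd : p ∈ A.dom := A.isClosed_dom.mem_of_tendsto hgp
    (Eventually.of_forall fun t => A.act_mem hx _)
  have hval : ∀ s : ℝ, (inner ℝ u (A.F (A.act (s • u) p)) : ℝ) = ⨆ t, k t := fun s => by
    have hc : Continuous fun y => (inner ℝ u (A.F (A.act (s • u) y)) : ℝ) := by
      have := A.continuous_F.comp (continuous_act_right (A := A) (s • u))
      simp only [comp_def] at this
      fun_prop
    have h2 : Tendsto (fun t : ℝ => k (s + t)) g (𝓝 (⨆ t, k t)) :=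
      (hlim.comp (tendsto_atTop_add_const_left atTop s tendsto_id)).mono_left hg
    refine tendsto_nhds_unique ((hc.tendsto p).comp hgp) (h2.congr fun t => ?_)
    simp only [hk, comp_apply]
    rw [← A.act_add hx, add_smul]
  by_contra hne
  have h1 := A.mono hpd _ hne
  have h2 := hval 1
  have h3 := hval 0
  rw [one_smul] at h2
  rw [zero_smul, A.act_zero hpd] at h3
  rw [inner_sub_right, h2, h3, sub_self] at h1
  exact lt_irrefl _ h1

/-- Near a free point, the time needed to go from one point to another is small. -/
theorem tendsto_time {κ : Type*} {l : Filter κ} {a : κ → M} {σ : κ → Plane}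
    (ha : ∀ᶠ k in l, a k ∈ A.dom) (hx : x ∈ A.dom) (hf : A.Free x) (h1 : Tendsto a l (𝓝 x))
    (h2 : Tendsto (fun k => A.act (σ k) (a k)) l (𝓝 x)) : Tendsto σ l (𝓝 0) := by
  rw [Metric.tendsto_nhds]
  intro ε hε
  by_contra hcon
  rw [not_eventually] at hcon
  obtain ⟨g, hgl, hg⟩ : ∃ g : Ultrafilter κ, ↑g ≤ l ∧ ∀ᶠ k in g, ¬ dist (σ k) 0 < ε := by
    have := frequently_mem_iff_neBot (s := {k | ¬ dist (σ k) 0 < ε}).1 hcon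
    exact ⟨Ultrafilter.of _, (Ultrafilter.of_le _).trans inf_le_left,
      le_principal_iff.1 ((Ultrafilter.of_le _).trans inf_le_right)⟩
  -- If the times do not tend to 0, compare the time σ k with the time ε in the same direction u k.
  -- The height along u k is not smaller at σ k; in the limit direction v this gives ⟨v, F(x) -
  -- F(εv·x)⟩ ≥ 0, although x is moved by εv.
  set u : κ → Plane := fun k => ‖σ k‖⁻¹ • σ k with hu
  have hσ : ∀ᶠ k in g, ε ≤ ‖σ k‖ := hg.mono fun k hk => by
    rwa [dist_zero_right, not_lt] at hk
  have hunorm : ∀ᶠ k in g, u k ∈ Metric.sphere (0 : Plane) 1 := hσ.mono fun k hk => by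
    have : ‖σ k‖ ≠ 0 := (hε.trans_le hk).ne'
    rw [mem_sphere_zero_iff_norm, hu]
    simp only
    rw [norm_smul, norm_inv, norm_norm, inv_mul_cancel₀ this]
  obtain ⟨v, hv, hlim⟩ := (isCompact_sphere (0 : Plane) 1).ultrafilter_le_nhds (g.map u)
    (le_principal_iff.2 hunorm)
  have hlim : Tendsto u g (𝓝 v) := hlim
  have hact : Tendsto (fun k => A.act (ε • u k) (a k)) g (𝓝 (A.act (ε • v) x)) :=
    (A.continuous_act.tendsto (ε • v, x)).comp ((hlim.const_smul ε).prodMk_nhds (h1.mono_left hgl))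
  have hF := A.continuous_F
  have hl : Tendsto (fun k => (inner ℝ (u k) (A.F (A.act (σ k) (a k)) -
      A.F (A.act (ε • u k) (a k))) : ℝ)) g (𝓝 (inner ℝ v (A.F x - A.F (A.act (ε • v) x)))) :=
    hlim.inner (((hF.tendsto x).comp (h2.mono_left hgl)).sub ((hF.tendsto _).comp hact))
  have hge : ∀ᶠ k in g, (0 : ℝ) ≤ inner ℝ (u k) (A.F (A.act (σ k) (a k)) -
      A.F (A.act (ε • u k) (a k))) := by
    filter_upwards [hσ, hgl ha] with k hk hak
    have hpos : 0 < ‖σ k‖ := hε.trans_le hk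
    have hs : σ k = ‖σ k‖ • u k := by
      simp only [hu]
      rw [smul_smul, mul_inv_cancel₀ hpos.ne', one_smul]
    rcases hk.eq_or_lt with heq | hlt
    · rw [← heq] at hs
      rw [← hs, sub_self, inner_zero_right]
    · have h3 := inner_nonneg hak (σ k) (ε • u k)
      rw [show σ k - ε • u k = (‖σ k‖ - ε) • u k by rw [sub_smul, ← hs], real_inner_smul_left] at h3
      exact nonneg_of_mul_nonneg_right h3 (sub_pos.2 hlt)
  have h4 := ge_of_tendsto hl hge
  have hv1 : ‖v‖ = 1 := mem_sphere_zero_iff_norm.1 hv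
  have hne : A.act (ε • v) x ≠ x := fun h => by
    have := hf _ h
    rw [smul_eq_zero, or_iff_right hε.ne'] at this
    rw [this, norm_zero] at hv1
    exact zero_ne_one hv1
  have h5 := A.mono hx _ hne
  rw [real_inner_smul_left, ← neg_sub, inner_neg_right] at h5
  nlinarith

/-- Near some point of an edge there is a function which is invariant under the stabilizer of the
edge and injective on the edge. -/
theorem IsLeaf.exists_first_integral (hL : A.IsLeaf L) (hc : c ∈ A.frame L)
    (hn : A.IsNormal L c n) : ∃ (U : Set M) (g : M → ℝ) (q : M) (t : ℝ), IsOpen U ∧ ContinuousOn g U ∧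
      (∀ x ∈ A.dom, ∀ β : ℝ, (∀ r ∈ Icc (0 : ℝ) 1, A.act (r • β • n) x ∈ U) →
        g (A.act (β • n) x) = g x) ∧ q ∈ c ∧ 0 < t ∧
      (∀ s : ℝ, |s| ≤ t → A.act (s • rot n) q ∈ U) ∧ g (A.act (t • rot n) q) ≠ g q ∧
      g (A.act (-t • rot n) q) ≠ g q := by
  obtain ⟨q₀, hq₀⟩ := hc.1.nonempty
  have he := hn.edgeAt hc.1 hq₀
  obtain ⟨p, hpd, hpf, hpcl, -, -, -, -, -, ht⟩ := he.exists_endpoint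
  have hpL : p ∈ closure L :=
    closure_minimal (hL.orbit_subset_closure (hc.2 hq₀)) isClosed_closure hpcl
  obtain ⟨d, U, y, wt, hU, hpU, hyc, hyi, hyp, hy⟩ := A.chart hpd hpf
  -- A contracted coordinate at the end of the edge has weight parallel to the edge. It is therefore
  -- invariant under the stabilizer, and strictly monotone in absolute value along the edge.
  obtain ⟨q, hq, -, hqU, ⟨i, hi, a, ha, hwi⟩, -, -⟩ := he.exists_contracted hU hpU hyc hyi hyp hy
    univ_mem hpf (hL.tendsto_act (hc.2 hq₀) hpL ht)
  have hqe := he.of_mem_orbit hq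
  have hcont : ContinuousAt (fun s : ℝ => A.act (s • rot n) q) 0 :=
    ((continuous_act_left q).comp (by fun_prop : Continuous fun s : ℝ => s • rot n)).continuousAt
  have hev := hcont.preimage_mem_nhds (t := U) (hU.mem_nhds (by simpa [A.act_zero hqe.mem] using hqU))
  obtain ⟨δ, hδ, hball⟩ := Metric.mem_nhds_iff.1 hev
  have hstay : ∀ s : ℝ, |s| ≤ δ / 2 → A.act (s • rot n) q ∈ U := fun s hs => hball (by
    rw [mem_ball_zero_iff, Real.norm_eq_abs]; linarith)
  have hval : ∀ s : ℝ, s ≠ 0 → |s| ≤ δ / 2 → y (A.act (s • rot n) q) i ≠ y q i := fun s hs0 hs => by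
    rw [hy q hqe.mem (s • rot n) (fun r hr => by
      rw [smul_smul]
      refine hstay _ ?_
      rw [abs_mul, abs_of_nonneg hr.1]
      exact (mul_le_of_le_one_left (abs_nonneg _) hr.2).trans hs) i, hwi]
    intro h
    have h1 := Real.exp_eq_one_iff _ |>.1 (mul_right_cancel₀ hi (h.trans (one_mul _).symm))
    rw [real_inner_smul_left, real_inner_smul_right, inner_rot_rot, inner_self_eq_one he.norm,
      mul_one] at h1
    rcases mul_eq_zero.1 h1 with h2 | h2
    · linarith
    · exact hs0 h2
  refine ⟨U, fun z => y z i, q, δ / 2, hU, (continuous_apply i).comp_continuousOn hyc,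
    fun x hx β hst => ?_, hc.1.eq_orbit hq₀ ▸ hq, by linarith, hstay,
    hval _ (by linarith) (abs_of_pos (by linarith)).le,
    hval _ (by linarith) (by rw [abs_neg]; exact (abs_of_pos (by linarith)).le)⟩
  simp only
  rw [hy x hx _ hst i, hwi, real_inner_smul_left, real_inner_smul_right, inner_rot_self', mul_zero,
    mul_zero, Real.exp_zero, one_mul]

end PlaneAction

/-! ### Crossing a common edge inside a nearby leaf. -/

namespace PlaneAction

variable {M : Type*} [TopologicalSpace M] [T2Space M] [CompactSpace M]

variable {A : PlaneAction M} {c c' : Set M} {n m : Plane} {q x : M}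

namespace Degeneration

variable {f : Set (Set M)} {Λ : ℕ → Set M} {ι : Type*} [Finite ι] {L : ι → Set M}
  (D : A.Degeneration f Λ L) {i j k : ι}

include D

theorem isClosed_iUnion : IsClosed (⋃ i, closure (L i)) :=
  isClosed_iUnion_of_finite fun _ => isClosed_closure

theorem image_eq (m : ℕ) : A.F '' Λ m = A.F '' Λ 0 := by
  rw [← (D.leaf m).interior_closure, D.closure_image_eq, (D.leaf 0).interior_closure]

theorem mem_iUnion_of_tendsto {l : Filter ℕ} [l.NeBot] (hl : l ≤ atTop) {u : ℕ → M}
    (hu : ∀ᶠ m in l, u m ∈ closure (Λ m)) {y : M} (h : Tendsto u l (𝓝 y)) :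
    y ∈ ⋃ i, closure (L i) := by
  by_contra hnot
  obtain ⟨U, V, hU, hV, hKU, hyV, hUV⟩ : SeparatedNhds (⋃ i, closure (L i)) {y} :=
    SeparatedNhds.of_isCompact_isCompact D.isClosed_iUnion.isCompact isCompact_singleton
      (disjoint_singleton_right.2 hnot)
  obtain ⟨m, ⟨h1, h2⟩, h3⟩ := ((hu.and (hl (D.upper U hU hKU))).and
    (h.eventually (hV.mem_nhds (hyV rfl)))).exists
  exact disjoint_left.1 hUV (h2 h1) h3

/-- Limit points lie in the union of the closures, where F is injective, so convergence can be
checked after projection. -/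
theorem tendsto_of_tendsto_F {l : Filter ℕ} (hl : l ≤ atTop) {u : ℕ → M}
    (hu : ∀ᶠ m in l, u m ∈ closure (Λ m)) {y : M} (hy : y ∈ ⋃ i, closure (L i))
    (h : Tendsto (fun m => A.F (u m)) l (𝓝 (A.F y))) : Tendsto u l (𝓝 y) := by
  refine tendsto_iff_ultrafilter _ _ _ |>.2 fun g hg => ?_
  obtain ⟨z, -, hz⟩ := (isCompact_univ (X := M)).ultrafilter_le_nhds (g.map u) (by simp)
  have hz : Tendsto u g (𝓝 z) := hz
  have h1 := D.mem_iUnion_of_tendsto (hg.trans hl) (hg hu) hz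
  have h2 := tendsto_nhds_unique ((A.continuous_F.tendsto z).comp hz) (h.mono_left hg)
  rwa [← D.injOn_F h1 hy h2]

theorem mem_of_F_mem {y : M} (hy : y ∈ ⋃ i, closure (L i)) (h : A.F y ∈ A.F '' L j) :
    y ∈ L j := by
  obtain ⟨z, hz, hzF⟩ := h
  have := D.injOn_F (mem_iUnion.2 ⟨j, subset_closure hz⟩) hy hzF
  rwa [← this]

theorem exists_ball_of_nhds {y : M} (hy : y ∈ ⋃ i, closure (L i)) {V : Set M} (hV : V ∈ 𝓝 y) :
    ∃ ρ > 0, ∀ z ∈ ⋃ i, closure (L i), A.F z ∈ Metric.ball (A.F y) ρ → z ∈ V := by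
  have hcomp : IsCompact ((⋃ i, closure (L i)) \ interior V) :=
    D.isClosed_iUnion.isCompact.diff isOpen_interior
  have hnot : A.F y ∈ (A.F '' ((⋃ i, closure (L i)) \ interior V))ᶜ := by
    rintro ⟨z, hz, hzF⟩
    exact hz.2 (D.injOn_F hz.1 hy hzF ▸ mem_interior_iff_mem_nhds.2 hV)
  obtain ⟨ρ, hρ, hball⟩ := Metric.isOpen_iff.1 (hcomp.image A.continuous_F).isClosed.isOpen_compl
    _ hnot
  refine ⟨ρ, hρ, fun z hz hzF => ?_⟩
  by_contra hzV
  exact hball hzF ⟨z, ⟨hz, fun h => hzV (interior_subset h)⟩, rfl⟩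

/-- Near a point of a common edge of two leaves, the images of the two leaves fill the two sides. -/
theorem eventually_mem_of_wall (hij : i ≠ j) (hc : c ∈ A.frame (L i)) (hc' : c ∈ A.frame (L j))
    (hn : A.IsNormal (L i) c n) (hq : q ∈ c) : ∀ᶠ z in 𝓝 (A.F q), z ∈ A.F '' Λ 0 ∧
      ((inner ℝ n z : ℝ) < inner ℝ n (A.F q) → z ∈ A.F '' L i) ∧
      ((inner ℝ n (A.F q) : ℝ) < inner ℝ n z → z ∈ A.F '' L j) := by
  obtain ⟨m, hm⟩ := (D.limit_leaf j).exists_isNormal hc'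
  have hmn := D.eq_neg_of_ne hij hc hc' hn hm
  have hboth : ∀ᶠ z in 𝓝 (A.F q), ((inner ℝ n z : ℝ) < inner ℝ n (A.F q) → z ∈ A.F '' L i) ∧
      ((inner ℝ n (A.F q) : ℝ) < inner ℝ n z → z ∈ A.F '' L j) := by
    filter_upwards [hn.eventually_mem (D.limit_leaf i) hc hq,
      hm.eventually_mem (D.limit_leaf j) hc' hq] with z h1 h2
    refine ⟨h1, fun h => h2 ?_⟩
    rw [hmn, inner_neg_left, inner_neg_left]
    linarith
  obtain ⟨ε, hε, hseg⟩ := (hn.edgeAt hc.1 hq).exists_segment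
  have hcont : ContinuousAt (fun z : Plane => |(inner ℝ (rot n) (z - A.F q) : ℝ)|) (A.F q) := by
    fun_prop
  have hsm := hcont.eventually (gt_mem_nhds (show |(inner ℝ (rot n) (A.F q - A.F q) : ℝ)| < ε by
    simpa using hε))
  have hQ : ∀ᶠ z in 𝓝 (A.F q), z ∈ closure (A.F '' Λ 0) := by
    filter_upwards [hboth, hsm] with z hz hzε
    rcases lt_trichotomy (inner ℝ n z : ℝ) (inner ℝ n (A.F q)) with h | h | h
    · exact subset_closure (D.image_subset i (hz.1 h))
    · have h1 := eq_smul_rot_of_inner_eq_zero hn.norm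
        (show (inner ℝ n (z - A.F q) : ℝ) = 0 by rw [inner_sub_right, h, sub_self])
      have h2 : z = A.F q + (inner ℝ (rot n) (z - A.F q) : ℝ) • rot n := by
        rw [← h1, add_sub_cancel]
      refine D.closure_image_subset i ?_
      rw [← (D.limit_leaf i).image_closure, h2]
      exact image_mono hc.2 (hc.1.eq_orbit hq ▸ hseg _ hzε)
    · exact subset_closure (D.image_subset j (hz.2 h))
  have hP : ∀ᶠ z in 𝓝 (A.F q), z ∈ A.F '' Λ 0 := by
    filter_upwards [eventually_eventually_nhds.2 hQ] with z hz
    rw [← (D.leaf 0).interior_closure]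
    exact mem_interior_iff_mem_nhds.2 hz
  exact hP.and hboth

/-- Close to the limit, the flow in the direction of the normal of a common edge of two limit leaves
leads from the first leaf to the second one. -/
theorem exists_crossing (g : Ultrafilter ℕ) (hg : ↑g ≤ (atTop : Filter ℕ)) (hij : i ≠ j)
    (hc : c ∈ A.frame (L i)) (hc' : c ∈ A.frame (L j)) (hn : A.IsNormal (L i) c n) :
    ∃ (x : ℕ → M) (β : ℕ → ℝ), ∃ x₀ ∈ L i, ∃ e ∈ L j, (∀ m, x m ∈ Λ m) ∧ Tendsto x g (𝓝 x₀) ∧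
      (∀ᶠ m in g, 0 ≤ β m) ∧ Tendsto (fun m => A.act (β m • n) (x m)) g (𝓝 e) := by
  -- The trajectory of n is followed through a thin box about a segment of the edge. The height
  -- along n does not decrease, so it cannot leave backwards; the first integral, which separates
  -- the two ends of the segment from its middle, excludes the lateral faces. It leaves through the
  -- far face, in the tile of j.
  obtain ⟨U, φ, q, t, hU, hφc, hφ, hq, ht, hst, hne₁, hne₂⟩ :=
    (D.limit_leaf i).exists_first_integral hc hn
  have he := hn.edgeAt hc.1 hq
  have hcK : ∀ y ∈ c, y ∈ ⋃ i, closure (L i) := fun y hy => mem_iUnion.2 ⟨i, hc.2 hy⟩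
  have hact : ∀ s : ℝ, A.act (s • rot n) q ∈ c := fun s => hc.1.eq_orbit hq ▸ ⟨_, rfl⟩
  set ht' : ℝ → ℝ := fun s => inner ℝ (rot n) (A.F (A.act (s • rot n) q)) with hht
  have hmono : StrictMono ht' := he.strictMono
  have hFact : ∀ s : ℝ, A.F (A.act (s • rot n) q) = A.F q + (ht' s - ht' 0) • rot n := fun s => by
    rw [he.F_act_eq s, hht]
    simp only [zero_smul, A.act_zero he.mem]
  set a := ht' 0 - ht' (-t) with hadef
  set b := ht' t - ht' 0 with hbdef
  have ha : 0 < a := sub_pos.2 (hmono (by linarith))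
  have hb : 0 < b := sub_pos.2 (hmono ht)
  -- the side of the box is covered by points of the edge in `U`
  set S : Set Plane := (fun s : ℝ => A.F q + s • rot n) '' Icc (-a) b with hSdef
  have hScomp : IsCompact S := isCompact_Icc.image (by fun_prop)
  have hScov : ∀ z ∈ S, ∃ y ∈ c, y ∈ U ∧ A.F y = z := by
    rintro _ ⟨s, hs, rfl⟩
    obtain ⟨r, hr, hrs⟩ := intermediate_value_Icc (show -t ≤ t by linarith)
      he.continuous_height.continuousOn (show ht' 0 + s ∈ Icc (ht' (-t)) (ht' t) from
        ⟨by linarith [hs.1], by linarith [hs.2]⟩)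
    refine ⟨_, hact r, hst r (abs_le.2 hr), ?_⟩
    have hrs : ht' r = ht' 0 + s := hrs
    simp only
    rw [hFact, hrs, add_sub_cancel_left]
  set G : Set Plane := {z | z ∈ A.F '' Λ 0 ∧
      ((inner ℝ n z : ℝ) < inner ℝ n (A.F q) → z ∈ A.F '' L i) ∧
      ((inner ℝ n (A.F q) : ℝ) < inner ℝ n z → z ∈ A.F '' L j)} with hG
  have hcomp : IsCompact ((⋃ i, closure (L i)) \ U) := D.isClosed_iUnion.isCompact.diff hU
  have hSO : S ⊆ interior G ∩ (A.F '' ((⋃ i, closure (L i)) \ U))ᶜ := by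
    intro z hz
    obtain ⟨y, hy, hyU, rfl⟩ := hScov z hz
    have hyq : (inner ℝ n (A.F y) : ℝ) = inner ℝ n (A.F q) :=
      he.inner_F_of_mem (hc.1.eq_orbit hq ▸ hy)
    refine ⟨?_, ?_⟩
    · have := D.eventually_mem_of_wall hij hc hc' hn hy
      rw [hyq] at this
      exact mem_interior_iff_mem_nhds.2 this
    · rintro ⟨y', hy', hyF⟩
      exact hy'.2 (D.injOn_F hy'.1 (hcK y hy) hyF ▸ hyU)
  obtain ⟨δ₀, hδ₀, hthick⟩ := hScomp.exists_cthickening_subset_open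
    (isOpen_interior.inter (hcomp.image A.continuous_F).isClosed.isOpen_compl) hSO
  -- separation of the values of the first integral
  have hsep : ∀ s : ℝ, |s| ≤ t → φ (A.act (s • rot n) q) ≠ φ q → ∃ ρ > 0,
      ∀ z ∈ ⋃ i, closure (L i), ∀ x ∈ ⋃ i, closure (L i),
        A.F z ∈ Metric.ball (A.F (A.act (s • rot n) q)) ρ → A.F x ∈ Metric.ball (A.F q) ρ →
        φ z ≠ φ x := by
    intro s hs hne
    obtain ⟨O, O', hO, hO', h1, h2, hdisj⟩ := t2_separation hne
    have hqU : q ∈ U := by simpa [A.act_zero he.mem] using hst 0 (by simpa using ht.le)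
    obtain ⟨ρ, hρ, hz⟩ := D.exists_ball_of_nhds (hcK _ (hact s))
      ((hφc.continuousAt (hU.mem_nhds (hst s hs))).preimage_mem_nhds (hO.mem_nhds h1))
    obtain ⟨ρ', hρ', hx⟩ := D.exists_ball_of_nhds (hcK _ hq)
      ((hφc.continuousAt (hU.mem_nhds hqU)).preimage_mem_nhds (hO'.mem_nhds h2))
    refine ⟨min ρ ρ', lt_min hρ hρ', fun z hzK x hxK hzF hxF heq => ?_⟩
    have h3 := hz z hzK (Metric.ball_subset_ball (min_le_left _ _) hzF)
    have h4 := hx x hxK (Metric.ball_subset_ball (min_le_right _ _) hxF)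
    exact disjoint_left.1 hdisj h3 (show φ z ∈ O' from heq ▸ h4)
  obtain ⟨ρ₁, hρ₁, hsep₁⟩ := hsep t (abs_of_pos ht).le hne₁
  obtain ⟨ρ₂, hρ₂, hsep₂⟩ := hsep (-t) (by rw [abs_neg]; exact (abs_of_pos ht).le) hne₂
  obtain ⟨δ, hδ, hδ₁, hδ₂, hδ₃⟩ : ∃ δ > 0, δ < ρ₁ ∧ δ < ρ₂ ∧ δ < δ₀ := by
    refine ⟨min (min ρ₁ ρ₂) δ₀ / 2, by positivity, ?_, ?_, ?_⟩
    · linarith [min_le_left (min ρ₁ ρ₂) δ₀, min_le_left ρ₁ ρ₂, lt_min (lt_min hρ₁ hρ₂) hδ₀]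
    · linarith [min_le_left (min ρ₁ ρ₂) δ₀, min_le_right ρ₁ ρ₂, lt_min (lt_min hρ₁ hρ₂) hδ₀]
    · linarith [min_le_right (min ρ₁ ρ₂) δ₀, lt_min (lt_min hρ₁ hρ₂) hδ₀]
  -- the box
  set X : Plane → ℝ := fun z => inner ℝ n (z - A.F q) with hX
  set Y : Plane → ℝ := fun z => inner ℝ (rot n) (z - A.F q) with hY
  have hXc : Continuous X := by simp only [hX]; fun_prop
  have hYc : Continuous Y := by simp only [hY]; fun_prop
  have hdec : ∀ z, z = A.F q + Y z • rot n + X z • n := fun z => by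
    have := plane_decomp hn.norm (z - A.F q)
    rw [add_assoc, add_comm (Y z • rot n), ← this, add_sub_cancel]
  set O : Set Plane := {z | -δ < X z ∧ X z < δ ∧ -a < Y z ∧ Y z < b} with hO
  set C : Set Plane := {z | -δ ≤ X z ∧ X z ≤ δ ∧ -a ≤ Y z ∧ Y z ≤ b} with hC
  have hOo : IsOpen O := (isOpen_lt continuous_const hXc).inter ((isOpen_lt hXc continuous_const).inter
    ((isOpen_lt continuous_const hYc).inter (isOpen_lt hYc continuous_const)))
  have hCc : IsClosed C := (isClosed_le continuous_const hXc).inter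
    ((isClosed_le hXc continuous_const).inter
    ((isClosed_le continuous_const hYc).inter (isClosed_le hYc continuous_const)))
  have hOC : closure O ⊆ C := closure_minimal
    (fun z hz => ⟨hz.1.le, hz.2.1.le, hz.2.2.1.le, hz.2.2.2.le⟩) hCc
  have hCt : C ⊆ interior G ∩ (A.F '' ((⋃ i, closure (L i)) \ U))ᶜ := fun z hz => hthick <| by
    refine Metric.mem_cthickening_of_dist_le z (A.F q + Y z • rot n) δ₀ S
      ⟨_, ⟨hz.2.2.1, hz.2.2.2⟩, rfl⟩ ?_
    rw [dist_eq_norm]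
    nth_rewrite 1 [hdec z]
    rw [add_sub_cancel_left, norm_smul, hn.norm, mul_one, Real.norm_eq_abs]
    exact (abs_le.2 ⟨hz.1, hz.2.1⟩).trans hδ₃.le
  have hXn : ∀ r : ℝ, X (A.F q + r • n) = r := fun r => by
    simp only [hX]
    rw [add_sub_cancel_left, real_inner_smul_right, inner_self_eq_one hn.norm, mul_one]
  have hYn : ∀ r : ℝ, Y (A.F q + r • n) = 0 := fun r => by
    simp only [hY]
    rw [add_sub_cancel_left, real_inner_smul_right, inner_rot_self', mul_zero]
  -- the starting points
  set z₀ : Plane := A.F q + (-(δ / 2)) • n with hz₀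
  have hz₀O : z₀ ∈ O := by
    refine ⟨?_, ?_, ?_, ?_⟩
    · rw [hXn]; linarith
    · rw [hXn]; linarith
    · rw [hYn]; linarith
    · rw [hYn]; linarith
  have hXlt : ∀ z, X z < 0 ↔ (inner ℝ n z : ℝ) < inner ℝ n (A.F q) := fun z => by
    simp only [hX]; rw [inner_sub_right, sub_neg]
  have hXgt : ∀ z, 0 < X z ↔ (inner ℝ n (A.F q) : ℝ) < inner ℝ n z := fun z => by
    simp only [hX]; rw [inner_sub_right, sub_pos]
  have hz₀i : z₀ ∈ A.F '' L i := by
    refine (interior_subset (hCt (hOC (subset_closure hz₀O))).1).2.1 ((hXlt _).1 ?_)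
    rw [hXn]; linarith
  have hex : ∀ m, ∃ x ∈ Λ m, A.F x = z₀ := fun m => by
    have := D.image_subset i hz₀i
    rwa [← D.image_eq m] at this
  choose x hx hxF using hex
  obtain ⟨x₀, hx₀, hx₀F⟩ := hz₀i
  have hx₀K : x₀ ∈ ⋃ i, closure (L i) := mem_iUnion.2 ⟨i, subset_closure hx₀⟩
  have hxlim : Tendsto x g (𝓝 x₀) := D.tendsto_of_tendsto_F hg
    (Eventually.of_forall fun m => subset_closure (hx m)) hx₀K
    (by simp only [hxF, hx₀F]; exact tendsto_const_nhds)
  -- exit times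
  have hexit : ∀ m, ∃ β : ℝ, 0 < β ∧ A.F (A.act (β • n) (x m)) ∉ O ∧
      ∀ s : ℝ, 0 ≤ s → s ≤ β → A.F (A.act (s • n) (x m)) ∈ C := fun m => by
    have hxd := (D.leaf m).subset_dom (hx m)
    have hγ : Continuous fun s : ℝ => A.F (A.act (s • n) (x m)) :=
      A.continuous_F.comp ((continuous_act_left (x m)).comp (by fun_prop))
    -- A trajectory staying in the box would accumulate at a point fixed by n, but the box lies in
    -- the open image, over which the closure of Λ m has only free points.
    have hleave : ∃ T : ℝ, 0 ≤ T ∧ A.F (A.act (T • n) (x m)) ∉ O := by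
      by_contra! hcon
      obtain ⟨p, hp, hpn⟩ := exists_mapClusterPt hxd n
      have h1 : A.F p ∈ C := by
        have := (hp.continuousAt_comp (A.continuous_F.continuousAt)).mem_closure_of_mem (s := O)
          (mem_map.2 ((eventually_ge_atTop (0 : ℝ)).mono fun T hT => hcon T hT))
        exact hOC this
      have h2 : p ∈ closure (Λ m) := hp.mem_closure_of_mem (s := Λ m)
        (mem_map.2 (univ_mem' fun T => (D.leaf m).act_mem (hx m) _))
      refine (D.leaf m).F_notMem h2 (fun hf => hn.ne_zero (hf n hpn)) ?_
      rw [D.image_eq m]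
      exact (interior_subset (hCt h1).1).1
    obtain ⟨T, hT, hTO⟩ := hleave
    obtain ⟨β, hβ, hβO, -, hβC⟩ := exists_first_exit hOo hγ
      (by simp only [zero_smul, A.act_zero hxd, hxF]; exact hz₀O) hT hTO
    exact ⟨β, hβ, hβO, fun s hs hs' => hOC (hβC s hs hs')⟩
  choose β hβ hβO hβC using hexit
  obtain ⟨e, -, hlim⟩ := (isCompact_univ (X := M)).ultrafilter_le_nhds
    (g.map fun m => A.act (β m • n) (x m)) (by simp)
  have hlim : Tendsto (fun m => A.act (β m • n) (x m)) g (𝓝 e) := hlim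
  have heΛ : ∀ m, A.act (β m • n) (x m) ∈ Λ m := fun m => (D.leaf m).act_mem (hx m) _
  have heK : e ∈ ⋃ i, closure (L i) := D.mem_iUnion_of_tendsto hg
    (Eventually.of_forall fun m => subset_closure (heΛ m)) hlim
  have hFlim := (A.continuous_F.tendsto e).comp hlim
  have heC : A.F e ∈ C := hCc.mem_of_tendsto hFlim
    (Eventually.of_forall fun m => hβC m _ (hβ m).le le_rfl)
  have heO : A.F e ∉ O := fun h => by
    obtain ⟨m, hm⟩ := (hFlim.eventually (hOo.mem_nhds h)).exists
    exact hβO m hm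
  have heX : -(δ / 2) ≤ X (A.F e) := by
    refine ge_of_tendsto ((hXc.tendsto _).comp hFlim) (Eventually.of_forall fun m => ?_)
    have hxd := (D.leaf m).subset_dom (hx m)
    have h1 := inner_nonneg hxd (β m • n) 0
    rw [sub_zero, real_inner_smul_left, A.act_zero hxd, hxF] at h1
    have h2 := nonneg_of_mul_nonneg_right h1 (hβ m)
    have h3 : X z₀ = -(δ / 2) := hXn _
    simp only [hX, comp_apply, inner_sub_right] at h2 h3 ⊢
    linarith
  have hKU : ∀ y ∈ ⋃ i, closure (L i), A.F y ∈ C → y ∈ U := fun y hy hyC => by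
    by_contra hyU
    exact (hCt hyC).2 ⟨y, ⟨hy, hyU⟩, rfl⟩
  -- Over the box the limit lies in U, so Λ m eventually does as well, and the first integral is
  -- constant along the trajectory.
  have hev : ∀ᶠ m in g, closure (Λ m) ⊆ U ∪ A.F ⁻¹' Cᶜ :=
    hg (D.upper _ (hU.union (hCc.isOpen_compl.preimage A.continuous_F)) fun y hy => by
      by_cases hyC : A.F y ∈ C
      · exact .inl (hKU y hy hyC)
      · exact .inr hyC)
  have hφeq : φ e = φ x₀ := by
    have h1 : Tendsto (fun m => φ (A.act (β m • n) (x m))) g (𝓝 (φ e)) :=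
      (hφc.continuousAt (hU.mem_nhds (hKU e heK heC))).tendsto.comp hlim
    have h2 : Tendsto (fun m => φ (x m)) g (𝓝 (φ x₀)) :=
      (hφc.continuousAt (hU.mem_nhds (hKU x₀ hx₀K (hx₀F ▸ hOC (subset_closure hz₀O))))).tendsto.comp
        hxlim
    refine tendsto_nhds_unique h1 (h2.congr' ?_)
    filter_upwards [hev] with m hm
    refine (hφ _ ((D.leaf m).subset_dom (hx m)) _ fun r hr => ?_).symm
    rw [smul_smul]
    refine (hm (subset_closure ((D.leaf m).act_mem (hx m) _))).resolve_right fun h => h ?_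
    exact hβC m _ (mul_nonneg hr.1 (hβ m).le) (mul_le_of_le_one_left (hβ m).le hr.2)
  refine ⟨x, β, x₀, hx₀, e, D.mem_of_F_mem heK ?_, hx, hxlim,
    Eventually.of_forall fun m => (hβ m).le, hlim⟩
  -- If e is not on the far face, it is on a lateral face, so F e is within δ of an end of the
  -- segment. There the first integral differs from its value at x₀.
  rcases heC.2.1.lt_or_eq with hlt | heq
  · exfalso
    have hx₀ball : ∀ ρ, δ < ρ → A.F x₀ ∈ Metric.ball (A.F q) ρ := fun ρ hρ => by
      rw [hx₀F, mem_ball_iff_norm, add_sub_cancel_left, norm_smul, hn.norm, mul_one, norm_neg,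
        Real.norm_of_nonneg (by linarith)]
      linarith
    have hball : ∀ s ρ, ht' s - ht' 0 = Y (A.F e) → δ < ρ →
        A.F e ∈ Metric.ball (A.F (A.act (s • rot n) q)) ρ := fun s ρ hs hρ => by
      rw [mem_ball_iff_norm, hFact, hs]
      nth_rewrite 1 [hdec (A.F e)]
      rw [add_sub_cancel_left, norm_smul, hn.norm, mul_one, Real.norm_eq_abs]
      exact (abs_le.2 ⟨heC.1, heC.2.1⟩).trans_lt hρ
    have hnot : ¬ (-a < Y (A.F e) ∧ Y (A.F e) < b) := fun h =>
      heO ⟨by linarith, hlt, h.1, h.2⟩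
    rcases heC.2.2.2.lt_or_eq with hlt' | heq'
    · rcases heC.2.2.1.lt_or_eq with hlt'' | heq''
      · exact hnot ⟨hlt'', hlt'⟩
      · exact hsep₂ e heK x₀ hx₀K (hball (-t) ρ₂ (by rw [← heq'', hadef]; ring) hδ₂)
          (hx₀ball _ hδ₂) hφeq
    · exact hsep₁ e heK x₀ hx₀K (hball t ρ₁ (by rw [heq']) hδ₁) (hx₀ball _ hδ₁) hφeq
  · refine (interior_subset (hCt heC).1).2.2 ((hXgt _).1 ?_)
    rw [heq]; exact hδ

end Degeneration

end PlaneAction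

/-! ### Placing the vertices of the web. -/

/-- If some linear functionals converge along a sequence of vectors and others tend to infinity,
then the first ones vanish and the others are positive at a suitable vector. -/
theorem exists_eq_zero_and_pos {V W : Type*} [NormedAddCommGroup V] [NormedSpace ℝ V]
    [FiniteDimensional ℝ V] [Finite W] (a b : W → V →ₗ[ℝ] ℝ) {κ : Type*} {l : Filter κ} [l.NeBot]
    (y : κ → V) (ha : ∀ w, ∃ α, Tendsto (fun m => a w (y m)) l (𝓝 α))
    (hb : ∀ w, Tendsto (fun m => b w (y m)) l atTop) : ∃ v, ∀ w, a w v = 0 ∧ 0 < b w v := by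
  cases nonempty_fintype W
  choose α hα using ha
  set T : V →ₗ[ℝ] (W → ℝ) := LinearMap.pi a with hT
  have hTy : Tendsto (fun m => T (y m)) l (𝓝 α) := tendsto_pi_nhds.2 hα
  have hα' : α ∈ LinearMap.range T :=
    (Submodule.closed_of_finiteDimensional (LinearMap.range T)).mem_of_tendsto hTy
      (Eventually.of_forall fun m => ⟨y m, rfl⟩)
  -- Subtracting the lift S(T y) kills all the functionals a. The lift converges, so the functionals
  -- b change by convergent amounts and become positive eventually.
  obtain ⟨S, hS⟩ := T.rangeRestrict.exists_rightInverse_of_surjective T.range_rangeRestrict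
  have hSc : Continuous S := S.continuous_of_finiteDimensional
  have hlim : Tendsto (fun m => S (T.rangeRestrict (y m))) l (𝓝 (S ⟨α, hα'⟩)) :=
    (hSc.tendsto _).comp (tendsto_subtype_rng.2 hTy)
  have hev : ∀ᶠ m in l, ∀ w, 0 < b w (y m - S (T.rangeRestrict (y m))) := by
    refine eventually_all.2 fun w => ?_
    have h1 : Tendsto (fun m => b w (S (T.rangeRestrict (y m)))) l (𝓝 (b w (S ⟨α, hα'⟩))) :=
      ((b w).continuous_of_finiteDimensional.tendsto _).comp hlim
    filter_upwards [((hb w).atTop_add h1.neg).eventually_gt_atTop 0] with m hm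
    rwa [map_sub, sub_eq_add_neg]
  obtain ⟨m, hm⟩ := hev.exists
  refine ⟨_, fun w => ⟨?_, hm w⟩⟩
  have h2 : T (S (T.rangeRestrict (y m))) = T (y m) := by
    have := LinearMap.congr_fun hS (T.rangeRestrict (y m))
    exact congrArg Subtype.val this
  have h3 := congrFun h2 w
  simp only [hT, LinearMap.pi_apply] at h3
  rw [map_sub, sub_eq_zero]
  exact h3.symm

/-- A transitive relation that holds locally holds globally. -/
theorem rel_of_locally {R : ℝ → ℝ → Prop} {a b : ℝ} (hab : a < b)
    (htrans : ∀ s ∈ Icc a b, ∀ t ∈ Icc a b, ∀ u ∈ Icc a b, R s t → R t u → R s u)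
    (hloc : ∀ t ∈ Icc a b, ∃ ε > 0, ∀ s ∈ Icc a b, ∀ u ∈ Icc a b, |s - t| < ε → |u - t| < ε →
      s < u → R s u) : R a b := by
  choose! ε hε h using hloc
  obtain ⟨δ, hδ, hL⟩ := lebesgue_number_lemma_of_metric (isCompact_Icc (a := a) (b := b))
    (c := fun t : Icc a b => Metric.ball (t : ℝ) (ε t)) (fun _ => Metric.isOpen_ball)
    (fun t ht => mem_iUnion.2 ⟨⟨t, ht⟩, Metric.mem_ball_self (hε t ht)⟩)
  obtain ⟨N, hN⟩ := exists_nat_gt ((b - a) / δ)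
  have hN0 : (0 : ℝ) < N := (div_pos (sub_pos.2 hab) hδ).trans hN
  set τ : ℝ := (b - a) / N with hτ
  have hτ0 : 0 < τ := div_pos (sub_pos.2 hab) hN0
  have hτδ : τ < δ := by
    rw [hτ, div_lt_iff₀ hN0]
    rwa [div_lt_iff₀ hδ, mul_comm] at hN
  have hτN : N * τ = b - a := mul_div_cancel₀ _ hN0.ne'
  have hmem : ∀ k : ℕ, k ≤ N → a + k * τ ∈ Icc a b := fun k hk => by
    have : (k : ℝ) * τ ≤ N * τ := mul_le_mul_of_nonneg_right (by exact_mod_cast hk) hτ0.le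
    have h0 : 0 ≤ (k : ℝ) * τ := by positivity
    exact ⟨by linarith, by linarith⟩
  have hstep : ∀ k : ℕ, k + 1 ≤ N → R (a + k * τ) (a + (k + 1 : ℕ) * τ) := fun k hk => by
    have h1 := hmem k (by omega)
    have h2 := hmem (k + 1) hk
    obtain ⟨t, ht⟩ := hL _ h1
    have h3 : a + k * τ ∈ Metric.ball (t : ℝ) (ε t) := ht (Metric.mem_ball_self hδ)
    have h4 : a + (k + 1 : ℕ) * τ ∈ Metric.ball (t : ℝ) (ε t) := ht (by
      rw [Metric.mem_ball, Real.dist_eq]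
      push_cast
      rw [show a + (k + 1) * τ - (a + k * τ) = τ by ring, abs_of_pos hτ0]
      exact hτδ)
    exact h t t.2 _ h1 _ h2 h3 h4 (by push_cast; linarith)
  have hind : ∀ k : ℕ, k + 1 ≤ N → R a (a + (k + 1 : ℕ) * τ) := by
    intro k
    induction k with
    | zero => intro hk; simpa using hstep 0 hk
    | succ k ih =>
      intro hk
      exact htrans a ⟨le_rfl, hab.le⟩ _ (hmem (k + 1) (by omega)) _ (hmem _ hk) (ih (by omega))
        (hstep _ hk)
  obtain ⟨k, rfl⟩ : ∃ k, N = k + 1 := Nat.exists_eq_succ_of_ne_zero (by rintro rfl; simp at hN0)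
  have := hind k le_rfl
  rwa [hτN, add_sub_cancel] at this

/-- The points off finitely many lines are dense. -/
theorem dense_inner_ne_zero {B : Set Plane} (hB : B.Finite) (h0 : ∀ a ∈ B, a ≠ 0) (z : Plane) :
    Dense {x : Plane | ∀ a ∈ B, (inner ℝ a (x - z) : ℝ) ≠ 0} := by
  have h := dense_biInter_of_isOpen (S := B) (f := fun a => {x : Plane | (inner ℝ a (x - z) : ℝ) ≠ 0})
    (fun a _ => isOpen_ne_fun (by fun_prop) continuous_const) hB.countable (fun a ha => ?_)
  · convert h using 1
    ext x
    simp
  · intro x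
    by_cases hx : (inner ℝ a (x - z) : ℝ) = 0
    · have hlim : Tendsto (fun t : ℝ => x + t • a) (𝓝[≠] 0) (𝓝 x) := by
        have : ContinuousAt (fun t : ℝ => x + t • a) 0 := by fun_prop
        have h1 := this.tendsto.mono_left (nhdsWithin_le_nhds (s := {0}ᶜ))
        simpa using h1
      refine mem_closure_of_tendsto hlim ?_
      filter_upwards [self_mem_nhdsWithin] with t ht
      have h1 : (inner ℝ a a : ℝ) ≠ 0 := (real_inner_self_pos.2 (h0 a ha)).ne'
      rw [add_sub_right_comm, inner_add_right, hx, zero_add, real_inner_smul_right]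
      exact mul_ne_zero ht h1
    · exact subset_closure hx

namespace PlaneAction

variable {M : Type*} [TopologicalSpace M] [T2Space M] [CompactSpace M]

variable {A : PlaneAction M} {c c' : Set M} {n m : Plane} {q x : M}

theorem Fixed.not_free (h : A.Fixed q) : ¬ A.Free q := fun hf => by
  have := hf !₂[1, 0] (h _)
  simpa using congrArg (fun v : Plane => v 0) this

namespace Degeneration

variable {f : Set (Set M)} {Λ : ℕ → Set M} {ι : Type*} [Finite ι] {L : ι → Set M}
  (D : A.Degeneration f Λ L) {i j k : ι}

include D

/-- Let τ lead from a to a' in the limit leaf. After x m is moved by τ, both sequences converge to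
the same free point, so the remaining time tends to 0. -/
theorem exists_tendsto_time {g : Ultrafilter ℕ} {x x' : ℕ → M} (hx : ∀ m, x m ∈ Λ m)
    (hx' : ∀ m, x' m ∈ Λ m) {a a' : M} (ha : a ∈ L i) (ha' : a' ∈ L i) (h : Tendsto x g (𝓝 a))
    (h' : Tendsto x' g (𝓝 a')) :
    ∃ (σ : ℕ → Plane) (τ : Plane), (∀ m, x' m = A.act (σ m) (x m)) ∧ Tendsto σ g (𝓝 τ) := by
  have hσ : ∀ m, ∃ σ, x' m = A.act σ (x m) := fun m => by
    have := hx' m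
    rw [(D.leaf m).eq_orbit (hx m)] at this
    obtain ⟨σ, hσ⟩ := this
    exact ⟨σ, hσ.symm⟩
  choose σ hσ using hσ
  rw [(D.limit_leaf i).eq_orbit ha] at ha'
  obtain ⟨τ, rfl⟩ := ha'
  refine ⟨σ, τ, hσ, ?_⟩
  have hd : ∀ m, x m ∈ A.dom := fun m => (D.leaf m).subset_dom (hx m)
  have h1 : Tendsto (fun m => A.act τ (x m)) g (𝓝 (A.act τ a)) :=
    ((continuous_act_right τ).tendsto a).comp h
  have had := (D.limit_leaf i).subset_dom ha
  have h2 := tendsto_time (A := A) (l := g) (σ := fun m => σ m - τ)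
    (Eventually.of_forall fun m => A.act_mem (hd m) τ) (A.act_mem had τ)
    ((free_act_iff had τ).2 ((D.limit_leaf i).free ha)) h1
    (h'.congr fun m => by rw [← A.act_add (hd m), sub_add_cancel, hσ])
  simpa using h2.add_const τ

theorem finite_iUnion_frame : (⋃ i, A.frame (L i)).Finite :=
  finite_iUnion fun i => (D.limit_leaf i).finite_frame

/-- There are points of the plane, one for each limit leaf, whose differences for adjacent leaves
are positive multiples of the normals of the common edges. -/
theorem exists_points : ∃ y : ι → Plane, ∀ i j c n, i ≠ j → c ∈ A.frame (L i) →
    c ∈ A.frame (L j) → A.IsNormal (L i) c n → ∃ r : ℝ, 0 < r ∧ y j - y i = r • n := by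
  cases nonempty_fintype ι
  set g : Ultrafilter ℕ := hyperfilter ℕ
  have hg : (g : Filter ℕ) ≤ atTop := Nat.hyperfilter_le_atTop
  set W := {w : ι × ι × Set M // w.1 ≠ w.2.1 ∧ w.2.2 ∈ A.frame (L w.1) ∧
    w.2.2 ∈ A.frame (L w.2.1)}
  have hW : Finite W := by
    refine (Set.Finite.subset (finite_univ.prod (finite_univ.prod D.finite_iUnion_frame))
      (s := univ ×ˢ univ ×ˢ ⋃ i, A.frame (L i)) ?_ : Set.Finite {w : ι × ι × Set M |
        w.1 ≠ w.2.1 ∧ w.2.2 ∈ A.frame (L w.1) ∧ w.2.2 ∈ A.frame (L w.2.1)}).to_subtype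
    rintro ⟨i, j, c⟩ ⟨-, hc, -⟩
    exact ⟨mem_univ _, mem_univ _, mem_iUnion.2 ⟨i, hc⟩⟩
  have hN : ∀ w : W, ∃ n, A.IsNormal (L w.1.1) w.1.2.2 n := fun w =>
    (D.limit_leaf _).exists_isNormal w.2.2.1
  choose N hN using hN
  -- base points
  have hbase : ∀ i, ∃ x : ℕ → M, ∃ a ∈ L i, (∀ m, x m ∈ Λ m) ∧ Tendsto x g (𝓝 a) := fun i => by
    obtain ⟨a, ha⟩ := (D.limit_leaf i).nonempty
    have hex : ∀ m, ∃ x ∈ Λ m, A.F x = A.F a := fun m => by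
      have := D.image_subset i ⟨a, ha, rfl⟩
      rwa [← D.image_eq m] at this
    choose x hx hxF using hex
    refine ⟨x, a, ha, hx, D.tendsto_of_tendsto_F hg
      (Eventually.of_forall fun m => subset_closure (hx m))
      (mem_iUnion.2 ⟨i, subset_closure ha⟩) ?_⟩
    simp only [hxF]
    exact tendsto_const_nhds
  choose x a ha hx hxlim using hbase
  choose o ho using fun m => (D.leaf m).nonempty
  have hod : ∀ m, o m ∈ A.dom := fun m => (D.leaf m).subset_dom (ho m)
  have hy : ∀ m i, ∃ y, x i m = A.act y (o m) := fun m i => by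
    have := hx i m
    rw [(D.leaf m).eq_orbit (ho m)] at this
    obtain ⟨y, hy⟩ := this
    exact ⟨y, hy.symm⟩
  choose y hy using hy
  -- The time from the base point of i to that of j is split at the crossing: two convergent times
  -- inside L i and L j, and the crossing time along the normal.
  have key : ∀ w : W, ∃ (β : ℕ → ℝ) (σ : ℕ → Plane) (τ : Plane), Tendsto β g atTop ∧
      Tendsto σ g (𝓝 τ) ∧ ∀ m, y m w.1.2.1 - y m w.1.1 = β m • N w + σ m := by
    rintro ⟨⟨i, j, c⟩, hij, hc, hc'⟩
    simp only at hij hc hc'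
    set n := N ⟨⟨i, j, c⟩, hij, hc, hc'⟩
    obtain ⟨u, β, u₀, hu₀, e, he, hu, hulim, hβ, helim⟩ := D.exists_crossing g hg hij hc hc'
      (hN ⟨⟨i, j, c⟩, hij, hc, hc'⟩)
    obtain ⟨σ, τ, hσ, hσlim⟩ := D.exists_tendsto_time (hx i) hu (ha i) hu₀ (hxlim i) hulim
    obtain ⟨σ', τ', hσ', hσlim'⟩ := D.exists_tendsto_time (hx j)
      (fun m => (D.leaf m).act_mem (hu m) (β m • n)) (ha j) he (hxlim j) helim
    refine ⟨β, fun m => σ m - σ' m, τ - τ', ?_, hσlim.sub hσlim', fun m => ?_⟩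
    -- A bounded crossing time would have a limit that leads from a point of L i to a point of L j,
    -- making these leaves equal.
    · refine tendsto_atTop.2 fun R => ?_
      by_contra hcon
      rw [← Ultrafilter.eventually_not] at hcon
      have hR : ∀ᶠ m in g, β m ∈ Icc 0 R := by
        filter_upwards [hβ, hcon] with m h1 h2 using ⟨h1, (not_le.1 h2).le⟩
      obtain ⟨β₀, -, hβ₀⟩ := isCompact_Icc.ultrafilter_le_nhds (g.map β) (le_principal_iff.2 hR)
      have hβ₀ : Tendsto β g (𝓝 β₀) := hβ₀
      have h1 : Tendsto (fun m => A.act (β m • n) (u m)) g (𝓝 (A.act (β₀ • n) u₀)) :=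
        (A.continuous_act.tendsto (β₀ • n, u₀)).comp ((hβ₀.smul_const n).prodMk_nhds hulim)
      have h2 := tendsto_nhds_unique h1 helim
      have h3 := (D.limit_leaf i).act_mem hu₀ (β₀ • n)
      rw [h2] at h3
      exact hij (D.injective ((D.limit_leaf i).eq_of_mem_of_mem (D.limit_leaf j) h3 he))
    · have h1 : A.act (β m • n + (σ m + y m i)) (o m) = A.act (σ' m + y m j) (o m) := by
        rw [A.act_add (hod m), A.act_add (hod m), A.act_add (hod m), ← hy, ← hy, ← hσ, ← hσ']
      have h2 := ((D.leaf m).free (ho m)).act_injective (hod m) h1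
      simp only
      rw [eq_sub_of_add_eq' h2.symm]
      abel
  choose β σ τ hβ hσ hyβ using key
  -- For each common edge, the component of the difference orthogonal to the normal converges and
  -- the component along the normal tends to infinity. The vector found has first component 0 and
  -- second component positive, for all edges at once.
  obtain ⟨v, hv⟩ := exists_eq_zero_and_pos (l := (g : Filter ℕ))
    (fun w : W => (innerₛₗ ℝ (rot (N w))).comp
      (LinearMap.proj (R := ℝ) (φ := fun _ : ι => Plane) w.1.2.1 - LinearMap.proj w.1.1))
    (fun w : W => (innerₛₗ ℝ (N w)).comp
      (LinearMap.proj (R := ℝ) (φ := fun _ : ι => Plane) w.1.2.1 - LinearMap.proj w.1.1)) y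
    (fun w => ⟨inner ℝ (rot (N w)) (τ w), by
      simp only [LinearMap.comp_apply, LinearMap.sub_apply, LinearMap.proj_apply, innerₛₗ_apply_apply,
        hyβ, inner_add_right, real_inner_smul_right, inner_rot_self', mul_zero, zero_add]
      exact tendsto_const_nhds.inner (hσ w)⟩)
    (fun w => by
      simp only [LinearMap.comp_apply, LinearMap.sub_apply, LinearMap.proj_apply, innerₛₗ_apply_apply,
        hyβ, inner_add_right, real_inner_smul_right, inner_self_eq_one (hN w).norm, mul_one]
      exact (hβ w).atTop_add (tendsto_const_nhds.inner (hσ w)))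
  refine ⟨v, fun i j c n hij hc hc' hn => ?_⟩
  obtain ⟨h1, h2⟩ := hv ⟨⟨i, j, c⟩, hij, hc, hc'⟩
  have hnN := hn.eq (D.limit_leaf i) hc.1 (hN ⟨⟨i, j, c⟩, hij, hc, hc'⟩)
  simp only [LinearMap.comp_apply, LinearMap.sub_apply, LinearMap.proj_apply,
    innerₛₗ_apply_apply, hnN] at h1 h2
  exact ⟨_, h2, eq_smul_of_inner_rot_eq_zero hn.norm h1⟩

end Degeneration

end PlaneAction

/-! ### Relative position of the vertices, and disjointness of the edges of the web. -/

namespace PlaneAction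

variable {M : Type*} [TopologicalSpace M] [T2Space M] [CompactSpace M]

variable {A : PlaneAction M} {c c' : Set M} {n m : Plane} {q x : M}

/-- The differences of the points for adjacent leaves are positive multiples of the normals. -/
def IsDual (A : PlaneAction M) {ι : Type*} (L : ι → Set M) (y : ι → Plane) : Prop :=
  ∀ i j c n, i ≠ j → c ∈ A.frame (L i) → c ∈ A.frame (L j) → A.IsNormal (L i) c n →
    ∃ r : ℝ, 0 < r ∧ y j - y i = r • n

/-- `y₀` lies on the edge that crosses `c` of the web with vertices `y`, in terms of the properties
which are used to see that the edges are disjoint. -/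
structure Crosses (A : PlaneAction M) {ι : Type*} (L : ι → Set M) (y : ι → Plane) (y₀ : Plane)
    (c : Set M) : Prop where
  pos : ∀ q ∈ c, ∀ l, ∀ z ∈ A.F '' L l, 0 < (inner ℝ (y l - y₀) (z - A.F q) : ℝ)
  offset : ∀ i, c ∈ A.frame (L i) → ∀ n, A.IsNormal (L i) c n → ∃ s : ℝ, y₀ = y i + s • n

namespace Degeneration

variable {f : Set (Set M)} {Λ : ℕ → Set M} {ι : Type*} [Finite ι] {L : ι → Set M}
  (D : A.Degeneration f Λ L) {i j k : ι} {y : ι → Plane}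

include D

/-- The segment from z to z' misses the critical points and is transversal to all walls. Each wall
it crosses changes y by a positive multiple of the normal pointing forward. -/
theorem inner_pos_of_generic (hy : A.IsDual L y) (hij : i ≠ j) {z z' : Plane}
    (hz : z ∈ A.F '' L i) (hz' : z' ∈ A.F '' L j)
    (hfix : ∀ p ∈ ⋃ i, closure (L i), A.Fixed p → (inner ℝ (rot (A.F p - z)) (z' - z) : ℝ) ≠ 0)
    (hnor : ∀ l, ∀ c ∈ A.frame (L l), ∀ n, A.IsNormal (L l) c n → (inner ℝ n (z' - z) : ℝ) ≠ 0) :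
    0 < (inner ℝ (y j - y i) (z' - z) : ℝ) := by
  set d := z' - z with hd
  have hP : ∀ t ∈ Icc (0 : ℝ) 1, z + t • d ∈ closure (A.F '' Λ 0) := fun t ht => by
    have := (D.leaf 0).convex_image (D.image_subset i hz) (D.image_subset j hz')
      (sub_nonneg.2 ht.2) ht.1 (by ring)
    convert subset_closure this using 1
    rw [hd]; module
  -- The relation allows points on several closed tiles: any two tiles at the two parameters either
  -- coincide or differ by a positive step. In this form it is transitive.
  have key := rel_of_locally (R := fun s u => ∀ l l', z + s • d ∈ closure (A.F '' L l) →
    z + u • d ∈ closure (A.F '' L l') → l = l' ∨ 0 < (inner ℝ (y l' - y l) d : ℝ)) one_pos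
    (fun s _ t ht u _ h1 h2 l l' hl hl' => by
      obtain ⟨l'', hl''⟩ := D.exists_mem_closure (hP t ht)
      rcases h1 l l'' hl hl'' with rfl | h3
      · exact h2 _ _ hl'' hl'
      · rcases h2 l'' l' hl'' hl' with rfl | h4
        · exact .inr h3
        · right
          rw [show y l' - y l = (y l' - y l'') + (y l'' - y l) by abel, inner_add_left]
          exact add_pos h4 h3) (fun t ht => ?_)
  · refine (key i j (subset_closure (by simpa using hz)) (subset_closure ?_)).resolve_left hij
    rwa [one_smul, hd, add_sub_cancel]
  have hcont : ContinuousAt (fun s : ℝ => z + s • d) t := by fun_prop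
  -- Near t only the tiles whose closures contain the point at t occur, so two different ones share
  -- the critical edge through that point.
  have hev : ∀ᶠ s : ℝ in 𝓝 t, ∀ l, z + s • d ∈ closure (A.F '' L l) →
      z + t • d ∈ closure (A.F '' L l) := by
    refine eventually_all.2 fun l => ?_
    by_cases hl : z + t • d ∈ closure (A.F '' L l)
    · exact Eventually.of_forall fun _ _ => hl
    · filter_upwards [hcont.preimage_mem_nhds (isClosed_closure.isOpen_compl.mem_nhds hl)]
        with s hs hs' using absurd hs' hs
  obtain ⟨ε, hε, hball⟩ := Metric.eventually_nhds_iff.1 hev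
  refine ⟨ε, hε, fun s hs u hu hst hut hsu l l' hl hl' => ?_⟩
  have hlt := hball (y := s) hst l hl
  have hlt' := hball (y := u) hut l' hl'
  by_cases hll : l = l'
  · exact .inl hll
  right
  rw [← (D.limit_leaf l).image_closure] at hlt
  rw [← (D.limit_leaf l').image_closure] at hlt'
  obtain ⟨q, hq, hqF⟩ := hlt
  obtain ⟨q', hq', hqF'⟩ := hlt'
  have hqq := D.eq_of_F_eq hq hq' (hqF.trans hqF'.symm)
  subst hqq
  have hfree : ¬ A.Free q := fun hf => hll (D.injective
    ((D.limit_leaf l).eq_of_mem_of_mem (D.limit_leaf l') ((D.limit_leaf l).mem_of_free hq hf)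
      ((D.limit_leaf l').mem_of_free hq' hf)))
  have hnfix : ¬ A.Fixed q := fun hfx => hfix q (mem_iUnion.2 ⟨l, hq⟩) hfx (by
    rw [hqF, add_sub_cancel_left, real_inner_comm]
    simp only [inner_plane, rot_zero_apply, rot_one_apply, PiLp.smul_apply, smul_eq_mul]
    ring)
  obtain ⟨m, hm⟩ := exists_edgeAt ((D.limit_leaf l).closure_subset_dom hq) hfree hnfix
  have hc := (D.limit_leaf l).orbit_mem_frame hm hq
  have hc' := (D.limit_leaf l').orbit_mem_frame hm hq'
  obtain ⟨n, hn⟩ := (D.limit_leaf l).exists_isNormal hc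
  obtain ⟨n', hn'⟩ := (D.limit_leaf l').exists_isNormal hc'
  have hnn := D.eq_neg_of_ne hll hc hc' hn hn'
  obtain ⟨r, hr, hyr⟩ := hy l l' _ n hll hc hc' hn
  rw [hyr, real_inner_smul_left]
  -- If the segment ran against n, the earlier point in l and the later one in l', behind opposite
  -- sides of the wall, would be in the wrong order.
  refine mul_pos hr (lt_of_le_of_ne ?_ (hnor l _ hc n hn).symm)
  by_contra hneg
  have h1 := hn.le_of_mem_closure hl (mem_orbit_self hm.mem)
  have h2 := hn'.le_of_mem_closure hl' (mem_orbit_self hm.mem)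
  rw [hnn, inner_neg_left, inner_neg_left] at h2
  rw [inner_add_right, real_inner_smul_right] at h1 h2
  nlinarith [mul_pos (sub_pos.2 hsu) (neg_pos.2 (not_le.1 hneg))]

/-- The points are in the same relative position as the images of the leaves. -/
theorem inner_pos (hy : A.IsDual L y) (hij : i ≠ j) {z z' : Plane} (hz : z ∈ A.F '' L i)
    (hz' : z' ∈ A.F '' L j) : 0 < (inner ℝ (y j - y i) (z' - z) : ℝ) := by
  -- These are the normals of the lines from z through images of fixed points, and the normals of
  -- all walls. An endpoint off the corresponding lines through z is generic.
  set B : Set Plane := (fun p => rot (A.F p - z)) '' {p | p ∈ ⋃ i, closure (L i) ∧ A.Fixed p} ∪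
    ⋃ l, ⋃ c ∈ A.frame (L l), {n | A.IsNormal (L l) c n} with hB
  have hBfin : B.Finite := by
    refine Finite.union (Finite.image _ ((finite_fixed (A := A)).subset ?_)) (finite_iUnion fun l =>
      (D.limit_leaf l).finite_frame.biUnion fun c hc => Set.Subsingleton.finite
        fun n hn n' hn' => hn'.eq (D.limit_leaf l) hc.1 hn)
    rintro p ⟨hp, hpf⟩
    obtain ⟨l, hl⟩ := mem_iUnion.1 hp
    exact ⟨(D.limit_leaf l).closure_subset_dom hl, hpf⟩
  have hB0 : ∀ a ∈ B, a ≠ 0 := by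
    rintro a (⟨p, ⟨hp, hpf⟩, rfl⟩ | ha)
    · intro (h0 : rot (A.F p - z) = 0)
      have h1 : A.F p - z = 0 := by
        rw [← norm_eq_zero, ← norm_rot, h0, norm_zero]
      have h2 := D.mem_of_F_mem (j := i) hp (by rwa [sub_eq_zero.1 h1])
      exact hpf.not_free ((D.limit_leaf i).free h2)
    · simp only [mem_iUnion] at ha
      obtain ⟨l, c, hc, hn⟩ := ha
      exact hn.ne_zero
  have hdense := (dense_inner_ne_zero hBfin hB0 z).open_subset_closure_inter
    (D.limit_leaf j).isOpen_image
  have hgen : ∀ x ∈ A.F '' L j ∩ {x | ∀ a ∈ B, (inner ℝ a (x - z) : ℝ) ≠ 0},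
      0 < (inner ℝ (y j - y i) (x - z) : ℝ) := by
    rintro x ⟨hx, hxB⟩
    refine D.inner_pos_of_generic hy hij hz hx (fun p hp hpf => hxB _ (.inl ⟨p, ⟨hp, hpf⟩, rfl⟩))
      fun l c hc n hn => hxB n (.inr ?_)
    simp only [mem_iUnion]
    exact ⟨l, c, hc, hn⟩
  have hne : y j - y i ≠ 0 := by
    obtain ⟨x, hx⟩ := closure_nonempty_iff.1 ⟨z', hdense hz'⟩
    intro h0
    have := hgen x hx
    rw [h0, inner_zero_left] at this
    exact lt_irrefl _ this
  have hge : ∀ x ∈ A.F '' L j, 0 ≤ (inner ℝ (y j - y i) (x - z) : ℝ) := fun x hx =>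
    closure_minimal (t := {x | 0 ≤ (inner ℝ (y j - y i) (x - z) : ℝ)}) (fun x hx => (hgen x hx).le)
      (isClosed_le continuous_const (by fun_prop)) (hdense hx)
  -- The weak inequality holds on an open set; moving z' slightly against y j - y i makes it strict.
  have hcont : ContinuousAt (fun s : ℝ => z' + s • (y j - y i)) 0 := by fun_prop
  have hev : ∀ᶠ s : ℝ in 𝓝[<] 0, z' + s • (y j - y i) ∈ A.F '' L j :=
    (hcont.tendsto.mono_left nhdsWithin_le_nhds).eventually
      ((D.limit_leaf j).isOpen_image.mem_nhds (by simpa using hz'))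
  obtain ⟨s, hs, hs0⟩ := (hev.and self_mem_nhdsWithin).exists
  have h1 := hge _ hs
  rw [add_sub_right_comm, inner_add_right, real_inner_smul_right] at h1
  have h2 : s * (inner ℝ (y j - y i) (y j - y i) : ℝ) < 0 :=
    mul_neg_of_neg_of_pos hs0 (real_inner_self_pos.2 hne)
  linarith

theorem ne_of_ne (hy : A.IsDual L y) (hij : i ≠ j) : y i ≠ y j := fun heq => by
  obtain ⟨z, hz⟩ := (D.limit_leaf i).nonempty.image A.F
  obtain ⟨z', hz'⟩ := (D.limit_leaf j).nonempty.image A.F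
  have := D.inner_pos hy hij hz hz'
  rw [heq, sub_self, inner_zero_left] at this
  exact lt_irrefl _ this

theorem inner_pos_of_mem_closure (hy : A.IsDual L y) (hij : i ≠ j) {z z' : Plane}
    (hz : z ∈ closure (A.F '' L i)) (hz' : z' ∈ A.F '' L j) :
    0 < (inner ℝ (y j - y i) (z' - z) : ℝ) := by
  have hge : ∀ x ∈ A.F '' L j, 0 ≤ (inner ℝ (y j - y i) (x - z) : ℝ) := fun x hx =>
    closure_minimal (t := {z | 0 ≤ (inner ℝ (y j - y i) (x - z) : ℝ)})
      (fun z hz => (D.inner_pos hy hij hz hx).le) (isClosed_le continuous_const (by fun_prop)) hz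
  have hne : y j - y i ≠ 0 := sub_ne_zero.2 (D.ne_of_ne hy hij).symm
  have hcont : ContinuousAt (fun s : ℝ => z' + s • (y j - y i)) 0 := by fun_prop
  have hev : ∀ᶠ s : ℝ in 𝓝[<] 0, z' + s • (y j - y i) ∈ A.F '' L j :=
    (hcont.tendsto.mono_left nhdsWithin_le_nhds).eventually
      ((D.limit_leaf j).isOpen_image.mem_nhds (by simpa using hz'))
  obtain ⟨s, hs, hs0⟩ := (hev.and self_mem_nhdsWithin).exists
  have h1 := hge _ hs
  rw [add_sub_right_comm, inner_add_right, real_inner_smul_right] at h1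
  have h2 : s * (inner ℝ (y j - y i) (y j - y i) : ℝ) < 0 :=
    mul_neg_of_neg_of_pos hs0 (real_inner_self_pos.2 hne)
  linarith

theorem F_mem_closure_image (hc : c ∈ A.frame (L i)) (hq : q ∈ c) :
    A.F q ∈ closure (A.F '' L i) :=
  (D.limit_leaf i).image_closure ▸ ⟨q, hc.2 hq, rfl⟩

/-- The points of the segment between the points for two adjacent leaves. -/
theorem crosses_openSegment (hy : A.IsDual L y) (hij : i ≠ j) (hc : c ∈ A.frame (L i))
    (hc' : c ∈ A.frame (L j)) {y₀ : Plane} (h : y₀ ∈ openSegment ℝ (y i) (y j)) :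
    A.Crosses L y y₀ c := by
  obtain ⟨a, b, ha, hb, hab, rfl⟩ := h
  refine ⟨fun q hq l z hz => ?_, fun l hl m hm => ?_⟩
  · have h1 : y l - (a • y i + b • y j) = a • (y l - y i) + b • (y l - y j) := by
      rw [show a = 1 - b by linarith]; module
    rw [h1, inner_add_left, real_inner_smul_left, real_inner_smul_left]
    have hpos : ∀ k, c ∈ A.frame (L k) → l ≠ k → 0 < (inner ℝ (y l - y k) (z - A.F q) : ℝ) :=
      fun k hk hlk => D.inner_pos_of_mem_closure hy hlk.symm (D.F_mem_closure_image hk hq) hz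
    have hnn : ∀ k, c ∈ A.frame (L k) → 0 ≤ (inner ℝ (y l - y k) (z - A.F q) : ℝ) := fun k hk => by
      by_cases hlk : l = k
      · rw [hlk, sub_self, inner_zero_left]
      · exact (hpos k hk hlk).le
    -- Both terms are nonnegative, and they do not vanish together since l cannot equal both i and
    -- j.
    by_cases hli : l = i
    · have := mul_pos hb (hpos j hc' (hli ▸ hij))
      have := mul_nonneg ha.le (hnn i hc)
      linarith
    · have := mul_pos ha (hpos i hc hli)
      have := mul_nonneg hb.le (hnn j hc')
      linarith
  · obtain ⟨n, hn⟩ := (D.limit_leaf i).exists_isNormal hc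
    obtain ⟨r, hr, hyr⟩ := hy i j c n hij hc hc' hn
    have hyj : y j = y i + r • n := by rw [← hyr]; abel
    by_cases hli : l = i
    · subst hli
      obtain rfl := hn.eq (D.limit_leaf l) hc.1 hm
      refine ⟨b * r, ?_⟩
      rw [hyj, show a = 1 - b by linarith]
      module
    · have hlj : l = j := by
        by_contra hlj
        exact hlj (D.eq_of_mem_of_mem_of_mem hc hl hc' (Ne.symm hli) hij)
      subst hlj
      have hmn := D.eq_neg_of_ne hij hc hc' hn hm
      refine ⟨a * r, ?_⟩
      rw [hmn, hyj, show a = 1 - b by linarith]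
      module

/-- The points of the ray of an outer edge. -/
theorem crosses_ray (hy : A.IsDual L y) (hc : c ∈ A.frame (L i)) (hcf : c ∈ f)
    (hn : A.IsNormal (L i) c n) {r : ℝ} (hr : 0 < r) : A.Crosses L y (y i + r • n) c := by
  rw [← D.frame_eq 0] at hcf
  obtain ⟨n', hn'⟩ := (D.leaf 0).exists_isNormal hcf
  have hnn := hn.eq (D.limit_leaf i) hc.1 (D.isNormal_of_outer i hn')
  subst hnn
  refine ⟨fun q hq l z hz => ?_, fun l hl m hm => ?_⟩
  · rw [← sub_sub, inner_sub_left, real_inner_smul_left]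
    have h1 := hn'.lt_of_mem (D.image_subset l hz) hq
    have h2 : 0 ≤ (inner ℝ (y l - y i) (z - A.F q) : ℝ) := by
      by_cases hli : l = i
      · rw [hli, sub_self, inner_zero_left]
      · exact (D.inner_pos_of_mem_closure hy (Ne.symm hli) (D.F_mem_closure_image hc hq) hz).le
    rw [inner_sub_right (𝕜 := ℝ) n']
    nlinarith
  · rw [D.frame_eq 0] at hcf
    obtain rfl := D.eq_of_mem_of_mem_outer hcf hc hl
    exact ⟨r, by rw [hm.eq (D.limit_leaf i) hc.1 hn]⟩

omit D in
theorem _root_.TwoMorse.PlaneAction.Crosses.ne {y₀ : Plane} (h : A.Crosses L y y₀ c)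
    (hL : A.IsLeaf (L i)) (hc : A.IsEdge c) : y i ≠ y₀ := fun heq => by
  obtain ⟨q, hq⟩ := hc.nonempty
  obtain ⟨x, hx⟩ := hL.nonempty
  have := h.pos q hq i _ ⟨x, hx, rfl⟩
  rw [heq, sub_self, inner_zero_left] at this
  exact lt_irrefl _ this

/-- If the edges of the web across `c` and `c'` meet, then `c'` has no point on the inner side of
`c`. -/
theorem not_inner_neg_of_crosses {y₀ : Plane} (h : A.Crosses L y y₀ c) (h' : A.Crosses L y y₀ c')
    (hc : c ∈ A.frame (L i)) (hn : A.IsNormal (L i) c n) {q q' : M} (hq : q ∈ c) (hq' : q' ∈ c') :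
    ¬ (inner ℝ n (A.F q' - A.F q) : ℝ) < 0 := fun hneg => by
  have hcont : ContinuousAt (fun s : ℝ => A.F q + s • (A.F q' - A.F q)) 0 := by fun_prop
  have hlim : Tendsto (fun s : ℝ => A.F q + s • (A.F q' - A.F q)) (𝓝[>] 0) (𝓝 (A.F q)) := by
    simpa using hcont.tendsto.mono_left (nhdsWithin_le_nhds (s := Ioi 0))
  have hlt1 : ∀ᶠ s : ℝ in 𝓝[>] 0, s < 1 :=
    mem_nhdsWithin_of_mem_nhds (gt_mem_nhds one_pos)
  -- A point of the segment from F q to F q', close to F q, lies in the tile of i. Seen from q and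
  -- from q' it lies in opposite directions, so the two positivity conditions contradict each other.
  obtain ⟨s, ⟨hs, hs1⟩, hs0⟩ := (((hlim.eventually (hn.eventually_mem (D.limit_leaf i) hc hq)).and
    hlt1).and self_mem_nhdsWithin).exists
  have hs0 : 0 < s := hs0
  have hmem := hs (by
    rw [inner_add_right, real_inner_smul_right]
    have := mul_neg_of_pos_of_neg hs0 hneg
    linarith)
  have h1 := h.pos q hq i _ hmem
  have h2 := h'.pos q' hq' i _ hmem
  rw [add_sub_cancel_left, real_inner_smul_right] at h1
  rw [show A.F q + s • (A.F q' - A.F q) - A.F q' = (-(1 - s)) • (A.F q' - A.F q) by module,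
    real_inner_smul_right] at h2
  have h3 := (pos_iff_pos_of_mul_pos h1).1 hs0
  have := mul_pos (sub_pos.2 hs1) h3
  linarith

/-- If the edges of the web across `c` and `c'` meet, then `c'` lies on the line of `c`. -/
theorem inner_eq_of_crosses {y₀ : Plane} (h : A.Crosses L y y₀ c)
    (h' : A.Crosses L y y₀ c') (hc : c ∈ A.frame (L i)) (hn : A.IsNormal (L i) c n)
    (hc' : c' ∈ A.frame (L j)) {q q' : M} (hq : q ∈ c) (hq' : q' ∈ c') :
    (inner ℝ n (A.F q') : ℝ) = inner ℝ n (A.F q) := by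
  have h1 := D.not_inner_neg_of_crosses h h' hc hn hq hq'
  rw [inner_sub_right] at h1
  rcases D.mem_or_exists_mem hc with hf | ⟨k, hki, hk⟩
  · rw [← D.frame_eq 0] at hf
    obtain ⟨m, hm⟩ := (D.leaf 0).exists_isNormal hf
    rw [hn.eq (D.limit_leaf i) hc.1 (D.isNormal_of_outer i hm)] at hm
    have := hm.le_of_mem_closure (D.closure_image_subset j (D.F_mem_closure_image hc' hq')) hq
    linarith
  · obtain ⟨m, hm⟩ := (D.limit_leaf k).exists_isNormal hk
    have h2 := D.not_inner_neg_of_crosses h h' hk hm hq hq'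
    rw [D.eq_neg_of_ne hki.symm hc hk hn hm, inner_neg_left, inner_sub_right] at h2
    linarith

/-- Edges of the web across different critical edges are disjoint. -/
theorem eq_of_crosses (hy : A.IsDual L y) {y₀ : Plane} (h : A.Crosses L y y₀ c)
    (h' : A.Crosses L y y₀ c') (hc : c ∈ A.frame (L i)) (hc' : c' ∈ A.frame (L j)) : c = c' := by
  obtain ⟨n, hn⟩ := (D.limit_leaf i).exists_isNormal hc
  obtain ⟨q, hq⟩ := hc.1.nonempty
  obtain ⟨q', hq'⟩ := hc'.1.nonempty
  have heq : ∀ x ∈ c', (inner ℝ n (A.F x) : ℝ) = inner ℝ n (A.F q) := fun x hx =>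
    D.inner_eq_of_crosses h h' hc hn hc' hq hx
  -- Among the tiles at c' there is one on the same side of the common line as the tile of i at c.
  obtain ⟨k, hk, hnk⟩ : ∃ k, c' ∈ A.frame (L k) ∧ A.IsNormal (L k) c' n := by
    obtain ⟨m, hm⟩ := (D.limit_leaf j).exists_isNormal hc'
    have hmn : m = n ∨ m = -n := by
      have he := hm.edgeAt hc'.1 hq'
      obtain ⟨ε, hε, hseg⟩ := he.exists_segment
      obtain ⟨x, hx, hxF⟩ := hseg (ε / 2) (by rw [abs_of_pos (half_pos hε)]; linarith)
      rw [← hc'.1.eq_orbit hq'] at hx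
      have h1 := (heq x hx).trans (heq q' hq').symm
      rw [hxF, inner_add_right, real_inner_smul_right, add_eq_left, mul_eq_zero,
        or_iff_right (half_pos hε).ne', real_inner_comm] at h1
      rcases eq_or_eq_neg_of_inner_rot_eq_zero he.norm hn.norm h1 with h2 | h2
      · exact .inl h2.symm
      · exact .inr (by rw [h2, neg_neg])
    rcases hmn with rfl | rfl
    · exact ⟨j, hc', hm⟩
    rcases D.mem_or_exists_mem hc' with hf | ⟨k, hkj, hk⟩
    · exfalso
      rw [← D.frame_eq 0] at hf
      obtain ⟨m, hm'⟩ := (D.leaf 0).exists_isNormal hf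
      rw [hm.eq (D.limit_leaf j) hc'.1 (D.isNormal_of_outer j hm')] at hm'
      obtain ⟨z, hz⟩ := (D.limit_leaf i).nonempty.image A.F
      have h1 := hn.lt_of_mem hz hq
      have h2 := hm'.lt_of_mem (D.image_subset i hz) hq'
      rw [inner_neg_left, inner_neg_left, heq q' hq'] at h2
      linarith
    · obtain ⟨m, hm'⟩ := (D.limit_leaf k).exists_isNormal hk
      refine ⟨k, hk, ?_⟩
      have := D.eq_neg_of_ne hkj.symm hc' hk hm hm'
      rw [neg_neg] at this
      rwa [← this]
  by_cases hik : i = k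
  · subst hik
    exact hn.eq_of_eq (D.limit_leaf i) hc hk hnk
  · exfalso
    -- Both y i and y k differ from y₀ by multiples of n, so y k - y i is parallel to n. Points of
    -- the two tiles at equal depth behind the common line then give inner product 0, against the
    -- positivity for different tiles.
    obtain ⟨s, hs⟩ := h.offset i hc n hn
    obtain ⟨s', hs'⟩ := h'.offset k hk n hnk
    have hcont : ∀ x : M, Tendsto (fun s : ℝ => A.F x + s • n) (𝓝[<] 0) (𝓝 (A.F x)) := fun x => by
      have : ContinuousAt (fun s : ℝ => A.F x + s • n) 0 := by fun_prop
      simpa using this.tendsto.mono_left (nhdsWithin_le_nhds (s := Iio 0))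
    obtain ⟨t, ⟨h1, h2⟩, ht⟩ := ((((hcont q).eventually
      (hn.eventually_mem (D.limit_leaf i) hc hq)).and ((hcont q').eventually
        (hnk.eventually_mem (D.limit_leaf k) hk hq'))).and self_mem_nhdsWithin).exists
    have ht : t < 0 := ht
    have hin : ∀ x : M, (inner ℝ n (A.F x + t • n) : ℝ) < inner ℝ n (A.F x) := fun x => by
      rw [inner_add_right, real_inner_smul_right, inner_self_eq_one hn.norm]; linarith
    have h3 := D.inner_pos hy hik (h1 (hin q)) (h2 (hin q'))
    have hyy : y k - y i = (s - s') • n := by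
      have : y i + s • n = y k + s' • n := hs.symm.trans hs'
      rw [sub_smul, sub_eq_sub_iff_add_eq_add, add_comm (s • n), this]
    rw [hyy, real_inner_smul_left, add_sub_add_right_eq_sub, inner_sub_right, heq q' hq', sub_self,
      mul_zero] at h3
    exact lt_irrefl _ h3

end Degeneration

end PlaneAction

/-! ### From the action of the plane back to the dual graph. -/

section Bridge

variable {n : ℕ} {M : Type*} [TopologicalSpace M] [T2Space M] [CompactSpace M]
    [ChartedSpace (EuclideanSpace ℝ (Fin n)) M] [IsManifold (𝓡 n) ∞ M]
    {v w : (x : M) → TangentSpace (𝓡 n) x} {fv fw : M → ℝ} {A : PlaneAction M}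

/-- A vector orthogonal to u is d = t • rot u, and then d 1 • v - d 0 • w is t times the field of u.
So having d as a direction of the edge means that u stabilizes it. -/
theorem isOutwardNormal_iff (hF : A.F = proj fv fw)
    (hstab : ∀ x ∈ A.dom, ∀ u, combField v w u x = 0 ↔ A.act u x = x) {L c : Set M}
    (hc : A.IsEdge c) (u : Plane) : IsOutwardNormal v w fv fw L c u ↔ A.IsNormal L c u := by
  have hcd : ∀ q ∈ c, q ∈ A.dom := by
    obtain ⟨q, hq, -, -, rfl⟩ := hc
    exact fun _ h => PlaneAction.orbit_subset_dom hq h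
  constructor
  · rintro ⟨h1, ⟨d, ⟨hd0, hd⟩, hud⟩, h3⟩
    refine ⟨h1, fun q hq => (hstab q (hcd q hq) u).1 ?_, by rwa [hF]⟩
    have h4 := eq_smul_rot_of_inner_eq_zero h1 hud
    set t : ℝ := inner ℝ (rot u) d
    have ht : t ≠ 0 := by
      intro ht
      rw [ht, zero_smul] at h4
      exact hd0 h4
    have h5 := hd q hq
    have e0 : d 0 = t * -u 1 := by rw [h4]; rfl
    have e1 : d 1 = t * u 0 := by rw [h4]; rfl
    have h6 : t • combField v w u q = 0 := by
      rw [← h5, e0, e1, combField]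
      module
    exact (smul_eq_zero.1 h6).resolve_left ht
  · intro h
    refine ⟨h.norm, ⟨rot u, ⟨?_, fun q hq => ?_⟩, inner_rot_self u⟩, by rw [← hF]; exact h.lt⟩
    · rw [← norm_ne_zero_iff, norm_rot, h.norm]; exact one_ne_zero
    · have := (hstab q (hcd q hq) u).2 (h.stab q hq)
      rw [← this, combField, rot_zero_apply, rot_one_apply]
      module

theorem isNormal_outwardNormal (hF : A.F = proj fv fw)
    (hstab : ∀ x ∈ A.dom, ∀ u, combField v w u x = 0 ↔ A.act u x = x) {L c : Set M}
    (hL : A.IsLeaf L) (hc : c ∈ A.frame L) : A.IsNormal L c (outwardNormal v w fv fw L c) := by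
  obtain ⟨u, hu⟩ := hL.exists_isNormal hc
  exact (isOutwardNormal_iff hF hstab hc.1 _).1
    (Classical.epsilon_spec ⟨u, (isOutwardNormal_iff hF hstab hc.1 u).2 hu⟩)

theorem frame_eq (hedge : ∀ c, IsCriticalEdge v w c ↔ A.IsEdge c) (L : Set M) :
    frame v w L = A.frame L := by
  ext c
  exact and_congr_left fun _ => hedge c

variable {f : Set (Set M)} {Λ : ℕ → Set M} {k : ℕ} {L : Fin k → Set M}

theorem Degenerates.degeneration (hleaf : ∀ S, IsLeaf v w S ↔ A.IsLeaf S)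
    (hedge : ∀ c, IsCriticalEdge v w c ↔ A.IsEdge c) (h : Degenerates v w f Λ L) :
    A.Degeneration f Λ L :=
  ⟨fun m => (hleaf _).1 (h.leaf m), fun m => (frame_eq hedge _).symm.trans (h.boundary m),
    fun i => (hleaf _).1 (h.limit_leaf i), h.distinct, h.upper, h.lower⟩

section Graph

variable (hF : A.F = proj fv fw)
  (hstab : ∀ x ∈ A.dom, ∀ u, combField v w u x = 0 ↔ A.act u x = x)
  (hedge : ∀ c, IsCriticalEdge v w c ↔ A.IsEdge c) (D : A.Degeneration f Λ L)

namespace DualEdge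

include hedge in
theorem mem_frame_src (e : DualEdge v w f L) {i : Fin k} (h : e.src = some i) :
    e.wall ∈ A.frame (L i) := by
  have := e.mem_src
  rw [h] at this
  exact frame_eq hedge (L i) ▸ this

include hedge in
theorem mem_frame_tgt (e : DualEdge v w f L) {i : Fin k} (h : e.tgt = some i) :
    e.wall ∈ A.frame (L i) := by
  have := e.mem_tgt
  rw [h] at this
  exact frame_eq hedge (L i) ▸ this

theorem mem_outer_src (e : DualEdge v w f L) (h : e.src = none) : e.wall ∈ f := by
  have := e.mem_src
  rwa [h] at this

theorem mem_outer_tgt (e : DualEdge v w f L) (h : e.tgt = none) : e.wall ∈ f := by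
  have := e.mem_tgt
  rwa [h] at this

theorem exists_tgt (e : DualEdge v w f L) (h : e.src = none) : ∃ j, e.tgt = some j :=
  Option.ne_none_iff_exists'.1 fun h' => e.ne (h.trans h'.symm)

theorem exists_mem_frame (e : DualEdge v w f L) : ∃ i, e.src = some i ∨ e.tgt = some i := by
  rcases hs : e.src with _ | i
  · obtain ⟨j, hj⟩ := e.exists_tgt hs
    exact ⟨j, .inr hj⟩
  · exact ⟨i, .inl rfl⟩

theorem dir_of_src (e : DualEdge v w f L) {i : Fin k} (h : e.src = some i) :
    e.dir fv fw = outwardNormal v w fv fw (L i) e.wall := by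
  obtain ⟨s, t, c, hne, hs, ht⟩ := e
  subst h
  rfl

theorem dir_of_tgt (e : DualEdge v w f L) (h : e.src = none) {j : Fin k} (h' : e.tgt = some j) :
    e.dir fv fw = - outwardNormal v w fv fw (L j) e.wall := by
  obtain ⟨s, t, c, hne, hs, ht⟩ := e
  subst h h'
  rfl

include hF hstab hedge D

theorem isNormal_dir (e : DualEdge v w f L) {i : Fin k} (h : e.src = some i) :
    A.IsNormal (L i) e.wall (e.dir fv fw) := by
  rw [e.dir_of_src h]
  exact isNormal_outwardNormal hF hstab (D.limit_leaf i) (e.mem_frame_src hedge h)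

/-- An outward normal of the outer image is also one for the tile at that edge, by inclusion of the
images. So the fan at infinity is minus the fan of normals of the outer leaf. -/
theorem isNormal_neg_dir (e : DualEdge v w f L) (h : e.src = none) :
    A.IsNormal (Λ 0) e.wall (-e.dir fv fw) := by
  obtain ⟨j, hj⟩ := e.exists_tgt h
  have hc := e.mem_frame_tgt hedge hj
  have hcf : e.wall ∈ A.frame (Λ 0) := (D.frame_eq 0).symm ▸ e.mem_outer_src h
  obtain ⟨m, hm⟩ := (D.leaf 0).exists_isNormal hcf
  rw [e.dir_of_tgt h hj, neg_neg, (D.isNormal_of_outer j hm).eq (D.limit_leaf j) hc.1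
    (isNormal_outwardNormal hF hstab (D.limit_leaf j) hc)]
  exact hm

theorem norm_dir (e : DualEdge v w f L) : ‖e.dir fv fw‖ = 1 := by
  rcases h : e.src with _ | i
  · rw [← norm_neg]
    exact (e.isNormal_neg_dir hF hstab hedge D h).norm
  · exact (e.isNormal_dir hF hstab hedge D h).norm

omit hF hstab in
/-- The faces that an edge joins are determined by one of them and the crossed critical edge. -/
theorem tgt_eq_of_wall_eq {e e' : DualEdge v w f L} (hs : e.src = e'.src)
    (hw : e.wall = e'.wall) : e.tgt = e'.tgt := by
  rcases h : e.src with _ | i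
  · obtain ⟨j, hj⟩ := e.exists_tgt h
    obtain ⟨j', hj'⟩ := e'.exists_tgt (hs ▸ h)
    rw [hj, hj', D.eq_of_mem_of_mem_outer (e.mem_outer_src h) (e.mem_frame_tgt hedge hj)
      (hw ▸ e'.mem_frame_tgt hedge hj')]
  · have hi := e.mem_frame_src hedge h
    rcases ht : e.tgt with _ | j <;> rcases ht' : e'.tgt with _ | j'
    · rfl
    · have := D.eq_of_mem_of_mem_outer (e.mem_outer_tgt ht) hi (hw ▸ e'.mem_frame_tgt hedge ht')
      exact absurd (this ▸ (hs.symm.trans h)) (ht' ▸ e'.ne)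
    · have := D.eq_of_mem_of_mem_outer (hw ▸ e'.mem_outer_tgt ht') hi (e.mem_frame_tgt hedge ht)
      exact absurd (this ▸ h) (ht ▸ e.ne)
    · rw [D.eq_of_mem_of_mem_of_mem hi (e.mem_frame_tgt hedge ht)
        (hw ▸ e'.mem_frame_tgt hedge ht') (fun hh => e.ne (by rw [h, ht, hh]))
        (fun hh => e'.ne (by rw [← hs, h, ht', hh]))]

omit hF hstab in
-- A wall has exactly two faces, counting the exterior one.
theorem eq_of_src_eq {e e' : DualEdge v w f L} (hs : e.src = e'.src) (hw : e.wall = e'.wall) :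
    e = e' :=
  DualEdge.ext hs (tgt_eq_of_wall_eq hedge D hs hw) hw

omit hF hstab in
theorem eq_or_eq_rev {e e' : DualEdge v w f L} (hw : e.wall = e'.wall) :
    e' = e ∨ e' = (dualGraph v w fv fw f L).rev e := by
  suffices h : e.src = e'.src ∨ e.tgt = e'.src by
    rcases h with h | h
    · exact .inl (eq_of_src_eq hedge D h.symm hw.symm)
    · exact .inr (eq_of_src_eq hedge D (e := e') (e' := (dualGraph v w fv fw f L).rev e)
        h.symm hw.symm)
  rcases hs' : e'.src with _ | l
  · have hf : e.wall ∈ f := hw ▸ e'.mem_outer_src hs'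
    rcases hs : e.src with _ | i <;> rcases ht : e.tgt with _ | j
    · exact .inl rfl
    · exact .inl rfl
    · exact .inr rfl
    · have := D.eq_of_mem_of_mem_outer hf (e.mem_frame_src hedge hs) (e.mem_frame_tgt hedge ht)
      exact absurd (by rw [hs, ht, this]) e.ne
  · have hl : e.wall ∈ A.frame (L l) := hw ▸ e'.mem_frame_src hedge hs'
    rcases hs : e.src with _ | i <;> rcases ht : e.tgt with _ | j
    · exact absurd (hs.trans ht.symm) e.ne
    · exact .inr (by rw [D.eq_of_mem_of_mem_outer (e.mem_outer_src hs)
        (e.mem_frame_tgt hedge ht) hl])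
    · exact .inl (by rw [D.eq_of_mem_of_mem_outer (e.mem_outer_tgt ht)
        (e.mem_frame_src hedge hs) hl])
    · by_cases hil : i = l
      · exact .inl (by rw [hil])
      · refine .inr (by rw [D.eq_of_mem_of_mem_of_mem (e.mem_frame_src hedge hs)
          (e.mem_frame_tgt hedge ht) hl (fun h => e.ne (by rw [hs, ht, h])) hil])

omit hF hstab in
theorem finite : Finite (DualEdge v w f L) := by
  have hfin : ((⋃ i, A.frame (L i)) : Set (Set M)).Finite := D.finite_iUnion_frame
  have := hfin.to_subtype
  have hmem : ∀ e : DualEdge v w f L, e.wall ∈ ⋃ i, A.frame (L i) := fun e => by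
    obtain ⟨i, h | h⟩ := e.exists_mem_frame
    · exact mem_iUnion.2 ⟨i, e.mem_frame_src hedge h⟩
    · exact mem_iUnion.2 ⟨i, e.mem_frame_tgt hedge h⟩
  refine Finite.of_injective (β := Option (Fin k) × (⋃ i, A.frame (L i) : Set (Set M)))
    (fun e => (e.src, ⟨e.wall, hmem e⟩)) fun e e' h => ?_
  simp only [Prod.mk.injEq, Subtype.mk.injEq] at h
  exact eq_of_src_eq hedge D h.1 h.2

end DualEdge

include hF hstab hedge D

/-- At each vertex the outgoing directions are, up to a common sign, all the outward normals of one
leaf: L i at a finite vertex, Λ 0 at infinity. They are pairwise different and meet every open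
half-plane. -/
theorem isGraphWithDirections_dualGraph : (dualGraph v w fv fw f L).IsGraphWithDirections where
  finite_vertices := inferInstanceAs (Finite (Fin k))
  dir_rev e := by
    set e' : DualEdge v w f L := (dualGraph v w fv fw f L).rev e
    change e'.dir fv fw = - DualEdge.dir fv fw e
    rcases hs : DualEdge.src e with _ | i
    · obtain ⟨j, hj⟩ := DualEdge.exists_tgt e hs
      rw [DualEdge.dir_of_tgt e hs hj, neg_neg, DualEdge.dir_of_src e' hj]
      rfl
    · rcases ht : DualEdge.tgt e with _ | j
      · rw [DualEdge.dir_of_src e hs, DualEdge.dir_of_tgt e' ht hs]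
        rfl
      · exact D.eq_neg_of_ne (fun h => DualEdge.ne e (by rw [hs, ht, h]))
          (DualEdge.mem_frame_src hedge e hs) (DualEdge.mem_frame_tgt hedge e ht)
          (DualEdge.isNormal_dir hF hstab hedge D e hs)
          (DualEdge.isNormal_dir hF hstab hedge D e' ht)
  fan a := by
    refine ⟨?_, fun e => ?_, ?_, fun u hu => ?_⟩
    · have : Finite (dualGraph v w fv fw f L).E := DualEdge.finite hedge D
      infer_instance
    · rw [← norm_ne_zero_iff]
      exact (DualEdge.norm_dir hF hstab hedge D e.1).symm ▸ one_ne_zero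
    · rintro ⟨e, he⟩ ⟨e', he'⟩ hne hray
      have hdir : DualEdge.dir fv fw e = DualEdge.dir fv fw e' :=
        (sameRay_iff_of_norm_eq ((DualEdge.norm_dir hF hstab hedge D e).trans
          (DualEdge.norm_dir hF hstab hedge D e').symm)).1 hray
      refine hne (Subtype.ext (DualEdge.eq_of_src_eq hedge D (he.trans he'.symm) ?_))
      rcases a with _ | i
      · have h1 := DualEdge.isNormal_neg_dir hF hstab hedge D e he
        have h2 := DualEdge.isNormal_neg_dir hF hstab hedge D e' he'
        rw [← hdir] at h2
        refine h1.eq_of_eq (D.leaf 0) ?_ ?_ h2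
        · rw [D.frame_eq]; exact DualEdge.mem_outer_src e he
        · rw [D.frame_eq]; exact DualEdge.mem_outer_src e' he'
      · have h1 := DualEdge.isNormal_dir hF hstab hedge D e he
        have h2 := DualEdge.isNormal_dir hF hstab hedge D e' he'
        rw [← hdir] at h2
        exact h1.eq_of_eq (D.limit_leaf i) (DualEdge.mem_frame_src hedge e he)
          (DualEdge.mem_frame_src hedge e' he') h2
    · rcases a with _ | i
      · obtain ⟨c, hc, m, hm, hpos⟩ := (D.leaf 0).exists_inner_pos (neg_ne_zero.2 hu)
        have hcf := hc
        rw [D.frame_eq] at hcf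
        obtain ⟨i, hi⟩ := D.exists_mem_frame_of_mem hcf
        let e : DualEdge v w f L := ⟨none, some i, c, by simp, hcf,
          show c ∈ frame v w (L i) from (frame_eq hedge (L i)).symm ▸ hi⟩
        refine ⟨⟨e, rfl⟩, ?_⟩
        have h1 := (DualEdge.isNormal_neg_dir hF hstab hedge D e rfl).eq (D.leaf 0) hc.1 hm
        change 0 < inner ℝ u (e.dir fv fw)
        rw [h1, inner_neg_left, inner_neg_right, neg_neg] at hpos
        exact hpos
      · obtain ⟨c, hc, m, hm, hpos⟩ := (D.limit_leaf i).exists_inner_pos hu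
        have hcs : c ∈ faceFrame v w f L (some i) :=
          show c ∈ frame v w (L i) from (frame_eq hedge (L i)).symm ▸ hc
        obtain ⟨e, hes, hew⟩ : ∃ e : DualEdge v w f L, e.src = some i ∧ e.wall = c := by
          rcases D.mem_or_exists_mem hc with hf | ⟨j, hji, hj⟩
          · exact ⟨⟨some i, none, c, by simp, hcs, hf⟩, rfl, rfl⟩
          · exact ⟨⟨some i, some j, c, fun h => hji (Option.some.inj h).symm, hcs,
              show c ∈ frame v w (L j) from (frame_eq hedge (L j)).symm ▸ hj⟩, rfl, rfl⟩
        refine ⟨⟨e, hes⟩, ?_⟩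
        have h1 := DualEdge.isNormal_dir hF hstab hedge D e hes
        rw [hew] at h1
        change 0 < inner ℝ u (e.dir fv fw)
        rwa [← h1.eq (D.limit_leaf i) hc.1 hm]

theorem crosses_of_mem_edgeInterior {y : Fin k → Plane} (hy : A.IsDual L y)
    (e : DualEdge v w f L) {y₀ : Plane}
    (h : y₀ ∈ (dualGraph v w fv fw f L).edgeInterior y e) : A.Crosses L y y₀ e.wall := by
  obtain ⟨s, t, c, hne, hs, ht⟩ := e
  rcases s with _ | i <;> rcases t with _ | j
  · exact absurd rfl hne
  · obtain ⟨r, hr, rfl⟩ := h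
    let e' : DualEdge v w f L := ⟨some j, none, c, hne.symm, ht, hs⟩
    exact D.crosses_ray hy (e'.mem_frame_src hedge rfl) hs (e'.isNormal_dir hF hstab hedge D rfl) hr
  · obtain ⟨r, hr, rfl⟩ := h
    let e' : DualEdge v w f L := ⟨some i, none, c, hne, hs, ht⟩
    exact D.crosses_ray hy (e'.mem_frame_src hedge rfl) ht (e'.isNormal_dir hF hstab hedge D rfl) hr
  · let e' : DualEdge v w f L := ⟨some i, some j, c, hne, hs, ht⟩
    exact D.crosses_openSegment hy (fun hij => hne (by rw [hij])) (e'.mem_frame_src hedge rfl)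
      (e'.mem_frame_tgt hedge rfl) h

theorem realizable_dualGraph : (dualGraph v w fv fw f L).Realizable := by
  obtain ⟨y, hy⟩ := D.exists_points
  have hy : A.IsDual L y := hy
  have hmem : ∀ e : DualEdge v w f L, ∃ i, e.wall ∈ A.frame (L i) := fun e => by
    obtain ⟨i, h | h⟩ := e.exists_mem_frame
    · exact ⟨i, e.mem_frame_src hedge h⟩
    · exact ⟨i, e.mem_frame_tgt hedge h⟩
  refine ⟨y, isGraphWithDirections_dualGraph hF hstab hedge D, fun i j h => ?_, fun e i j hs ht => ?_,
    fun e e' h h' => ?_, fun e i h => ?_⟩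
  · by_contra hij
    exact D.ne_of_ne hy hij h
  · exact hy i j _ _ (fun hij => DualEdge.ne e (hs.trans ((congrArg some hij).trans ht.symm)))
      (DualEdge.mem_frame_src hedge e hs) (DualEdge.mem_frame_tgt hedge e ht)
      (DualEdge.isNormal_dir hF hstab hedge D e hs)
  · rw [Set.disjoint_left]
    intro y₀ h₁ h₂
    obtain ⟨i, hi⟩ := hmem e
    obtain ⟨j, hj⟩ := hmem e'
    have hw := D.eq_of_crosses hy (crosses_of_mem_edgeInterior hF hstab hedge D hy e h₁)
      (crosses_of_mem_edgeInterior hF hstab hedge D hy e' h₂) hi hj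
    rcases DualEdge.eq_or_eq_rev (fv := fv) (fw := fw) hedge D hw with h3 | h3
    · exact h h3
    · exact h' h3
  · obtain ⟨j, hj⟩ := hmem e
    exact (crosses_of_mem_edgeInterior hF hstab hedge D hy e h).ne (D.limit_leaf i) hj.1 rfl

end Graph

end Bridge

end TwoMorse

end

theorem lemma5p9 {n : ℕ} {M : Type*} [TopologicalSpace M] [T2Space M] [CompactSpace M]
    [ChartedSpace (EuclideanSpace ℝ (Fin n)) M] [IsManifold (𝓡 n) ∞ M]
    (v w : (x : M) → TangentSpace (𝓡 n) x) (fv fw : M → ℝ)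
    (hvw : TwoMorse.IsTwoMorsePair v w fv fw)
    (f : Set (Set M)) (Λ : ℕ → Set M) {k : ℕ} (L : Fin k → Set M)
    (hdeg : TwoMorse.Degenerates v w f Λ L) :
    (TwoMorse.dualGraph v w fv fw f L).IsGraphWithDirections ∧
      (TwoMorse.dualGraph v w fv fw f L).Realizable := by
  obtain ⟨A, hF, hleaf, hedge, hstab⟩ := TwoMorse.exists_planeAction hvw
  have D := hdeg.degeneration hleaf hedge
  exact ⟨TwoMorse.isGraphWithDirections_dualGraph hF hstab hedge D,
    TwoMorse.realizable_dualGraph hF hstab hedge D⟩
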